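/- Let $\mathcal D=\{h_1,\dots,h_s\}$ be a fixed set of $s\ge 1$ distinct integers, and for a prime $p$ let $\nu_p(\mathcal D)$ be the number of residue classes modulo $p$ met by $\mathcal D$. Assume that $\mathcal D$ is admissible, i.e. $\nu_p(\mathcal D)<p$ for every prime $p$. For integers $q\ge 1$, $h\ge 0$ and $k\ge 1$ put $P=\phi(q)/q$, let $k_q(m)=1$ if $\gcd(m,q)=1$ and $k_q(m)=0$ otherwise, and define $$M_k^{\mathcal D}(q,h)=\sum_{n=0}^{q-1}\Bigl(\sum_{m=1}^{h}k_q(n+m+h_1)\cdots k_q(n+m+h_s)-h\prod_{p\mid q}\Bigl(1-\frac{\nu_p(\mathcal D)}{p}\Bigr)\Bigr)^{k}.$$ Then, with implied constants that depend only on $\mathcal D$ and $k$, the following hold for all $q$ and $h$. (i) If $h<\exp\bigl(1/(kP^{1/s})\bigr)$ and, in case $k\ge 3$, also $hP^s\ge 1$, then $$M_k^{\mathcal D}(q,h)\ll q\,(hP^s)^{k/2}.$$ (ii) In general (for all $h$, except that in case $s=1$ and $k\ge 3$ one assumes $hP\ge 1$), $$M_k^{\mathcal D}(q,h)\ll q\,h^{k/2}\,P^{sk-s^2k/2}.$$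 -/

import Mathlib

/-- `ν_p(D)`: the number of residue classes modulo `p` that are occupied by `D`. -/
def residueCount (D : Finset ℤ) (p : ℕ) : ℕ :=
  (D.image (fun x : ℤ => (x : ZMod p))).card

/-- `D` is admissible if it misses a residue class modulo every prime. -/
def Admissible (D : Finset ℤ) : Prop :=
  ∀ p : ℕ, p.Prime → residueCount D p < p

/-- `k_q`: the indicator function of the integers coprime to `q`. -/
noncomputable def coprimeIndicator (q : ℕ) (m : ℤ) : ℝ :=
  if Int.gcd m q = 1 then 1 else 0

/-- `P = φ(q) / q`. -/
noncomputable def reducedDensity (q : ℕ) : ℝ :=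
  (Nat.totient q : ℝ) / (q : ℝ)

/-- `P_D = ∏_{p ∣ q} (1 - ν_p(D) / p)`. -/
noncomputable def tupleDensity (D : Finset ℤ) (q : ℕ) : ℝ :=
  ∏ p ∈ q.primeFactors, (1 - (residueCount D p : ℝ) / (p : ℝ))

/-- The number of `m` with `1 ≤ m ≤ h` such that `n + m + d` is coprime to `q` for all `d ∈ D`. -/
noncomputable def tupleCount (D : Finset ℤ) (q h : ℕ) (n : ℤ) : ℝ :=
  ∑ m ∈ Finset.Icc 1 h, ∏ d ∈ D, coprimeIndicator q (n + (m : ℤ) + d)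

/-- `M_k^D(q, h)`: the `k`-th centred moment of the count of tuples of reduced residues. -/
noncomputable def tupleMoment (D : Finset ℤ) (k q h : ℕ) : ℝ :=
  ∑ n ∈ Finset.range q, (tupleCount D q h (n : ℤ) - (h : ℝ) * tupleDensity D q) ^ k

/-! The primes of q are sifted one at a time. By the Chinese remainder theorem the residue of n
modulo a new prime p is independent of its residues modulo the primes already used. The deviation
becomes 1 - ν_p/p times the old one plus a fluctuation of conditional mean zero (`siftDev_insert`,
`mean_fluct`). In an even moment of the deviation X the linear term then vanishes, so p costs only
the mean of X^(2m) · Var_p and the moment of order 2(m+1) of the fluctuation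
(`mean_siftDev_insert_le`), where Var_p is the conditional variance `condVar`.

If p ≥ h, then p removes at most s integers of the interval, Var_p is at most s²/p times the number
of survivors, and the recursion closes (`mean_siftDev_sq_union_le`,
`exists_mean_siftDev_pow_union_le`).

If p ≤ h, the fluctuation is made of deviations along progressions of difference p. Hölder's
inequality alone loses powers of log h (`exists_mean_siftDev_pow_le`). To do better, Var_p is
bounded by `shiftAvg`, an average of squared deviations over p consecutive starting points
(`condVar_le_shiftAvg`). The mean of `shiftAvg` is a variance, which Fourier analysis bounds by h/p
times the Euler product `varFactor` (`mean_siftDev_sq_le`). It remains to see that `shiftAvg` is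
concentrated around its mean. Its Fourier coefficient at d is a correlation of coefficients of the
deviation times an exponential sum of length p, which is large only if d is close to an integer.
With e = p d the correlation has a bound that depends on e alone, and for fixed e few primes p in
[16^j, 16^(j+1)) make d small, since such p divide one of a few integers (`card_small_roots_le`).
Hence `shiftAvg` has small variance for most primes of the block (`sum_mean_shiftAvg_sub_sq_le`).

The order of insertion is free, so each step takes a prime with small variance as long as at least
8^j primes of the block remain; the rest are paid for by Hölder (`mean_siftDev_block_le`). The
saving (3/4)^j beats the lost powers of log h as soon as j is about √(log h), and the primes below
that point are treated by Rankin's trick (`exists_mean_siftDev_verySmall_le`). The total error is of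
order h / log h, which Mertens' bound absorbs.

Together, the moment of order 2(m+1) is at most the power m+1 of a constant times h P^(2s) P₁^(-s²)
+ max(h P^s, 1), where P₁ is the coprime density for the primes p ≤ h
(`exists_mean_siftDev_pow_le_mainFactor`). Part (ii) follows from P₁ ≥ P, part (i) from 1/P₁ ≪ log h
and P (log h)^s ≪ 1. The moment of order k ≥ 3 comes from that of order 2k by Cauchy–Schwarz. -/

/-! ### Averages over a period -/

/-- The average of `f` over the integers `0 ≤ n < N`. -/
noncomputable def mean (N : ℕ) (f : ℤ → ℝ) : ℝ := (∑ n ∈ Finset.range N, f n) / N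

theorem mean_congr {N : ℕ} {f g : ℤ → ℝ} (h : ∀ n, f n = g n) : mean N f = mean N g := by
  rw [funext h]

theorem mean_mono {N : ℕ} {f g : ℤ → ℝ} (h : ∀ n, f n ≤ g n) : mean N f ≤ mean N g := by
  unfold mean
  gcongr
  exact h _

theorem mean_nonneg {N : ℕ} {f : ℤ → ℝ} (h : ∀ n, 0 ≤ f n) : 0 ≤ mean N f :=
  div_nonneg (Finset.sum_nonneg fun _ _ => h _) (Nat.cast_nonneg _)

theorem mean_add (N : ℕ) (f g : ℤ → ℝ) :
    mean N (fun n => f n + g n) = mean N f + mean N g := by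
  simp [mean, Finset.sum_add_distrib, add_div]

theorem mean_sub (N : ℕ) (f g : ℤ → ℝ) :
    mean N (fun n => f n - g n) = mean N f - mean N g := by
  simp [mean, Finset.sum_sub_distrib, sub_div]

theorem mean_const_mul (N : ℕ) (c : ℝ) (f : ℤ → ℝ) :
    mean N (fun n => c * f n) = c * mean N f := by
  simp [mean, ← Finset.mul_sum, mul_div_assoc]

theorem mean_sum {ι : Type*} (N : ℕ) (s : Finset ι) (f : ι → ℤ → ℝ) :
    mean N (fun n => ∑ i ∈ s, f i n) = ∑ i ∈ s, mean N (f i) := by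
  simp only [mean, ← Finset.sum_div]
  rw [Finset.sum_comm]

theorem mean_const {N : ℕ} (hN : 0 < N) (c : ℝ) : mean N (fun _ => c) = c := by
  have : (N : ℝ) ≠ 0 := by positivity
  simp [mean, this]

theorem mean_mul_sq_le (N : ℕ) (f g : ℤ → ℝ) :
    mean N (fun n => f n * g n) ^ 2 ≤ mean N (fun n => f n ^ 2) * mean N (fun n => g n ^ 2) := by
  unfold mean
  rw [div_pow, div_mul_div_comm, ← sq]
  gcongr
  exact Finset.sum_mul_sq_le_sq_mul_sq _ _ _

theorem sum_range_eq_sum_zmod (N : ℕ) [NeZero N] (f : ℤ → ℝ) :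
    ∑ n ∈ Finset.range N, f n = ∑ x : ZMod N, f (x.val : ℤ) := by
  refine Finset.sum_bij' (fun n _ => (n : ZMod N)) (fun x _ => x.val) ?_ ?_ ?_ ?_ ?_
  · simp
  · intro x _; simpa using ZMod.val_lt x
  · intro n hn; simpa using ZMod.val_cast_of_lt (Finset.mem_range.mp hn)
  · intro x _; simp
  · intro n hn; simp [ZMod.val_cast_of_lt (Finset.mem_range.mp hn)]

theorem Function.Periodic.eq_of_intCast_eq {N : ℕ} {α : Type*} {f : ℤ → α}
    (hf : Function.Periodic f (N : ℤ)) {a b : ℤ} (h : (a : ZMod N) = b) : f a = f b := by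
  obtain ⟨c, hc⟩ := (ZMod.intCast_eq_intCast_iff_dvd_sub a b N).mp h
  have : b = a + c * (N : ℤ) := by linarith
  rw [this]
  exact ((hf.int_mul c) a).symm

theorem mean_comp_add {N : ℕ} {f : ℤ → ℝ} (hf : Function.Periodic f (N : ℤ)) (c : ℤ) :
    mean N (fun n => f (n + c)) = mean N f := by
  rcases Nat.eq_zero_or_pos N with rfl | hN
  · simp [mean]
  have : NeZero N := ⟨hN.ne'⟩
  unfold mean
  congr 1
  rw [sum_range_eq_sum_zmod N f, sum_range_eq_sum_zmod N (fun n => f (n + c)),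
    ← Equiv.sum_comp (Equiv.addRight (c : ZMod N)) fun x : ZMod N => f (x.val : ℤ)]
  refine Finset.sum_congr rfl fun x _ => hf.eq_of_intCast_eq ?_
  simp

theorem mean_mul_of_periodic {a : ℕ} {f : ℤ → ℝ} (hf : Function.Periodic f (a : ℤ)) {b : ℕ}
    (hb : 0 < b) : mean (a * b) f = mean a f := by
  have key : ∀ b : ℕ, ∑ n ∈ Finset.range (a * b), f n = b * ∑ n ∈ Finset.range a, f n := by
    intro b
    induction b with
    | zero => simp
    | succ b ih =>
      rw [Nat.mul_succ, Finset.sum_range_add, ih]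
      push_cast
      rw [add_mul, one_mul]
      congr 1
      refine Finset.sum_congr rfl fun i _ => ?_
      have := (hf.int_mul b) (i : ℤ)
      rw [← this]
      congr 1
      push_cast
      ring
  unfold mean
  rw [key]
  rcases Nat.eq_zero_or_pos a with rfl | ha
  · simp
  · push_cast
    field_simp

/-- Independence of residues to coprime moduli. The two occurrences of n are separated into two
slots of `Φ`, so that the residue modulo b can be averaged with the residue modulo a held fixed. -/
theorem mean_crt {a b : ℕ} (hab : Nat.Coprime a b) (Φ : ℤ → ℤ → ℝ)
    (h₁ : ∀ c, Function.Periodic (fun n => Φ n c) (a : ℤ))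
    (h₂ : ∀ n, Function.Periodic (Φ n) (b : ℤ)) :
    mean (a * b) (fun n => Φ n n) = mean a (fun n => mean b (Φ n)) := by
  rcases Nat.eq_zero_or_pos a with rfl | ha
  · simp [mean]
  rcases Nat.eq_zero_or_pos b with rfl | hb
  · simp [mean]
  have : NeZero a := ⟨ha.ne'⟩
  have : NeZero b := ⟨hb.ne'⟩
  have hs : ∑ n ∈ Finset.range (a * b), Φ n n
      = ∑ n ∈ Finset.range a, ∑ c ∈ Finset.range b, Φ n c := by
    rw [sum_range_eq_sum_zmod (a * b) (fun n => Φ n n)]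
    rw [sum_range_eq_sum_zmod a (fun n : ℤ => ∑ c ∈ Finset.range b, Φ n c)]
    simp_rw [fun n : ℤ => sum_range_eq_sum_zmod b (Φ n)]
    rw [← Fintype.sum_prod_type' (fun (x : ZMod a) (y : ZMod b) => Φ (x.val : ℤ) (y.val : ℤ)),
      ← Equiv.sum_comp (ZMod.chineseRemainder hab).toEquiv]
    refine Finset.sum_congr rfl fun x _ => ?_
    have e1 : (((ZMod.chineseRemainder hab) x).1 : ZMod a) = ((x.val : ℤ) : ZMod a) := by
      conv_lhs => rw [← ZMod.natCast_zmod_val x, map_natCast]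
      rw [Int.cast_natCast]
      rfl
    have e2 : (((ZMod.chineseRemainder hab) x).2 : ZMod b) = ((x.val : ℤ) : ZMod b) := by
      conv_lhs => rw [← ZMod.natCast_zmod_val x, map_natCast]
      rw [Int.cast_natCast]
      rfl
    calc Φ x.val x.val = Φ (((ZMod.chineseRemainder hab) x).1.val : ℤ) x.val :=
          (h₁ _).eq_of_intCast_eq (by rw [← e1]; simp)
      _ = _ := (h₂ _).eq_of_intCast_eq (by rw [← e2]; simp)
  unfold mean
  rw [hs, ← Finset.sum_div, div_div]
  push_cast
  rw [mul_comm (b : ℝ)]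

/-! ### Sifting by one more prime -/

/-- The indicator function of the integers that avoid the classes `Ω p` modulo every `p ∈ S`. -/
noncomputable def sift (S : Finset ℕ) (Ω : (p : ℕ) → Finset (ZMod p)) (n : ℤ) : ℝ :=
  ∏ p ∈ S, if (n : ZMod p) ∈ Ω p then 0 else 1

/-- The number of `1 ≤ t ≤ h` such that `n + g * t` survives the sieve. -/
noncomputable def siftCount (S : Finset ℕ) (Ω : (p : ℕ) → Finset (ZMod p)) (g h : ℕ) (n : ℤ) : ℝ :=
  ∑ t ∈ Finset.Icc 1 h, sift S Ω (n + g * t)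

/-- The density of the integers that survive the sieve. -/
noncomputable def siftDensity (S : Finset ℕ) (Ω : (p : ℕ) → Finset (ZMod p)) : ℝ :=
  ∏ p ∈ S, (1 - ((Ω p).card : ℝ) / p)

/-- The deviation of the sifted count from its mean. -/
noncomputable def siftDev (S : Finset ℕ) (Ω : (p : ℕ) → Finset (ZMod p)) (g h : ℕ) (n : ℤ) : ℝ :=
  siftCount S Ω g h n - h * siftDensity S Ω

/-- The number of survivors `n + g * t` removed by the prime `p` when its residue is that of `c`. -/
noncomputable def hitCount (S : Finset ℕ) (Ω : (p : ℕ) → Finset (ZMod p)) (g h p : ℕ)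
    (n c : ℤ) : ℝ :=
  ∑ t ∈ Finset.Icc 1 h, if ((c + g * t : ℤ) : ZMod p) ∈ Ω p then sift S Ω (n + g * t) else 0

/-- The centred number of survivors removed by the prime `p`, with the opposite sign. -/
noncomputable def fluct (S : Finset ℕ) (Ω : (p : ℕ) → Finset (ZMod p)) (g h p : ℕ)
    (n c : ℤ) : ℝ :=
  ((Ω p).card : ℝ) / p * siftCount S Ω g h n - hitCount S Ω g h p n c

/-- The conditional variance of the number of survivors removed by `p`. -/
noncomputable def condVar (S : Finset ℕ) (Ω : (p : ℕ) → Finset (ZMod p)) (g h p : ℕ)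
    (n : ℤ) : ℝ :=
  mean p (fun c => fluct S Ω g h p n c ^ 2)

section sieve

variable {S : Finset ℕ} {Ω : (p : ℕ) → Finset (ZMod p)} {g h p : ℕ}

theorem sift_nonneg (n : ℤ) : 0 ≤ sift S Ω n :=
  Finset.prod_nonneg fun _ _ => by split_ifs <;> norm_num

theorem sift_le_one (n : ℤ) : sift S Ω n ≤ 1 :=
  Finset.prod_le_one (fun _ _ => by split_ifs <;> norm_num) fun _ _ => by split_ifs <;> norm_num

theorem siftCount_nonneg (n : ℤ) : 0 ≤ siftCount S Ω g h n :=
  Finset.sum_nonneg fun _ _ => sift_nonneg _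

theorem siftCount_le (n : ℤ) : siftCount S Ω g h n ≤ h := by
  refine (Finset.sum_le_sum fun _ _ => sift_le_one _).trans ?_
  simp

theorem sift_periodic : Function.Periodic (sift S Ω) ((∏ p ∈ S, p : ℕ) : ℤ) := by
  intro n
  refine Finset.prod_congr rfl fun p hp => ?_
  have : (((∏ p ∈ S, p : ℕ) : ℤ) : ZMod p) = 0 := by
    rw [Int.cast_natCast, ZMod.natCast_eq_zero_iff]
    exact Finset.dvd_prod_of_mem _ hp
  rw [Int.cast_add, this, add_zero]

theorem siftCount_periodic :
    Function.Periodic (siftCount S Ω g h) ((∏ p ∈ S, p : ℕ) : ℤ) := by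
  intro n
  refine Finset.sum_congr rfl fun t _ => ?_
  rw [add_right_comm]
  exact sift_periodic _

theorem siftDev_periodic :
    Function.Periodic (siftDev S Ω g h) ((∏ p ∈ S, p : ℕ) : ℤ) := by
  intro n
  simp only [siftDev, siftCount_periodic n]

theorem hitCount_periodic_left (c : ℤ) :
    Function.Periodic (fun n => hitCount S Ω g h p n c) ((∏ p ∈ S, p : ℕ) : ℤ) := by
  intro n
  refine Finset.sum_congr rfl fun t _ => ?_
  rw [add_right_comm, sift_periodic]

theorem hitCount_periodic_right (n : ℤ) :
    Function.Periodic (hitCount S Ω g h p n) (p : ℤ) := by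
  intro c
  refine Finset.sum_congr rfl fun t _ => ?_
  simp

theorem fluct_periodic_left (c : ℤ) :
    Function.Periodic (fun n => fluct S Ω g h p n c) ((∏ p ∈ S, p : ℕ) : ℤ) := by
  intro n
  have := hitCount_periodic_left (S := S) (Ω := Ω) (g := g) (h := h) (p := p) c n
  simp only at this
  simp only [fluct, siftCount_periodic n, this]

theorem fluct_periodic_right (n : ℤ) : Function.Periodic (fluct S Ω g h p n) (p : ℤ) := by
  intro c
  simp only [fluct, hitCount_periodic_right n c]

theorem condVar_nonneg (n : ℤ) : 0 ≤ condVar S Ω g h p n :=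
  mean_nonneg fun _ => sq_nonneg _

theorem siftDensity_insert (hp : p ∉ S) :
    siftDensity (insert p S) Ω = (1 - ((Ω p).card : ℝ) / p) * siftDensity S Ω :=
  Finset.prod_insert hp

theorem siftCount_insert (hp : p ∉ S) (n : ℤ) :
    siftCount (insert p S) Ω g h n = siftCount S Ω g h n - hitCount S Ω g h p n n := by
  unfold siftCount hitCount
  rw [← Finset.sum_sub_distrib]
  refine Finset.sum_congr rfl fun t _ => ?_
  rw [sift, Finset.prod_insert hp]
  split_ifs <;> simp [sift]

/-- A martingale decomposition: the survivors removed by p are replaced by their conditional mean,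
which rescales the old deviation, and what remains is the fluctuation. The last argument of `fluct`
matters only modulo p, the other only modulo the primes of S. -/
theorem siftDev_insert (hp : p ∉ S) (n : ℤ) :
    siftDev (insert p S) Ω g h n
      = (1 - ((Ω p).card : ℝ) / p) * siftDev S Ω g h n + fluct S Ω g h p n n := by
  rw [siftDev, siftCount_insert hp, siftDensity_insert hp, siftDev, fluct]
  ring

theorem card_div_le_one (hp : 0 < p) : ((Ω p).card : ℝ) / p ≤ 1 := by
  have : NeZero p := ⟨hp.ne'⟩
  rw [div_le_one (by exact_mod_cast hp)]
  have := (Ω p).card_le_univ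
  rw [ZMod.card] at this
  exact_mod_cast this

theorem siftDensity_nonneg (hS : ∀ p ∈ S, p.Prime) : 0 ≤ siftDensity S Ω :=
  Finset.prod_nonneg fun p hp => sub_nonneg.mpr (card_div_le_one (hS p hp).pos)

theorem siftDensity_le_one (hS : ∀ p ∈ S, p.Prime) : siftDensity S Ω ≤ 1 :=
  Finset.prod_le_one (fun p hp => sub_nonneg.mpr (card_div_le_one (hS p hp).pos))
    fun p hp => sub_le_self _ (by positivity)

theorem mean_indicator_add (hp : 0 < p) (b : ℤ) :
    mean p (fun c => if ((c + b : ℤ) : ZMod p) ∈ Ω p then (1 : ℝ) else 0)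
      = ((Ω p).card : ℝ) / p := by
  have : NeZero p := ⟨hp.ne'⟩
  have hper : Function.Periodic (fun c : ℤ => if (c : ZMod p) ∈ Ω p then (1 : ℝ) else 0)
      (p : ℤ) := by
    intro c; simp
  rw [mean_comp_add hper b, mean,
    sum_range_eq_sum_zmod p (fun c : ℤ => if (c : ZMod p) ∈ Ω p then (1 : ℝ) else 0)]
  congr 1
  simp

theorem mean_hitCount (hp : 0 < p) (n : ℤ) :
    mean p (hitCount S Ω g h p n) = ((Ω p).card : ℝ) / p * siftCount S Ω g h n := by
  have : hitCount S Ω g h p n = fun c => ∑ t ∈ Finset.Icc 1 h, sift S Ω (n + g * t) *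
      (if ((c + g * t : ℤ) : ZMod p) ∈ Ω p then 1 else 0) := by
    funext c
    refine Finset.sum_congr rfl fun t _ => ?_
    split_ifs <;> simp
  rw [this, mean_sum, siftCount, Finset.mul_sum]
  refine Finset.sum_congr rfl fun t _ => ?_
  rw [mean_const_mul, mean_indicator_add hp, mul_comm]

theorem mean_fluct (hp : 0 < p) (n : ℤ) : mean p (fluct S Ω g h p n) = 0 := by
  have : fluct S Ω g h p n = fun c => ((Ω p).card : ℝ) / p * siftCount S Ω g h n
    - hitCount S Ω g h p n c := rfl
  rw [this, mean_sub, mean_const hp, mean_hitCount hp, sub_self]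

/-- Binomial expansion to second order, for even exponents. -/
theorem add_pow_two_mul_le (m : ℕ) (x d : ℝ) :
    (x + d) ^ (2 * (m + 1)) ≤ x ^ (2 * (m + 1)) + (2 * (m + 1) : ℕ) * x ^ (2 * m + 1) * d
      + 4 ^ (m + 1) * (x ^ (2 * m) * d ^ 2 + d ^ (2 * (m + 1))) := by
  set k := 2 * m with hk
  have hk2 : 2 * (m + 1) = k + 2 := by omega
  rw [hk2, add_comm x d, add_pow, Finset.sum_range_succ', Finset.sum_range_succ']
  simp only [pow_zero, one_mul, Nat.sub_zero, Nat.choose_zero_right, Nat.cast_one, mul_one,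
    zero_add, pow_one, Nat.choose_one_right]
  have hE : Even k := ⟨m, by omega⟩
  have hx : 0 ≤ x ^ k := hE.pow_nonneg x
  have hterm : ∀ j ∈ Finset.range (k + 1), d ^ (j + 1 + 1) * x ^ (k + 2 - (j + 1 + 1)) *
      ((k + 2).choose (j + 1 + 1) : ℝ)
      ≤ ((k + 2).choose (j + 1 + 1) : ℝ) * (x ^ k * d ^ 2 + d ^ (k + 2)) := by
    intro j hj
    rw [mul_comm]
    refine mul_le_mul_of_nonneg_left ?_ (by positivity)
    have hj' : j ≤ k := by simpa [Nat.lt_succ_iff] using hj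
    have e : k + 2 - (j + 1 + 1) = k - j := by omega
    rw [e]
    refine (le_abs_self _).trans ?_
    rw [abs_mul, abs_pow, abs_pow]
    have hxk : x ^ k = |x| ^ k := (hE.pow_abs x).symm
    have hdk : d ^ (k + 2) = |d| ^ (k + 2) := ((hE.add even_two).pow_abs d).symm
    rw [hxk, hdk, ← sq_abs d]
    have ha := abs_nonneg x
    have hb := abs_nonneg d
    rcases le_total (|d|) (|x|) with hle | hle
    · calc |d| ^ (j + 1 + 1) * |x| ^ (k - j) = |d| ^ 2 * (|d| ^ j * |x| ^ (k - j)) := by ring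
        _ ≤ |d| ^ 2 * (|x| ^ j * |x| ^ (k - j)) := by gcongr
        _ = |x| ^ k * |d| ^ 2 := by rw [← pow_add, Nat.add_sub_cancel' hj']; ring
        _ ≤ _ := le_add_of_nonneg_right (by positivity)
    · calc |d| ^ (j + 1 + 1) * |x| ^ (k - j) ≤ |d| ^ (j + 1 + 1) * |d| ^ (k - j) := by gcongr
        _ = |d| ^ (k + 2) := by rw [← pow_add]; congr 1; omega
        _ ≤ _ := le_add_of_nonneg_left (by positivity)
  have hsum := Finset.sum_le_sum hterm
  rw [← Finset.sum_mul] at hsum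
  have hch : ∑ j ∈ Finset.range (k + 1), ((k + 2).choose (j + 1 + 1) : ℝ) ≤ 4 ^ (m + 1) := by
    have := Nat.sum_range_choose (k + 2)
    rw [Finset.sum_range_succ', Finset.sum_range_succ'] at this
    have h4 : (2 : ℕ) ^ (k + 2) = 4 ^ (m + 1) := by
      rw [← hk2, pow_mul]; norm_num
    have : ∑ j ∈ Finset.range (k + 1), (k + 2).choose (j + 1 + 1) ≤ 4 ^ (m + 1) := by omega
    exact_mod_cast this
  have hnn : 0 ≤ x ^ k * d ^ 2 + d ^ (k + 2) :=
    add_nonneg (mul_nonneg hx (sq_nonneg d)) ((hE.add even_two).pow_nonneg d)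
  have := hsum.trans (mul_le_mul_of_nonneg_right hch hnn)
  have e : k + 2 - 1 = k + 1 := by omega
  rw [e]
  push_cast at this ⊢
  linarith [this]

theorem coprime_prod_of_notMem (hS : ∀ p ∈ S, p.Prime) (hp : p.Prime) (hmem : p ∉ S) :
    Nat.Coprime (∏ p ∈ S, p) p :=
  Nat.Coprime.prod_left fun l hl =>
    (Nat.coprime_primes (hS l hl) hp).mpr fun h => hmem (h ▸ hl)

theorem mean_siftDev_insert_pow (hS : ∀ p ∈ S, p.Prime) (hp : p.Prime) (hmem : p ∉ S) (k : ℕ) :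
    mean (∏ l ∈ insert p S, l) (fun n => siftDev (insert p S) Ω g h n ^ k)
      = mean (∏ l ∈ S, l) (fun n => mean p fun c =>
        ((1 - ((Ω p).card : ℝ) / p) * siftDev S Ω g h n + fluct S Ω g h p n c) ^ k) := by
  rw [Finset.prod_insert hmem, mul_comm]
  simp_rw [siftDev_insert hmem]
  refine mean_crt (coprime_prod_of_notMem hS hp hmem)
    (fun n c => ((1 - ((Ω p).card : ℝ) / p) * siftDev S Ω g h n + fluct S Ω g h p n c) ^ k) ?_ ?_
  · intro c n
    have := fluct_periodic_left (S := S) (Ω := Ω) (g := g) (h := h) (p := p) c n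
    simp only at this
    simp only [siftDev_periodic n, this]
  · intro n c
    simp only [fluct_periodic_right n c]

/-- An equality, because the cross term is linear in the fluctuation and averages to zero. -/
theorem mean_siftDev_insert_sq (hS : ∀ p ∈ S, p.Prime) (hp : p.Prime) (hmem : p ∉ S) :
    mean (∏ l ∈ insert p S, l) (fun n => siftDev (insert p S) Ω g h n ^ 2)
      = (1 - ((Ω p).card : ℝ) / p) ^ 2 * mean (∏ l ∈ S, l) (fun n => siftDev S Ω g h n ^ 2)
        + mean (∏ l ∈ S, l) (condVar S Ω g h p) := by
  rw [mean_siftDev_insert_pow hS hp hmem, ← mean_const_mul, ← mean_add]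
  refine mean_congr fun n => ?_
  set θ := 1 - ((Ω p).card : ℝ) / p
  have : (fun c => (θ * siftDev S Ω g h n + fluct S Ω g h p n c) ^ 2) = fun c =>
      (θ ^ 2 * siftDev S Ω g h n ^ 2 + (2 * θ * siftDev S Ω g h n) * fluct S Ω g h p n c)
        + fluct S Ω g h p n c ^ 2 := by
    funext c; ring
  rw [this, mean_add, mean_add, mean_const hp.pos, mean_const_mul, mean_fluct hp.pos, condVar]
  ring

/-- Adding one prime to the sieve: effect on the even moments. -/
theorem mean_siftDev_insert_le (hS : ∀ p ∈ S, p.Prime) (hp : p.Prime) (hmem : p ∉ S) (m : ℕ) :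
    mean (∏ l ∈ insert p S, l) (fun n => siftDev (insert p S) Ω g h n ^ (2 * (m + 1)))
      ≤ (1 - ((Ω p).card : ℝ) / p) ^ (2 * (m + 1))
          * mean (∏ l ∈ S, l) (fun n => siftDev S Ω g h n ^ (2 * (m + 1)))
        + 4 ^ (m + 1) *
          (mean (∏ l ∈ S, l) (fun n => siftDev S Ω g h n ^ (2 * m) * condVar S Ω g h p n)
          + mean (∏ l ∈ S, l) (fun n => mean p fun c => fluct S Ω g h p n c ^ (2 * (m + 1)))) := by
  rw [mean_siftDev_insert_pow hS hp hmem, ← mean_add, ← mean_const_mul, ← mean_const_mul,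
    ← mean_add]
  refine mean_mono fun n => ?_
  set θ := 1 - ((Ω p).card : ℝ) / p
  have hθ0 : 0 ≤ θ := sub_nonneg.mpr (card_div_le_one hp.pos)
  have hθ1 : θ ≤ 1 := sub_le_self _ (by positivity)
  refine (mean_mono fun c => add_pow_two_mul_le m _ _).trans ?_
  -- The term linear in the fluctuation disappears here, by `mean_fluct`.
  rw [mean_add, mean_add, mean_const hp.pos, mean_const_mul, mean_const_mul, mean_fluct hp.pos,
    mean_add, mean_const_mul, mul_zero, add_zero, mul_pow]
  have hE : 0 ≤ siftDev S Ω g h n ^ (2 * m) := (even_two_mul m).pow_nonneg _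
  have h1 : (θ * siftDev S Ω g h n) ^ (2 * m) ≤ siftDev S Ω g h n ^ (2 * m) := by
    rw [mul_pow]
    exact mul_le_of_le_one_left hE (pow_le_one₀ hθ0 hθ1)
  have h2 := mul_le_mul_of_nonneg_right h1 (condVar_nonneg (S := S) (Ω := Ω) (g := g) (h := h)
    (p := p) n)
  have h3 : (0 : ℝ) < 4 ^ (m + 1) := by positivity
  unfold condVar at h2 ⊢
  gcongr

end sieve

/-! ### The fluctuation at one prime, through residue classes -/

section crude

variable {S : Finset ℕ} {Ω : (p : ℕ) → Finset (ZMod p)} {g h p s : ℕ}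

theorem pow_mul_le_pow_succ_add {x y : ℝ} (hx : 0 ≤ x) (hy : 0 ≤ y) (m : ℕ) :
    x ^ m * y ≤ x ^ (m + 1) + y ^ (m + 1) := by
  rcases le_total x y with hxy | hxy
  · calc x ^ m * y ≤ y ^ m * y := by gcongr
      _ = y ^ (m + 1) := by ring
      _ ≤ _ := le_add_of_nonneg_left (by positivity)
  · calc x ^ m * y ≤ x ^ m * x := by gcongr
      _ = x ^ (m + 1) := by ring
      _ ≤ _ := le_add_of_nonneg_right (by positivity)

theorem pow_succ_add_le {B x : ℝ} (hB : 0 ≤ B) (hx : 0 ≤ x) (m : ℕ) :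
    B ^ (m + 1) + B ^ m * x ≤ (B + x) ^ (m + 1) := by
  calc B ^ (m + 1) + B ^ m * x = B ^ m * (B + x) := by ring
    _ ≤ (B + x) ^ m * (B + x) := by gcongr; linarith
    _ = _ := by ring

/-- A crude form of Hölder's inequality for even moments. -/
theorem mean_pow_mul_sq_le {N : ℕ} {X Y : ℤ → ℝ} {B d : ℝ} (hB : 0 < B) (hd : 0 < d) (m : ℕ)
    (hX : mean N (fun n => X n ^ (2 * (m + 1))) ≤ B ^ (m + 1))
    (hY : mean N (fun n => Y n ^ (m + 1)) ≤ d ^ (m + 1)) (hY0 : ∀ n, 0 ≤ Y n) :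
    mean N (fun n => X n ^ (2 * m) * Y n) ≤ 2 * B ^ m * d := by
  have key : ∀ n, X n ^ (2 * m) * Y n ≤
      B ^ m * d * (1 / B ^ (m + 1)) * X n ^ (2 * (m + 1))
        + B ^ m * d * (1 / d ^ (m + 1)) * Y n ^ (m + 1) := by
    intro n
    have := pow_mul_le_pow_succ_add (x := X n ^ 2 / B) (y := Y n / d)
      (by positivity) (div_nonneg (hY0 n) hd.le) m
    have h2 := mul_le_mul_of_nonneg_left this (by positivity : 0 ≤ B ^ m * d)
    have e1 : B ^ m * d * ((X n ^ 2 / B) ^ m * (Y n / d)) = X n ^ (2 * m) * Y n := by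
      rw [div_pow, ← pow_mul]; field_simp
    have e2 : B ^ m * d * ((X n ^ 2 / B) ^ (m + 1) + (Y n / d) ^ (m + 1))
        = B ^ m * d * (1 / B ^ (m + 1)) * X n ^ (2 * (m + 1))
        + B ^ m * d * (1 / d ^ (m + 1)) * Y n ^ (m + 1) := by
      rw [div_pow, ← pow_mul, div_pow]; ring
    rw [e1, e2] at h2
    exact h2
  refine (mean_mono key).trans ?_
  rw [mean_add, mean_const_mul, mean_const_mul]
  calc B ^ m * d * (1 / B ^ (m + 1)) * mean N (fun n => X n ^ (2 * (m + 1)))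
        + B ^ m * d * (1 / d ^ (m + 1)) * mean N (fun n => Y n ^ (m + 1))
      ≤ B ^ m * d * (1 / B ^ (m + 1)) * B ^ (m + 1)
        + B ^ m * d * (1 / d ^ (m + 1)) * d ^ (m + 1) := by gcongr
    _ = 2 * B ^ m * d := by field_simp; ring

theorem mean_pow_two_mul_le {N : ℕ} {X : ℤ → ℝ} {B : ℝ} (hN : 0 < N) (hB : 0 < B) (m : ℕ)
    (hX : mean N (fun n => X n ^ (2 * (m + 1))) ≤ B ^ (m + 1)) :
    mean N (fun n => X n ^ (2 * m)) ≤ 2 * B ^ m := by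
  have := mean_pow_mul_sq_le (N := N) (X := X) (Y := fun _ => 1) (d := 1) hB one_pos m hX
    (by simp [mean_const hN]) (by simp)
  simpa using this

theorem mean_le_pow_of_pow_succ {p : ℕ} {f : ℤ → ℝ} (hp : 0 < p) (m : ℕ) :
    mean p (fun c => f c ^ 2) ^ (m + 1) ≤ mean p (fun c => f c ^ (2 * (m + 1))) := by
  unfold mean
  have hp' : (p : ℝ) ≠ 0 := by positivity
  have := Real.pow_arith_mean_le_arith_mean_pow (Finset.range p) (fun _ => (1 / p : ℝ))
    (fun c => f c ^ 2) (fun _ _ => by positivity) (by simp [hp']) (fun _ _ => by positivity) (m + 1)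
  simp only [← Finset.mul_sum, ← pow_mul] at this
  simpa [div_eq_inv_mul] using this

/-- A sum over a residue class, as a sum over an interval. -/
theorem sum_Icc_modEq {p r : ℕ} (hr : 1 ≤ r) (hrp : r ≤ p) (h : ℕ) (f : ℤ → ℝ) :
    ∑ t ∈ Finset.Icc 1 h, (if t ≡ r [MOD p] then f t else 0)
      = ∑ j ∈ Finset.Icc 1 ((h + p - r) / p), f (((r : ℤ) - p) + p * j) := by
  have hp : 0 < p := by omega
  rw [← Finset.sum_filter]
  symm
  refine Finset.sum_bij (fun j _ => r + p * j - p) ?_ ?_ ?_ ?_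
  · intro j hj
    simp only [Finset.mem_Icc] at hj
    have h1 : p * 1 ≤ p * j := Nat.mul_le_mul_left p hj.1
    have h2 : p * j ≤ h + p - r := (Nat.mul_le_mul_left p hj.2).trans (Nat.mul_div_le _ _)
    simp only [Finset.mem_filter, Finset.mem_Icc]
    refine ⟨⟨by omega, by omega⟩, ?_⟩
    have : r + p * j - p = r + p * (j - 1) := by
      obtain ⟨i, rfl⟩ : ∃ i, j = i + 1 := ⟨j - 1, by omega⟩
      rw [Nat.add_sub_cancel, Nat.mul_succ]; omega
    rw [this]
    simp [Nat.ModEq]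
  · intro j hj k hk hjk
    simp only [Finset.mem_Icc] at hj hk
    have h1 : p * 1 ≤ p * j := Nat.mul_le_mul_left p hj.1
    have h2 : p * 1 ≤ p * k := Nat.mul_le_mul_left p hk.1
    have hjk' : r + p * j - p = r + p * k - p := hjk
    have : p * j = p * k := by omega
    exact Nat.eq_of_mul_eq_mul_left hp this
  · intro t ht
    simp only [Finset.mem_filter, Finset.mem_Icc] at ht
    obtain ⟨⟨ht1, ht2⟩, hmod⟩ := ht
    have hdvd : (p : ℤ) ∣ (t : ℤ) - r := (Nat.modEq_iff_dvd.mp hmod.symm)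
    obtain ⟨k, hk⟩ := hdvd
    have hk0 : 0 ≤ k := by
      by_contra hneg
      push Not at hneg
      have : (p : ℤ) * k ≤ p * (-1) := mul_le_mul_of_nonneg_left (by omega) (by positivity)
      omega
    obtain ⟨i, rfl⟩ := Int.eq_ofNat_of_zero_le hk0
    have hti : t = r + p * i := by zify; linarith
    refine ⟨i + 1, ?_, ?_⟩
    · simp only [Finset.mem_Icc]
      refine ⟨by omega, ?_⟩
      rw [Nat.le_div_iff_mul_le hp, mul_comm, Nat.mul_succ]
      omega
    · rw [Nat.mul_succ]; omega
  · intro j hj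
    simp only [Finset.mem_Icc] at hj
    have h1 : p * 1 ≤ p * j := Nat.mul_le_mul_left p hj.1
    congr 1
    rw [Nat.cast_sub (by omega)]
    push_cast
    ring

theorem exists_residue {p : ℕ} (hp : 0 < p) (x : ZMod p) :
    ∃ r ∈ Finset.Icc 1 p, (r : ZMod p) = x := by
  have : NeZero p := ⟨hp.ne'⟩
  by_cases hx : x.val = 0
  · refine ⟨p, by simp; omega, ?_⟩
    rw [ZMod.val_eq_zero] at hx
    simp [hx]
  · exact ⟨x.val, by simp only [Finset.mem_Icc]; have := ZMod.val_lt x; omega, by simp⟩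

/-- The survivors in the residue class `r` modulo `p`. -/
noncomputable def classCount (S : Finset ℕ) (Ω : (p : ℕ) → Finset (ZMod p)) (g h p r : ℕ)
    (n : ℤ) : ℝ :=
  ∑ t ∈ Finset.Icc 1 h, if t ≡ r [MOD p] then sift S Ω (n + g * t) else 0

/-- One residue class of t modulo p is a progression, so its survivors form a count of the same kind
with difference g * p. This is why counts carry a difference g: the family is closed under passing
to classes. The base point is shifted by g(r - p) so that the new index starts at 1. -/
theorem classCount_eq {r : ℕ} (hr : r ∈ Finset.Icc 1 p) (n : ℤ) :
    classCount S Ω g h p r n = siftCount S Ω (g * p) ((h + p - r) / p) (n + g * ((r : ℤ) - p)) := by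
  rw [Finset.mem_Icc] at hr
  rw [classCount, sum_Icc_modEq hr.1 hr.2 h (fun t => sift S Ω (n + g * t)), siftCount]
  refine Finset.sum_congr rfl fun j _ => ?_
  congr 1
  push_cast
  ring

theorem sum_class {p : ℕ} (hp : 0 < p) (h : ℕ) (f : ℕ → ℝ) :
    ∑ r ∈ Finset.Icc 1 p, ∑ t ∈ Finset.Icc 1 h, (if t ≡ r [MOD p] then f t else 0)
      = ∑ t ∈ Finset.Icc 1 h, f t := by
  rw [Finset.sum_comm]
  refine Finset.sum_congr rfl fun t _ => ?_
  obtain ⟨r₀, hr₀, h0⟩ := exists_residue hp (t : ZMod p)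
  have heq : ∀ r ∈ Finset.Icc 1 p, (t ≡ r [MOD p] ↔ r = r₀) := by
    intro r hr
    rw [← ZMod.natCast_eq_natCast_iff, ← h0]
    constructor
    · intro he
      rw [ZMod.natCast_eq_natCast_iff] at he
      rw [Finset.mem_Icc] at hr hr₀
      have h1 := Nat.modEq_iff_dvd.mp he
      obtain ⟨k, hk⟩ := h1
      have hk0 : k = 0 := by
        by_contra hne
        rcases lt_or_gt_of_ne hne with hlt | hgt
        · have : (p : ℤ) * k ≤ p * (-1) := mul_le_mul_of_nonneg_left (by omega) (by positivity)
          omega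
        · have : (p : ℤ) * 1 ≤ p * k := mul_le_mul_of_nonneg_left (by omega) (by positivity)
          omega
      rw [hk0] at hk; omega
    · rintro rfl; rfl
  rw [Finset.sum_congr rfl fun r hr => by rw [if_congr (heq r hr) rfl rfl]]
  rw [Finset.sum_ite_eq' _ r₀, if_pos hr₀]

theorem sum_classCount (hp : 0 < p) (n : ℤ) :
    ∑ r ∈ Finset.Icc 1 p, classCount S Ω g h p r n = siftCount S Ω g h n :=
  sum_class hp h fun t => sift S Ω (n + g * t)

theorem sum_class_length (hp : 0 < p) :
    ∑ r ∈ Finset.Icc 1 p, (((h + p - r) / p : ℕ) : ℝ) = h := by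
  have := sum_class hp h (fun _ => (1 : ℝ))
  simp only [Finset.sum_const, Nat.card_Icc, nsmul_eq_mul, mul_one, Nat.add_sub_cancel] at this
  rw [← this]
  refine Finset.sum_congr rfl fun r hr => ?_
  rw [Finset.mem_Icc] at hr
  rw [sum_Icc_modEq hr.1 hr.2 h (fun _ => (1 : ℝ))]
  simp

theorem abs_class_length_sub (hp : 0 < p) {r : ℕ} (hr : r ∈ Finset.Icc 1 p) :
    |(h : ℝ) / p - (((h + p - r) / p : ℕ) : ℝ)| ≤ 1 := by
  rw [Finset.mem_Icc] at hr
  have hp' : (0 : ℝ) < p := by exact_mod_cast hp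
  have h1 : ((h + p - r) / p) * p ≤ h + p - r := Nat.div_mul_le_self _ _
  have h2 : h + p - r < ((h + p - r) / p) * p + p := Nat.lt_div_mul_add hp
  set T := (h + p - r) / p
  have h1' : (T : ℝ) * p ≤ h + p - 1 := by
    have : T * p + 1 ≤ h + p := by omega
    have : (T : ℝ) * p + 1 ≤ h + p := by exact_mod_cast this
    linarith
  have h2' : (h : ℝ) ≤ T * p + p := by
    have : h ≤ T * p + p := by omega
    exact_mod_cast this
  rw [abs_le]
  constructor
  · rw [neg_le_sub_iff_le_add, ← sub_le_iff_le_add, le_div_iff₀ hp']; nlinarith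
  · rw [sub_le_iff_le_add, div_le_iff₀ hp']; linarith

/-- Since g is invertible modulo p, each forbidden class ω determines one class of t, and this class
does not depend on n. -/
theorem hitCount_eq_sum (hp : p.Prime) (hg : ¬ p ∣ g) (c : ℤ) :
    ∃ r : ZMod p → ℕ, (∀ ω, r ω ∈ Finset.Icc 1 p) ∧
      ∀ n, hitCount S Ω g h p n c = ∑ ω ∈ Ω p, classCount S Ω g h p (r ω) n := by
  have : Fact p.Prime := ⟨hp⟩
  have hg0 : (g : ZMod p) ≠ 0 := by rwa [Ne, ZMod.natCast_eq_zero_iff]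
  choose r hr hr' using fun ω : ZMod p => exists_residue hp.pos ((ω - c) / g)
  refine ⟨r, hr, fun n => ?_⟩
  unfold hitCount classCount
  rw [Finset.sum_comm]
  refine Finset.sum_congr rfl fun t _ => ?_
  have : ∀ ω ∈ Ω p, (t ≡ r ω [MOD p] ↔ ((c + g * t : ℤ) : ZMod p) = ω) := by
    intro ω _
    rw [← ZMod.natCast_eq_natCast_iff, hr', eq_div_iff hg0]
    push_cast
    rw [eq_sub_iff_add_eq, mul_comm, add_comm]
  rw [Finset.sum_congr rfl fun ω hω => by rw [if_congr (this ω hω) rfl rfl]]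
  rw [Finset.sum_ite_eq]

theorem pow_sum_le_card_pow {ι : Type*} (t : Finset ι) (z : ι → ℝ) (m : ℕ) {c : ℕ}
    (hc : t.card ≤ c) :
    (∑ i ∈ t, z i) ^ (2 * (m + 1)) ≤ (c : ℝ) ^ (2 * m + 1) * ∑ i ∈ t, z i ^ (2 * (m + 1)) := by
  have hE := even_two_mul (m + 1)
  rcases t.eq_empty_or_nonempty with rfl | hne
  · simp
  have hcard : (0 : ℝ) < t.card := by exact_mod_cast hne.card_pos
  have := Real.pow_arith_mean_le_arith_mean_pow_of_even t (fun _ => (1 / t.card : ℝ)) z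
    (fun _ _ => by positivity) (by simp [hcard.ne']) hE
  rw [← Finset.mul_sum, ← Finset.mul_sum, mul_pow, one_div, inv_pow,
    inv_mul_le_iff₀ (by positivity), ← mul_assoc] at this
  refine this.trans (mul_le_mul_of_nonneg_right ?_
    (Finset.sum_nonneg fun i _ => hE.pow_nonneg (z i)))
  have e : (t.card : ℝ) ^ (2 * (m + 1)) * (t.card : ℝ)⁻¹ = (t.card : ℝ) ^ (2 * m + 1) := by
    rw [show 2 * (m + 1) = 2 * m + 1 + 1 by ring, pow_succ]
    field_simp
  rw [e]
  gcongr

theorem add_three_pow_le (a b c : ℝ) (m : ℕ) :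
    (a + b + c) ^ (2 * (m + 1))
      ≤ 3 ^ (2 * m + 1) * (a ^ (2 * (m + 1)) + b ^ (2 * (m + 1)) + c ^ (2 * (m + 1))) := by
  have := pow_sum_le_card_pow (Finset.univ : Finset (Fin 3)) ![a, b, c] m (c := 3) (by simp)
  simpa [Fin.sum_univ_three] using this

theorem mean_comm (M N : ℕ) (f : ℤ → ℤ → ℝ) :
    mean M (fun n => mean N (f n)) = mean N (fun c => mean M (fun n => f n c)) := by
  unfold mean
  simp_rw [← Finset.sum_div]
  rw [Finset.sum_comm, div_right_comm]

/-- Each forbidden class contributes the average deviation over all p classes, minus the deviation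
in its own class, plus a rounding term from the class lengths, which differ from h/p by at most 1.
-/
theorem fluct_eq_sum (hp : p.Prime) (hg : ¬ p ∣ g) (c : ℤ) :
    ∃ r : ZMod p → ℕ, (∀ ω, r ω ∈ Finset.Icc 1 p) ∧
      ∀ n, fluct S Ω g h p n c = ∑ ω ∈ Ω p,
        (∑ r ∈ Finset.Icc 1 p, (1 / p : ℝ) *
            siftDev S Ω (g * p) ((h + p - r) / p) (n + g * ((r : ℤ) - p))
          + - siftDev S Ω (g * p) ((h + p - r ω) / p) (n + g * ((r ω : ℤ) - p))
          + siftDensity S Ω * ((h : ℝ) / p - (((h + p - r ω) / p : ℕ) : ℝ))) := by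
  have hp0 : (p : ℝ) ≠ 0 := by exact_mod_cast hp.ne_zero
  obtain ⟨r, hr, hr'⟩ := hitCount_eq_sum (S := S) (Ω := Ω) (h := h) hp hg c
  refine ⟨r, hr, fun n => ?_⟩
  rw [fluct, hr', ← sum_classCount hp.pos]
  have h1 : ∀ r ∈ Finset.Icc 1 p, classCount S Ω g h p r n
      = siftDev S Ω (g * p) ((h + p - r) / p) (n + g * ((r : ℤ) - p))
        + siftDensity S Ω * (((h + p - r) / p : ℕ) : ℝ) := by
    intro r hr
    rw [classCount_eq hr, siftDev]; ring
  rw [Finset.sum_congr rfl h1, Finset.sum_congr rfl fun ω _ => h1 (r ω) (hr ω),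
    Finset.sum_add_distrib, ← Finset.mul_sum, sum_class_length hp.pos]
  rw [← Finset.mul_sum, Finset.sum_add_distrib, Finset.sum_add_distrib, Finset.sum_add_distrib,
    Finset.sum_const, ← Finset.mul_sum, ← Finset.mul_sum, Finset.sum_sub_distrib, Finset.sum_const,
    Finset.sum_neg_distrib]
  simp only [nsmul_eq_mul]
  field_simp
  ring

/-- The power mean inequality over at most s forbidden classes and three summands per class costs
(3s)^(2(m+1)), hence the factor 9 s². Every class has length at most h/p + 1, so `hdev` applies to
it. -/
theorem mean_fluct_pow_le (hS : ∀ p ∈ S, p.Prime) (hp : p.Prime) (hg : ¬ p ∣ g)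
    (hs : (Ω p).card ≤ s) (m : ℕ) {B : ℝ} (hB : 1 ≤ B)
    (hdev : ∀ T : ℕ, (T : ℝ) ≤ h / p + 1 →
      mean (∏ l ∈ S, l) (fun n => siftDev S Ω (g * p) T n ^ (2 * (m + 1))) ≤ B ^ (m + 1)) :
    mean (∏ l ∈ S, l) (fun n => mean p fun c => fluct S Ω g h p n c ^ (2 * (m + 1)))
      ≤ (9 * s ^ 2 * B) ^ (m + 1) := by
  have hE := even_two_mul (m + 1)
  have hp0 : (p : ℝ) ≠ 0 := by exact_mod_cast hp.ne_zero
  set Q := ∏ l ∈ S, l with hQdef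
  have hQ : 0 < Q := Finset.prod_pos fun l hl => (hS l hl).pos
  have hcls : ∀ r ∈ Finset.Icc 1 p, mean Q (fun n =>
      siftDev S Ω (g * p) ((h + p - r) / p) (n + g * ((r : ℤ) - p)) ^ (2 * (m + 1)))
        ≤ B ^ (m + 1) := by
    intro r hr
    have hper : Function.Periodic
        (fun n => siftDev S Ω (g * p) ((h + p - r) / p) n ^ (2 * (m + 1))) (Q : ℤ) := by
      intro n; simp only [siftDev_periodic n, hQdef]
    rw [mean_comp_add hper (g * ((r : ℤ) - p))]
    refine hdev _ ?_
    have := abs_le.mp (abs_class_length_sub (h := h) hp.pos hr)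
    linarith [this.1]
  have hfix : ∀ c, mean Q (fun n => fluct S Ω g h p n c ^ (2 * (m + 1)))
      ≤ (9 * s ^ 2 * B) ^ (m + 1) := by
    intro c
    obtain ⟨r, hr, hr'⟩ := fluct_eq_sum (S := S) (Ω := Ω) (h := h) hp hg c
    have h1 : ∀ n, fluct S Ω g h p n c ^ (2 * (m + 1)) ≤ (s : ℝ) ^ (2 * m + 1) *
        ∑ ω ∈ Ω p, (3 : ℝ) ^ (2 * m + 1) * ((∑ r ∈ Finset.Icc 1 p, (1 / p : ℝ) *
            siftDev S Ω (g * p) ((h + p - r) / p) (n + g * ((r : ℤ) - p)) ^ (2 * (m + 1)))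
          + siftDev S Ω (g * p) ((h + p - r ω) / p) (n + g * ((r ω : ℤ) - p)) ^ (2 * (m + 1))
          + 1) := by
      intro n
      rw [hr']
      refine (pow_sum_le_card_pow _ _ m hs).trans ?_
      gcongr with ω hω
      refine (add_three_pow_le _ _ _ m).trans ?_
      rw [hE.neg_pow]
      refine mul_le_mul_of_nonneg_left (add_le_add (add_le_add ?_ le_rfl) ?_) (by positivity)
      · exact Real.pow_arith_mean_le_arith_mean_pow_of_even _ _ _ (fun _ _ => by positivity)
          (by simp [hp0]) hE
      · rw [← hE.pow_abs, abs_mul]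
        refine pow_le_one₀ (by positivity) (mul_le_one₀ ?_ (abs_nonneg _)
          (abs_class_length_sub hp.pos (hr ω)))
        rw [abs_of_nonneg (siftDensity_nonneg hS)]
        exact siftDensity_le_one hS
    refine (mean_mono h1).trans ?_
    rw [mean_const_mul, mean_sum]
    have h2 : ∀ ω ∈ Ω p, mean Q (fun n => (3 : ℝ) ^ (2 * m + 1) *
        ((∑ r ∈ Finset.Icc 1 p, (1 / p : ℝ) *
            siftDev S Ω (g * p) ((h + p - r) / p) (n + g * ((r : ℤ) - p)) ^ (2 * (m + 1)))
          + siftDev S Ω (g * p) ((h + p - r ω) / p) (n + g * ((r ω : ℤ) - p)) ^ (2 * (m + 1))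
          + 1)) ≤ 3 ^ (2 * m + 1) * (3 * B ^ (m + 1)) := by
      intro ω _
      rw [mean_const_mul, mean_add, mean_add, mean_sum, mean_const hQ]
      have h3 : ∑ r ∈ Finset.Icc 1 p, mean Q (fun n => (1 / p : ℝ) *
            siftDev S Ω (g * p) ((h + p - r) / p) (n + g * ((r : ℤ) - p)) ^ (2 * (m + 1)))
          ≤ B ^ (m + 1) := by
        calc _ ≤ ∑ r ∈ Finset.Icc 1 p, (1 / p : ℝ) * B ^ (m + 1) := by
              refine Finset.sum_le_sum fun r hr => ?_
              rw [mean_const_mul]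
              gcongr
              exact hcls r hr
          _ = _ := by simp; field_simp
      have h4 := hcls (r ω) (hr ω)
      have h5 : (1 : ℝ) ≤ B ^ (m + 1) := one_le_pow₀ hB
      gcongr
      linarith
    calc (s : ℝ) ^ (2 * m + 1) * ∑ ω ∈ Ω p, _
        ≤ (s : ℝ) ^ (2 * m + 1) * ∑ ω ∈ Ω p, (3 ^ (2 * m + 1) * (3 * B ^ (m + 1)) : ℝ) := by
          gcongr with ω hω
          exact h2 ω hω
      _ ≤ (s : ℝ) ^ (2 * m + 1) * (s * (3 ^ (2 * m + 1) * (3 * B ^ (m + 1)))) := by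
          rw [Finset.sum_const, nsmul_eq_mul]
          gcongr
      _ = (9 * s ^ 2 * B) ^ (m + 1) := by
          rw [mul_pow, mul_pow, show (9 : ℝ) = 3 ^ 2 by norm_num, ← pow_mul, ← pow_mul,
            show 2 * (m + 1) = 2 * m + 1 + 1 by ring]
          ring
  rw [mean_comm]
  calc _ ≤ mean p (fun _ => (9 * s ^ 2 * B) ^ (m + 1)) := mean_mono hfix
    _ = _ := mean_const hp.pos _

theorem hitCount_nonneg (n c : ℤ) : 0 ≤ hitCount S Ω g h p n c :=
  Finset.sum_nonneg fun _ _ => by split_ifs <;> [exact sift_nonneg _; rfl]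

/-- When h ≤ p the values c + g t for 1 ≤ t ≤ h are distinct modulo p, so each forbidden class is
met at most once. -/
theorem hitCount_le_card (hp : p.Prime) (hg : ¬ p ∣ g) (hhp : h ≤ p) (n c : ℤ) :
    hitCount S Ω g h p n c ≤ (Ω p).card := by
  have : Fact p.Prime := ⟨hp⟩
  have hg0 : (g : ZMod p) ≠ 0 := by rwa [Ne, ZMod.natCast_eq_zero_iff]
  unfold hitCount
  rw [← Finset.sum_filter]
  refine (Finset.sum_le_sum fun _ _ => sift_le_one _).trans ?_
  rw [Finset.sum_const, nsmul_eq_mul, mul_one, Nat.cast_le]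
  refine Finset.card_le_card_of_injOn (fun t => ((c + g * t : ℤ) : ZMod p)) ?_ ?_
  · intro t ht
    simpa using (Finset.mem_filter.mp ht).2
  · intro t ht t' ht' he
    simp only [Finset.coe_filter, Finset.mem_Icc, Set.mem_ofPred_eq] at ht ht'
    simp only [Int.cast_add, Int.cast_mul, Int.cast_natCast, add_right_inj] at he
    have he' := mul_left_cancel₀ hg0 he
    rw [ZMod.natCast_eq_natCast_iff] at he'
    obtain ⟨k, hk⟩ := Nat.modEq_iff_dvd.mp he'
    have hk0 : k = 0 := by
      by_contra hne
      rcases lt_or_gt_of_ne hne with hlt | hgt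
      · have : (p : ℤ) * k ≤ p * (-1) := mul_le_mul_of_nonneg_left (by omega) (by positivity)
        omega
      · have : (p : ℤ) * 1 ≤ p * k := mul_le_mul_of_nonneg_left (by omega) (by positivity)
        omega
    rw [hk0] at hk
    omega

theorem abs_fluct_le (hp : p.Prime) (hg : ¬ p ∣ g) (hhp : h ≤ p) (hs : (Ω p).card ≤ s) (n c : ℤ) :
    |fluct S Ω g h p n c| ≤ s := by
  have hp0 : (0 : ℝ) < p := by exact_mod_cast hp.pos
  have h1 := hitCount_nonneg (S := S) (Ω := Ω) (g := g) (h := h) (p := p) n c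
  have h2 := hitCount_le_card (S := S) (Ω := Ω) hp hg hhp n c
  have h3 := siftCount_nonneg (S := S) (Ω := Ω) (g := g) (h := h) n
  have h4 := siftCount_le (S := S) (Ω := Ω) (g := g) (h := h) n
  have hs' : ((Ω p).card : ℝ) ≤ s := by exact_mod_cast hs
  have h5 : ((Ω p).card : ℝ) / p * siftCount S Ω g h n ≤ (Ω p).card := by
    rw [div_mul_eq_mul_div, div_le_iff₀ hp0]
    have : siftCount S Ω g h n ≤ p := h4.trans (by exact_mod_cast hhp)
    gcongr
  have h6 : 0 ≤ ((Ω p).card : ℝ) / p * siftCount S Ω g h n := by positivity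
  rw [fluct, abs_le]
  constructor <;> linarith

/-- A variance is at most a second moment, and the second moment of a count bounded by s is at most
s times its mean. -/
theorem condVar_le_of_le (hp : p.Prime) (hg : ¬ p ∣ g) (hhp : h ≤ p) (hs : (Ω p).card ≤ s)
    (n : ℤ) : condVar S Ω g h p n ≤ s ^ 2 / p * siftCount S Ω g h n := by
  have hs' : ((Ω p).card : ℝ) ≤ s := by exact_mod_cast hs
  have h3 := siftCount_nonneg (S := S) (Ω := Ω) (g := g) (h := h) n
  set a := ((Ω p).card : ℝ) / p * siftCount S Ω g h n with ha
  have ha0 : 0 ≤ a := by positivity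
  have key : ∀ c, fluct S Ω g h p n c ^ 2 ≤ (a ^ 2 + (-2 * a) * hitCount S Ω g h p n c)
      + s * hitCount S Ω g h p n c := by
    intro c
    have h1 := hitCount_nonneg (S := S) (Ω := Ω) (g := g) (h := h) (p := p) n c
    have h2 := (hitCount_le_card (S := S) (Ω := Ω) hp hg hhp n c).trans hs'
    rw [fluct, ← ha]
    nlinarith
  refine (mean_mono key).trans ?_
  rw [mean_add, mean_add, mean_const hp.pos, mean_const_mul, mean_const_mul, mean_hitCount hp.pos,
    ← ha]
  have : a ≤ s / p * siftCount S Ω g h n := by rw [ha]; gcongr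
  have h7 : (s : ℝ) * a ≤ s * (s / p * siftCount S Ω g h n) := by gcongr
  have e : (s : ℝ) * (s / p * siftCount S Ω g h n) = s ^ 2 / p * siftCount S Ω g h n := by ring
  nlinarith [sq_nonneg a]

theorem mean_fluct_pow_le_of_le (hp : p.Prime) (hg : ¬ p ∣ g) (hhp : h ≤ p)
    (hs : (Ω p).card ≤ s) (m : ℕ) (n : ℤ) :
    mean p (fun c => fluct S Ω g h p n c ^ (2 * (m + 1)))
      ≤ s ^ (2 * m) * condVar S Ω g h p n := by
  rw [condVar, ← mean_const_mul]
  refine mean_mono fun c => ?_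
  rw [show 2 * (m + 1) = 2 * m + 2 by ring, pow_add]
  refine mul_le_mul_of_nonneg_right ?_ (sq_nonneg _)
  rw [← (even_two_mul m).pow_abs]
  exact pow_le_pow_left₀ (abs_nonneg _) (abs_fluct_le hp hg hhp hs n c) _

end crude

/-! ### Crude moment bounds, and primes beyond the length of the interval -/

section moments

variable {S : Finset ℕ} {Ω : (p : ℕ) → Finset (ZMod p)} {g h p s : ℕ}

theorem siftDev_zero (n : ℤ) : siftDev S Ω g 0 n = 0 := by simp [siftDev, siftCount]

theorem siftDev_empty (n : ℤ) : siftDev ∅ Ω g h n = 0 := by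
  simp [siftDev, siftCount, siftDensity, sift]

/-- An upper bound for all even moments, sharp up to the Euler product. The exponent `τ < 1` gives
an additional saving when all primes are small. -/
theorem exists_mean_siftDev_pow_le (s m : ℕ) (hs : 1 ≤ s) : ∃ C : ℝ, 1 ≤ C ∧
    ∀ τ : ℝ, 0 ≤ τ → τ ≤ 1 → ∀ (Ω : (p : ℕ) → Finset (ZMod p)) (S : Finset ℕ),
      (∀ p ∈ S, p.Prime) → (∀ p ∈ S, (Ω p).card ≤ s) → ∀ g : ℕ, (∀ p ∈ S, ¬ p ∣ g) →
      ∀ h : ℕ, 1 ≤ h →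
      mean (∏ l ∈ S, l) (fun n => siftDev S Ω g h n ^ (2 * (m + 1)))
        ≤ ((h : ℝ) ^ τ * ∏ p ∈ S, (1 + C * (p : ℝ) ^ (-τ))) ^ (m + 1) := by
  have hs' : (1 : ℝ) ≤ s := by exact_mod_cast hs
  -- `C₁` is the cost of a prime p ≤ h and `C₂` that of a prime p > h.
  set C₁ : ℝ := 4 ^ (m + 1) * (2 + (18 * s ^ 2) ^ m) * (18 * s ^ 2) with hC₁
  set C₂ : ℝ := 4 ^ (m + 1) * s ^ 2 * (2 + s ^ (2 * m)) with hC₂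
  have hC₁0 : 0 ≤ C₁ := by positivity
  have hC₂0 : 0 ≤ C₂ := by positivity
  refine ⟨1 + C₁ + C₂, by linarith, ?_⟩
  set C := 1 + C₁ + C₂ with hC
  intro τ hτ0 hτ1 Ω S
  -- The difference g and the length h stay quantified: a prime p ≤ h calls the hypothesis for the
  -- difference g * p and for lengths about h/p.
  induction S using Finset.induction_on with
  | empty =>
    intro _ _ g _ h hh
    simp only [siftDev_empty]
    rw [zero_pow (by omega)]
    simp only [Finset.prod_empty, mul_one, mean_const one_pos]
    positivity
  | insert p S hpS ih =>
    intro hS hΩ g hg h hh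
    have hS' : ∀ l ∈ S, l.Prime := fun l hl => hS l (Finset.mem_insert_of_mem hl)
    have hΩ' : ∀ l ∈ S, (Ω l).card ≤ s := fun l hl => hΩ l (Finset.mem_insert_of_mem hl)
    have hg' : ∀ l ∈ S, ¬ l ∣ g := fun l hl => hg l (Finset.mem_insert_of_mem hl)
    have hp : p.Prime := hS p (Finset.mem_insert_self _ _)
    have hΩp : (Ω p).card ≤ s := hΩ p (Finset.mem_insert_self _ _)
    have hgp : ¬ p ∣ g := hg p (Finset.mem_insert_self _ _)
    have hp0 : (0 : ℝ) < p := by exact_mod_cast hp.pos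
    have hh0 : (0 : ℝ) < h := by exact_mod_cast hh
    have hQ : 0 < ∏ l ∈ S, l := Finset.prod_pos fun l hl => (hS' l hl).pos
    set Λ := ∏ l ∈ S, (1 + C * (l : ℝ) ^ (-τ)) with hΛ
    have hΛ1 : 1 ≤ Λ := by
      refine Finset.one_le_prod fun l _ => ?_
      have : 0 ≤ C * (l : ℝ) ^ (-τ) := by positivity
      linarith
    set B := (h : ℝ) ^ τ * Λ with hB
    have hB1 : 1 ≤ B := one_le_mul_of_one_le_of_one_le
      (Real.one_le_rpow (by exact_mod_cast hh) hτ0) hΛ1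
    have hB0 : 0 < B := by linarith
    have hX := ih hS' hΩ' g hg' h hh
    rw [Finset.prod_insert hpS (f := fun l : ℕ => 1 + C * (l : ℝ) ^ (-τ)), mul_left_comm, ← hΛ,
      ← hB]
    have hpτ : 0 < (p : ℝ) ^ (-τ) := by positivity
    have hpτ1 : (p : ℝ) ^ (-τ) ≤ 1 :=
      Real.rpow_le_one_of_one_le_of_nonpos (by exact_mod_cast hp.one_le) (by linarith)
    have hθ0 : 0 ≤ 1 - ((Ω p).card : ℝ) / p := sub_nonneg.mpr (card_div_le_one hp.pos)
    have hθ1 : 1 - ((Ω p).card : ℝ) / p ≤ 1 := sub_le_self _ (by positivity)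
    have hstep := mean_siftDev_insert_le (Ω := Ω) (g := g) (h := h) hS' hp hpS m
    have hfirst : (1 - ((Ω p).card : ℝ) / p) ^ (2 * (m + 1))
          * mean (∏ l ∈ S, l) (fun n => siftDev S Ω g h n ^ (2 * (m + 1))) ≤ B ^ (m + 1) :=
      (mul_le_of_le_one_left (mean_nonneg fun n => (even_two_mul _).pow_nonneg _)
        (pow_le_one₀ hθ0 hθ1)).trans hX
    have hdiv : ((h : ℝ) / p) ^ τ = (h : ℝ) ^ τ * (p : ℝ) ^ (-τ) := by
      rw [Real.div_rpow hh0.le hp0.le, Real.rpow_neg hp0.le, div_eq_mul_inv]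
    -- With x = C p^(-τ) B, the inequality B^(m+1) + B^m x ≤ (B + x)^(m+1) turns an error B^m x into
    -- the new factor 1 + C p^(-τ).
    suffices hE : 4 ^ (m + 1) *
          (mean (∏ l ∈ S, l) (fun n => siftDev S Ω g h n ^ (2 * m) * condVar S Ω g h p n)
          + mean (∏ l ∈ S, l) (fun n => mean p fun c => fluct S Ω g h p n c ^ (2 * (m + 1))))
          ≤ B ^ m * (C * (p : ℝ) ^ (-τ) * B) by
      refine hstep.trans ((add_le_add hfirst hE).trans
        ((pow_succ_add_le hB0.le (by positivity) m).trans_eq ?_))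
      ring
    rcases le_or_gt p h with hph | hph
    · have hph' : (1 : ℝ) ≤ h / p := by
        rw [le_div_iff₀ hp0, one_mul]; exact_mod_cast hph
      -- The factor 2 allows for class lengths T ≤ h/p + 1 ≤ 2h/p, together with 2^τ ≤ 2.
      set b := 2 * ((h : ℝ) / p) ^ τ * Λ with hb
      have hb1 : 1 ≤ b := by
        have h1 := Real.one_le_rpow hph' hτ0
        rw [hb]
        nlinarith
      have hfl : mean (∏ l ∈ S, l)
          (fun n => mean p fun c => fluct S Ω g h p n c ^ (2 * (m + 1)))
          ≤ (9 * s ^ 2 * b) ^ (m + 1) := by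
        refine mean_fluct_pow_le hS' hp hgp hΩp m hb1 fun T hT => ?_
        rcases Nat.eq_zero_or_pos T with rfl | hT0
        · simp only [siftDev_zero]
          rw [zero_pow (by omega), mean_const hQ]
          positivity
        refine (ih hS' hΩ' (g * p) ?_ T hT0).trans ?_
        · intro l hl hdvd
          rcases (hS' l hl).dvd_mul.mp hdvd with h1 | h1
          · exact hg' l hl h1
          · rw [Nat.prime_dvd_prime_iff_eq (hS' l hl) hp] at h1
            exact hpS (h1 ▸ hl)
        · refine pow_le_pow_left₀ (by positivity) ?_ _
          rw [hb]
          refine mul_le_mul_of_nonneg_right ?_ (by linarith)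
          calc (T : ℝ) ^ τ ≤ (2 * (h / p)) ^ τ :=
                Real.rpow_le_rpow (by positivity) (by linarith) hτ0
            _ = 2 ^ τ * ((h : ℝ) / p) ^ τ := Real.mul_rpow (by norm_num) (by positivity)
            _ ≤ 2 * ((h : ℝ) / p) ^ τ := by
                gcongr
                calc (2 : ℝ) ^ τ ≤ 2 ^ (1 : ℝ) :=
                      Real.rpow_le_rpow_of_exponent_le (by norm_num) hτ1
                  _ = 2 := Real.rpow_one 2
      set d := 9 * s ^ 2 * b with hd
      have hd0 : 0 < d := by positivity
      have hde : d = 18 * s ^ 2 * ((p : ℝ) ^ (-τ) * B) := by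
        rw [hd, hb, hdiv, hB]; ring
      have hdB : d ≤ 18 * s ^ 2 * B := by
        rw [hde]
        gcongr
        exact mul_le_of_le_one_left hB0.le hpτ1
      have hmix : mean (∏ l ∈ S, l) (fun n => siftDev S Ω g h n ^ (2 * m) * condVar S Ω g h p n)
          ≤ 2 * B ^ m * d := by
        refine mean_pow_mul_sq_le hB0 hd0 m hX ?_ fun n => condVar_nonneg n
        exact (mean_mono fun n => mean_le_pow_of_pow_succ hp.pos m).trans hfl
      have hdm : d ^ (m + 1) ≤ (18 * s ^ 2) ^ m * B ^ m * d := by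
        rw [pow_succ, ← mul_pow]
        gcongr
      calc _ ≤ 4 ^ (m + 1) * (2 * B ^ m * d + (18 * s ^ 2) ^ m * B ^ m * d) := by
            gcongr
            exact hfl.trans hdm
        _ = C₁ * (B ^ m * ((p : ℝ) ^ (-τ) * B)) := by rw [hde, hC₁]; ring
        _ ≤ C * (B ^ m * ((p : ℝ) ^ (-τ) * B)) := by
            gcongr
            linarith
        _ = _ := by ring
    · have hhp : h ≤ p := hph.le
      have hv : ∀ n, condVar S Ω g h p n ≤ s ^ 2 * ((h : ℝ) / p) := fun n =>
        (condVar_le_of_le hp hgp hhp hΩp n).trans (by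
          calc (s : ℝ) ^ 2 / p * siftCount S Ω g h n ≤ (s : ℝ) ^ 2 / p * h := by
                gcongr; exact siftCount_le n
            _ = _ := by ring)
      have hmix : mean (∏ l ∈ S, l) (fun n => siftDev S Ω g h n ^ (2 * m) * condVar S Ω g h p n)
          ≤ s ^ 2 * ((h : ℝ) / p) * (2 * B ^ m) := by
        calc _ ≤ mean (∏ l ∈ S, l) (fun n => s ^ 2 * ((h : ℝ) / p) * siftDev S Ω g h n ^ (2 * m)) :=
              mean_mono fun n => by
                rw [mul_comm]
                exact mul_le_mul_of_nonneg_right (hv n) ((even_two_mul m).pow_nonneg _)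
          _ ≤ _ := by
              rw [mean_const_mul]
              gcongr
              exact mean_pow_two_mul_le hQ hB0 m hX
      have hfl : mean (∏ l ∈ S, l)
          (fun n => mean p fun c => fluct S Ω g h p n c ^ (2 * (m + 1)))
          ≤ s ^ (2 * m) * (s ^ 2 * ((h : ℝ) / p)) := by
        rw [← mean_const hQ ((s : ℝ) ^ (2 * m) * (s ^ 2 * ((h : ℝ) / p)))]
        refine mean_mono fun n => (mean_fluct_pow_le_of_le hp hgp hhp hΩp m n).trans ?_
        gcongr
        exact hv n
      have hBm : 1 ≤ B ^ m := one_le_pow₀ hB1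
      have hle : (h : ℝ) / p ≤ (p : ℝ) ^ (-τ) * B := by
        have h1 : (h : ℝ) / p ≤ ((h : ℝ) / p) ^ τ := by
          have hlt : (h : ℝ) / p ≤ 1 := by
            rw [div_le_one hp0]; exact_mod_cast hhp
          calc (h : ℝ) / p = ((h : ℝ) / p) ^ (1 : ℝ) := (Real.rpow_one _).symm
            _ ≤ _ := Real.rpow_le_rpow_of_exponent_ge (by positivity) hlt hτ1
        rw [hdiv] at h1
        rw [hB]
        calc _ ≤ (h : ℝ) ^ τ * (p : ℝ) ^ (-τ) * 1 := by rw [mul_one]; exact h1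
          _ ≤ (h : ℝ) ^ τ * (p : ℝ) ^ (-τ) * Λ := by gcongr
          _ = _ := by ring
      calc _ ≤ 4 ^ (m + 1) * (s ^ 2 * ((h : ℝ) / p) * (2 * B ^ m)
              + s ^ (2 * m) * (s ^ 2 * ((h : ℝ) / p)) * B ^ m) := by
            gcongr
            exact hfl.trans (le_mul_of_one_le_right (by positivity) hBm)
        _ = C₂ * (B ^ m * ((h : ℝ) / p)) := by rw [hC₂]; ring
        _ ≤ C * (B ^ m * ((p : ℝ) ^ (-τ) * B)) := by
            gcongr
            linarith
        _ = _ := by ring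

theorem mean_siftCount (hS : ∀ p ∈ S, p.Prime) :
    mean (∏ l ∈ S, l) (siftCount S Ω g h) = h * siftDensity S Ω := by
  induction S using Finset.induction_on with
  | empty => simp [mean, siftCount, sift, siftDensity]
  | insert p S hpS ih =>
    have hS' : ∀ l ∈ S, l.Prime := fun l hl => hS l (Finset.mem_insert_of_mem hl)
    have hp : p.Prime := hS p (Finset.mem_insert_self _ _)
    rw [Finset.prod_insert hpS, mul_comm, funext (siftCount_insert (Ω := Ω) (g := g) (h := h) hpS),
      mean_crt (coprime_prod_of_notMem hS' hp hpS)
        (fun n c => siftCount S Ω g h n - hitCount S Ω g h p n c), siftDensity_insert hpS]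
    · have : ∀ n, mean p (fun c => siftCount S Ω g h n - hitCount S Ω g h p n c)
          = (1 - ((Ω p).card : ℝ) / p) * siftCount S Ω g h n := by
        intro n
        rw [mean_sub, mean_const hp.pos, mean_hitCount hp.pos]
        ring
      rw [mean_congr this, mean_const_mul, ih hS']
      ring
    · intro c n
      have := hitCount_periodic_left (S := S) (Ω := Ω) (g := g) (h := h) (p := p) c n
      simp only at this
      simp only [siftCount_periodic n, this]
    · intro n c
      simp only [hitCount_periodic_right n c]

/-- Adding primes larger than the length of the interval: second moment. -/
theorem mean_siftDev_sq_union_le (hs : 1 ≤ s) (S₁ : Finset ℕ) (hS₁ : ∀ p ∈ S₁, p.Prime) :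
    ∀ S : Finset ℕ, (∀ p ∈ S, p.Prime ∧ h ≤ p ∧ (Ω p).card ≤ s ∧ 1 ≤ (Ω p).card ∧
        (1 : ℝ) / (2 * s) ≤ 1 - ((Ω p).card : ℝ) / p) → (∀ p ∈ S, p ∉ S₁) →
      mean (∏ l ∈ S ∪ S₁, l) (fun n => siftDev (S ∪ S₁) Ω 1 h n ^ 2)
        ≤ siftDensity S Ω ^ 2 * mean (∏ l ∈ S₁, l) (fun n => siftDev S₁ Ω 1 h n ^ 2)
          + 2 * s ^ 3 * (h * siftDensity (S ∪ S₁) Ω) := by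
  intro S
  have hs' : (1 : ℝ) ≤ s := by exact_mod_cast hs
  induction S using Finset.induction_on with
  | empty =>
    intro _ _
    have := siftDensity_nonneg (Ω := Ω) hS₁
    simp only [Finset.empty_union, siftDensity, Finset.prod_empty, one_pow, one_mul] at *
    have : 0 ≤ 2 * (s : ℝ) ^ 3 * (h * ∏ p ∈ S₁, (1 - ((Ω p).card : ℝ) / p)) := by positivity
    linarith
  | insert p S hpS ih =>
    intro hS hd
    obtain ⟨hp, hhp, hΩp, hΩ1, hθ⟩ := hS p (Finset.mem_insert_self _ _)
    have hS' : ∀ l ∈ S ∪ S₁, l.Prime := fun l hl => by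
      rcases Finset.mem_union.mp hl with h1 | h1
      · exact (hS l (Finset.mem_insert_of_mem h1)).1
      · exact hS₁ l h1
    have hpU : p ∉ S ∪ S₁ := by
      rw [Finset.mem_union, not_or]
      exact ⟨hpS, hd p (Finset.mem_insert_self _ _)⟩
    have ih' := ih (fun l hl => hS l (Finset.mem_insert_of_mem hl))
      (fun l hl => hd l (Finset.mem_insert_of_mem hl))
    have hp0 : (0 : ℝ) < p := by exact_mod_cast hp.pos
    have hQ : 0 < ∏ l ∈ S ∪ S₁, l := Finset.prod_pos fun l hl => (hS' l hl).pos
    rw [Finset.insert_union, mean_siftDev_insert_sq hS' hp hpU, siftDensity_insert hpS,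
      siftDensity_insert hpU]
    set θ := 1 - ((Ω p).card : ℝ) / p with hθdef
    have hP0 : 0 ≤ siftDensity (S ∪ S₁) Ω := siftDensity_nonneg hS'
    have hdev0 : mean (∏ l ∈ S ∪ S₁, l) (siftCount (S ∪ S₁) Ω 1 h)
        = h * siftDensity (S ∪ S₁) Ω :=
      mean_siftCount hS'
    have hv : mean (∏ l ∈ S ∪ S₁, l) (condVar (S ∪ S₁) Ω 1 h p)
        ≤ s ^ 2 / p * (h * siftDensity (S ∪ S₁) Ω) := by
      rw [← hdev0, ← mean_const_mul]
      exact mean_mono fun n => condVar_le_of_le hp (by simpa using hp.ne_one) hhp hΩp n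
    have hs0 : (0 : ℝ) < s := by linarith
    have hθs : 1 ≤ 2 * s * θ := by
      rw [div_le_iff₀ (by positivity)] at hθ
      linarith
    have h1θ : 1 / (p : ℝ) ≤ 1 - θ := by
      rw [hθdef, sub_sub_cancel]
      gcongr
      exact_mod_cast hΩ1
    set Y := (h : ℝ) * siftDensity (S ∪ S₁) Ω with hY
    have hY0 : 0 ≤ Y := by positivity
    -- The old error is multiplied by θ², but the target only asks for θ. The difference 2s³ θ(1 -
    -- θ) Y pays for the new variance, because 1 ≤ 2sθ and 1/p ≤ 1 - θ.
    have hkey : (s : ℝ) ^ 2 / p * Y ≤ 2 * s ^ 3 * (θ * (1 - θ)) * Y := by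
      refine mul_le_mul_of_nonneg_right ?_ hY0
      calc (s : ℝ) ^ 2 / p = s ^ 2 * 1 * (1 / p) := by ring
        _ ≤ s ^ 2 * (2 * s * θ) * (1 - θ) := by gcongr
        _ = _ := by ring
    have hmul := mul_le_mul_of_nonneg_left ih' (sq_nonneg θ)
    calc _ ≤ θ ^ 2 * (siftDensity S Ω ^ 2 * mean (∏ l ∈ S₁, l) (fun n => siftDev S₁ Ω 1 h n ^ 2)
          + 2 * s ^ 3 * Y) + 2 * s ^ 3 * (θ * (1 - θ)) * Y := by linarith
      _ = _ := by rw [hY]; ring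

/-- The source of the gain for large primes: the deviation shrinks by θ while the square root of the
expected count shrinks only by √θ. The slack θ(1 - θ)/2 is of order 1/p, the size of the error made
at p. -/
theorem add_mul_le_sqrt {θ : ℝ} (h0 : 0 ≤ θ) (h1 : θ ≤ 1) : θ + θ * (1 - θ) / 2 ≤ √θ := by
  refine Real.le_sqrt_of_sq_le ?_
  have : θ - (θ + θ * (1 - θ) / 2) ^ 2 = θ * ((1 - θ) ^ 2 * (4 - θ)) / 4 := by ring
  have h2 : 0 ≤ θ * ((1 - θ) ^ 2 * (4 - θ)) / 4 := by
    have : 0 ≤ 4 - θ := by linarith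
    positivity
  linarith

set_option maxHeartbeats 800000 in
/-- Adding primes larger than the length of the interval: higher even moments. -/
theorem exists_mean_siftDev_pow_union_le (s m : ℕ) (hs : 1 ≤ s) : ∃ K : ℝ, 1 ≤ K ∧
    ∀ (Ω : (p : ℕ) → Finset (ZMod p)) (h : ℕ) (S₁ : Finset ℕ), (∀ p ∈ S₁, p.Prime) →
    ∀ α : ℝ, 0 ≤ α →
      mean (∏ l ∈ S₁, l) (fun n => siftDev S₁ Ω 1 h n ^ (2 * (m + 1))) ≤ α ^ (2 * (m + 1)) →
    ∀ S : Finset ℕ, (∀ p ∈ S, p.Prime ∧ h ≤ p ∧ (Ω p).card ≤ s ∧ 1 ≤ (Ω p).card ∧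
        (1 : ℝ) / (2 * s) ≤ 1 - ((Ω p).card : ℝ) / p) → (∀ p ∈ S, p ∉ S₁) →
      mean (∏ l ∈ S ∪ S₁, l) (fun n => siftDev (S ∪ S₁) Ω 1 h n ^ (2 * (m + 1)))
        ≤ (siftDensity S Ω * α + K * √(max (h * siftDensity (S ∪ S₁) Ω) 1)) ^ (2 * (m + 1)) := by
  have hs' : (1 : ℝ) ≤ s := by exact_mod_cast hs
  have hs0 : (0 : ℝ) < s := by linarith
  set C : ℝ := 4 ^ (m + 1) * s ^ 2 * (4 + s ^ (2 * m)) with hC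
  have hC0 : 0 ≤ C := by positivity
  refine ⟨2 * (2 * s) ^ (2 * (m + 1)) * C + 1, by
    have : 0 ≤ 2 * (2 * (s : ℝ)) ^ (2 * (m + 1)) * C := by positivity
    linarith, ?_⟩
  set K := 2 * (2 * (s : ℝ)) ^ (2 * (m + 1)) * C + 1 with hK
  have hK1 : 1 ≤ K := by
    have : 0 ≤ 2 * (2 * (s : ℝ)) ^ (2 * (m + 1)) * C := by positivity
    linarith
  intro Ω h S₁ hS₁ α hα hbase S
  induction S using Finset.induction_on with
  | empty =>
    intro _ _
    simp only [Finset.empty_union]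
    refine hbase.trans (pow_le_pow_left₀ hα ?_ _)
    simp only [siftDensity, Finset.prod_empty, one_mul]
    have : 0 ≤ K * √(max (h * ∏ p ∈ S₁, (1 - ((Ω p).card : ℝ) / p)) 1) := by positivity
    linarith
  | insert p S hpS ih =>
    intro hS hd
    obtain ⟨hp, hhp, hΩp, hΩ1, hθ⟩ := hS p (Finset.mem_insert_self _ _)
    have hSp : ∀ l ∈ S, l.Prime := fun l hl => (hS l (Finset.mem_insert_of_mem hl)).1
    have hS' : ∀ l ∈ S ∪ S₁, l.Prime := fun l hl => by
      rcases Finset.mem_union.mp hl with h1 | h1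
      · exact hSp l h1
      · exact hS₁ l h1
    have hpU : p ∉ S ∪ S₁ := by
      rw [Finset.mem_union, not_or]
      exact ⟨hpS, hd p (Finset.mem_insert_self _ _)⟩
    have hX := ih (fun l hl => hS l (Finset.mem_insert_of_mem hl))
      (fun l hl => hd l (Finset.mem_insert_of_mem hl))
    have hgp : ¬ p ∣ 1 := by simpa using hp.ne_one
    have hp0 : (0 : ℝ) < p := by exact_mod_cast hp.pos
    have hQ : 0 < ∏ l ∈ S ∪ S₁, l := Finset.prod_pos fun l hl => (hS' l hl).pos
    have hstep := mean_siftDev_insert_le (Ω := Ω) (g := 1) (h := h) hS' hp hpU m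
    rw [Finset.insert_union, siftDensity_insert hpS, siftDensity_insert hpU]
    refine hstep.trans ?_
    set θ := 1 - ((Ω p).card : ℝ) / p with hθdef
    set U := S ∪ S₁ with hU
    set P := siftDensity U Ω with hP
    have hP0 : 0 ≤ P := siftDensity_nonneg hS'
    set ϖ := siftDensity S Ω with hϖ
    have hϖ0 : 0 ≤ ϖ := siftDensity_nonneg hSp
    -- The floor 1 covers the sparse range, where the fluctuations are governed by bounded jumps. It
    -- also gives b ≥ √μ ≥ 1, so lower powers of b or √μ can be raised.
    set μ := max (h * P) 1 with hμ
    have hμ1 : 1 ≤ μ := le_max_right _ _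
    have hμ0 : 0 ≤ μ := by linarith
    have hrμ1 : 1 ≤ √μ := Real.one_le_sqrt.mpr hμ1
    set b := ϖ * α + K * √μ with hb
    have hbμ : √μ ≤ b := by
      have : 0 ≤ ϖ * α := by positivity
      nlinarith
    have hb1 : 1 ≤ b := hrμ1.trans hbμ
    have hb0 : 0 < b := by linarith
    have hY : h * P ≤ √μ * b := by
      calc h * P ≤ μ := le_max_left _ _
        _ = √μ * √μ := (Real.mul_self_sqrt hμ0).symm
        _ ≤ √μ * b := by gcongr
    have hθ0 : 0 ≤ θ := sub_nonneg.mpr (card_div_le_one hp.pos)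
    have hθ1 : θ ≤ 1 := sub_le_self _ (by positivity)
    have h1θ : 1 / (p : ℝ) ≤ 1 - θ := by
      rw [hθdef, sub_sub_cancel]
      gcongr
      exact_mod_cast hΩ1
    have hbm : 1 ≤ b ^ (2 * m) := one_le_pow₀ hb1
    have hX2 : mean (∏ l ∈ U, l) (fun n => siftDev U Ω 1 h n ^ (2 * (m + 1)))
        ≤ (b ^ 2) ^ (m + 1) := by rw [← pow_mul]; exact hX
    have hmom : mean (∏ l ∈ U, l) (fun n => siftDev U Ω 1 h n ^ (2 * m)) ≤ 2 * b ^ (2 * m) := by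
      rw [pow_mul]
      exact mean_pow_two_mul_le hQ (by positivity) m hX2
    have hmom' : mean (∏ l ∈ U, l) (fun n => siftDev U Ω 1 h n ^ (2 * m) * siftDev U Ω 1 h n)
        ≤ 2 * b ^ (2 * m + 1) := by
      have key : ∀ n, siftDev U Ω 1 h n ^ (2 * m) * siftDev U Ω 1 h n
          ≤ b ^ (2 * m + 1) + (1 / b) * siftDev U Ω 1 h n ^ (2 * (m + 1)) := by
        intro n
        set x := siftDev U Ω 1 h n
        have h1 : x ^ (2 * m) * x ≤ |x| ^ (2 * m + 1) := by
          rw [← pow_succ, ← abs_pow]; exact le_abs_self _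
        have h2 : x ^ (2 * (m + 1)) = |x| ^ (2 * m + 1) * |x| := by
          rw [← (even_two_mul (m + 1)).pow_abs]; ring
        rw [h2]
        refine h1.trans ?_
        rcases le_total (|x|) b with hle | hle
        · have h3 : |x| ^ (2 * m + 1) ≤ b ^ (2 * m + 1) := by gcongr
          have h4 : 0 ≤ 1 / b * (|x| ^ (2 * m + 1) * |x|) := by positivity
          linarith
        · have h3 : |x| ^ (2 * m + 1) ≤ 1 / b * (|x| ^ (2 * m + 1) * |x|) := by
            rw [one_div, inv_mul_eq_div, le_div_iff₀ hb0]
            gcongr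
          have : 0 ≤ b ^ (2 * m + 1) := by positivity
          linarith
      refine (mean_mono key).trans ?_
      rw [mean_add, mean_const hQ, mean_const_mul]
      have : 1 / b * mean (∏ l ∈ U, l) (fun n => siftDev U Ω 1 h n ^ (2 * (m + 1)))
          ≤ 1 / b * b ^ (2 * (m + 1)) := by gcongr
      have e : 1 / b * b ^ (2 * (m + 1)) = b ^ (2 * m + 1) := by
        rw [show 2 * (m + 1) = 2 * m + 1 + 1 by ring, pow_succ]; field_simp
      linarith
    -- The number of survivors is its mean plus the deviation, so the mixed term reduces to moments
    -- of order 2m and 2m + 1 of the deviation itself.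
    have hv : ∀ n, condVar U Ω 1 h p n ≤ s ^ 2 / p * (h * P + siftDev U Ω 1 h n) := fun n => by
      refine (condVar_le_of_le hp hgp hhp hΩp n).trans_eq ?_
      rw [siftDev]; ring
    have hmix : mean (∏ l ∈ U, l) (fun n => siftDev U Ω 1 h n ^ (2 * m) * condVar U Ω 1 h p n)
        ≤ s ^ 2 / p * (h * P * (2 * b ^ (2 * m)) + 2 * b ^ (2 * m + 1)) := by
      have key : ∀ n, siftDev U Ω 1 h n ^ (2 * m) * condVar U Ω 1 h p n
          ≤ s ^ 2 / p * (h * P * siftDev U Ω 1 h n ^ (2 * m)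
            + siftDev U Ω 1 h n ^ (2 * m) * siftDev U Ω 1 h n) := by
        intro n
        refine (mul_le_mul_of_nonneg_left (hv n) ((even_two_mul m).pow_nonneg _)).trans_eq ?_
        ring
      refine (mean_mono key).trans ?_
      rw [mean_const_mul, mean_add, mean_const_mul]
      gcongr
    have hfl : mean (∏ l ∈ U, l) (fun n => mean p fun c => fluct U Ω 1 h p n c ^ (2 * (m + 1)))
        ≤ s ^ (2 * m) * (s ^ 2 / p * (h * P)) := by
      rw [hP, ← mean_siftCount (g := 1) hS', ← mean_const_mul, ← mean_const_mul]
      refine mean_mono fun n => (mean_fluct_pow_le_of_le hp hgp hhp hΩp m n).trans ?_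
      gcongr
      exact condVar_le_of_le hp hgp hhp hΩp n
    have hextra : 4 ^ (m + 1) *
          (mean (∏ l ∈ U, l) (fun n => siftDev U Ω 1 h n ^ (2 * m) * condVar U Ω 1 h p n)
          + mean (∏ l ∈ U, l) (fun n => mean p fun c => fluct U Ω 1 h p n c ^ (2 * (m + 1))))
        ≤ C * (1 / p) * (√μ * b ^ (2 * m + 1)) := by
      have e1 : h * P * (2 * b ^ (2 * m)) ≤ 2 * (√μ * b ^ (2 * m + 1)) := by
        calc h * P * (2 * b ^ (2 * m)) ≤ √μ * b * (2 * b ^ (2 * m)) := by gcongr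
          _ = _ := by ring
      have e2 : 2 * b ^ (2 * m + 1) ≤ 2 * (√μ * b ^ (2 * m + 1)) := by
        gcongr
        exact le_mul_of_one_le_left (by positivity) hrμ1
      have e3 : h * P ≤ √μ * b ^ (2 * m + 1) := by
        calc h * P ≤ √μ * b * 1 := by rw [mul_one]; exact hY
          _ ≤ √μ * b * b ^ (2 * m) := by gcongr
          _ = _ := by ring
      calc _ ≤ 4 ^ (m + 1) * (s ^ 2 / p * (2 * (√μ * b ^ (2 * m + 1)) + 2 * (√μ * b ^ (2 * m + 1)))
            + s ^ (2 * m) * (s ^ 2 / p * (√μ * b ^ (2 * m + 1)))) := by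
            gcongr
            · exact hmix.trans (by gcongr)
            · exact hfl.trans (by gcongr)
        _ = _ := by rw [hC]; ring
    set b' := θ * ϖ * α + K * √(max (h * (θ * P)) 1) with hb'
    have hμ' : √θ * √μ ≤ √(max (h * (θ * P)) 1) := by
      rw [← Real.sqrt_mul hθ0]
      refine Real.sqrt_le_sqrt ?_
      rw [hμ, mul_max_of_nonneg _ _ hθ0]
      refine max_le_max (le_of_eq (by ring)) (by linarith)
    -- Room left in the target after multiplication by θ, from `add_mul_le_sqrt`.
    have hdiff : θ * b + K * √μ * (θ * (1 - θ) / 2) ≤ b' := by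
      have h1 := add_mul_le_sqrt hθ0 hθ1
      have h2 : K * ((θ + θ * (1 - θ) / 2) * √μ) ≤ K * √(max (h * (θ * P)) 1) := by
        gcongr
        exact (mul_le_mul_of_nonneg_right h1 (Real.sqrt_nonneg _)).trans hμ'
      rw [hb', hb]
      linarith
    have hx0 : 0 ≤ K * √μ * (θ * (1 - θ) / 2) := by
      have : 0 ≤ 1 - θ := by linarith
      positivity
    -- `K` is chosen so that this room exceeds the error; the factor (2sθ)^(2(m+1)) ≥ 1 is inserted
    -- to produce the required powers of θ.
    have hgain : C * (1 / p) * (√μ * b ^ (2 * m + 1))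
        ≤ (θ * b) ^ (2 * m + 1) * (K * √μ * (θ * (1 - θ) / 2)) := by
      have hθs : 1 ≤ 2 * s * θ := by
        rw [div_le_iff₀ (by positivity)] at hθ
        linarith
      have h1 : 1 ≤ (2 * s * θ) ^ (2 * (m + 1)) := one_le_pow₀ hθs
      have h2 : 2 * (2 * (s : ℝ)) ^ (2 * (m + 1)) * C ≤ K := by linarith
      calc C * (1 / p) * (√μ * b ^ (2 * m + 1))
          ≤ C * (1 - θ) * (√μ * b ^ (2 * m + 1)) := by gcongr
        _ = C * (1 - θ) * (√μ * b ^ (2 * m + 1)) * 1 := by ring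
        _ ≤ C * (1 - θ) * (√μ * b ^ (2 * m + 1)) * (2 * s * θ) ^ (2 * (m + 1)) := by
            have : 0 ≤ 1 - θ := by linarith
            gcongr
        _ = (θ * b) ^ (2 * m + 1) * (2 * (2 * (s : ℝ)) ^ (2 * (m + 1)) * C
              * √μ * (θ * (1 - θ) / 2)) := by
            rw [mul_pow _ θ, mul_pow θ b, show 2 * (m + 1) = 2 * m + 1 + 1 by ring, pow_succ θ]
            ring
        _ ≤ _ := by
            have : 0 ≤ 1 - θ := by linarith
            gcongr
    calc _ ≤ θ ^ (2 * (m + 1)) * b ^ (2 * (m + 1))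
          + (θ * b) ^ (2 * m + 1) * (K * √μ * (θ * (1 - θ) / 2)) := by
          exact add_le_add (mul_le_mul_of_nonneg_left hX (by positivity)) (hextra.trans hgain)
      _ = (θ * b) ^ (2 * m + 1 + 1)
          + (θ * b) ^ (2 * m + 1) * (K * √μ * (θ * (1 - θ) / 2)) := by
          rw [← mul_pow, show 2 * (m + 1) = 2 * m + 1 + 1 by ring]
      _ ≤ (θ * b + K * √μ * (θ * (1 - θ) / 2)) ^ (2 * m + 1 + 1) :=
          pow_succ_add_le (by positivity) hx0 _
      _ ≤ b' ^ (2 * m + 1 + 1) :=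
          pow_le_pow_left₀ (add_nonneg (mul_nonneg hθ0 hb0.le) hx0) hdiff _
      _ = _ := by rw [show 2 * m + 1 + 1 = 2 * (m + 1) by ring]

end moments

/-! ### The ℓ² norm of correlations on a product of cyclic groups -/

section energy

/-- The `ℓ²` norm of a family over the non-zero residues. -/
noncomputable def offNorm {l : ℕ} [NeZero l] {A : Type*} (f : ZMod l → A → ℝ) (a : A) : ℝ :=
  √(∑ x ∈ Finset.univ.erase (0 : ZMod l), f x a ^ 2)

theorem offNorm_nonneg {l : ℕ} [NeZero l] {A : Type*} (f : ZMod l → A → ℝ) (a : A) :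
    0 ≤ offNorm f a := Real.sqrt_nonneg _

theorem offNorm_sq {l : ℕ} [NeZero l] {A : Type*} (f : ZMod l → A → ℝ) (a : A) :
    offNorm f a ^ 2 = ∑ x ∈ Finset.univ.erase (0 : ZMod l), f x a ^ 2 :=
  Real.sq_sqrt (Finset.sum_nonneg fun _ _ => sq_nonneg _)

/-- Minkowski's inequality in ℓ²(s): the squares are expanded and Cauchy–Schwarz is applied to each
pair (a, b). -/
theorem sum_sq_sum_mul_le {ι A : Type*} [Fintype A] (s : Finset ι) (f : ι → A → ℝ) {c : A → ℝ}
    (hc : ∀ a, 0 ≤ c a) :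
    ∑ y ∈ s, (∑ a, f y a * c a) ^ 2 ≤ (∑ a, √(∑ y ∈ s, f y a ^ 2) * c a) ^ 2 := by
  have e1 : ∀ y, (∑ a, f y a * c a) ^ 2 = ∑ a, ∑ b, c a * c b * (f y a * f y b) := fun y => by
    rw [sq, Finset.sum_mul_sum]
    exact Finset.sum_congr rfl fun a _ => Finset.sum_congr rfl fun b _ => by ring
  have e2 : ∑ y ∈ s, (∑ a, f y a * c a) ^ 2
      = ∑ a, ∑ b, c a * c b * ∑ y ∈ s, f y a * f y b := by
    simp_rw [e1, Finset.mul_sum]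
    rw [Finset.sum_comm]
    exact Finset.sum_congr rfl fun a _ => Finset.sum_comm
  rw [e2, sq, Finset.sum_mul_sum]
  refine Finset.sum_le_sum fun a _ => Finset.sum_le_sum fun b _ => ?_
  calc c a * c b * ∑ y ∈ s, f y a * f y b
      ≤ c a * c b * (√(∑ y ∈ s, f y a ^ 2) * √(∑ y ∈ s, f y b ^ 2)) :=
        mul_le_mul_of_nonneg_left (Real.sum_mul_le_sqrt_mul_sqrt _ _ _)
          (mul_nonneg (hc a) (hc b))
    _ = _ := by ring

/-- The one-coordinate step. Families over ℤ/l are reduced to two functions, the value at 0 and the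
ℓ² norm over the non-zero residues, the second weighing κ in energy. What matters is a factor of the
form 1 + O(κ + lκ²): with κ of order 1/l it is 1 + O(1/l), so that the product over all coordinates
is only a power of a logarithm. -/
theorem sum_sq_corr_prod_le {l : ℕ} [NeZero l] {A : Type*} [Fintype A] [AddCommGroup A]
    {f g : ZMod l → A → ℝ} (hf : ∀ x a, 0 ≤ f x a) (hg : ∀ x a, 0 ≤ g x a) {κ X : ℝ} (hκ : 0 < κ)
    (h00 : ∑ d, (∑ a, f 0 a * g 0 (a - d)) ^ 2 ≤ X)
    (h10 : ∑ d, (∑ a, offNorm f a * g 0 (a - d)) ^ 2 ≤ κ * X)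
    (h01 : ∑ d, (∑ a, f 0 a * offNorm g (a - d)) ^ 2 ≤ κ * X)
    (h11 : ∑ d, (∑ a, offNorm f a * offNorm g (a - d)) ^ 2 ≤ κ ^ 2 * X) :
    ∑ y, ∑ d, (∑ x, ∑ a, f x a * g (x - y) (a - d)) ^ 2
      ≤ ((1 + κ) ^ 2 + 6 * κ + 3 * l * κ ^ 2) * X := by
  classical
  set U := Finset.univ.erase (0 : ZMod l) with hU
  have hX : 0 ≤ X := (Finset.sum_nonneg fun _ _ => sq_nonneg _).trans h00
  -- Where neither x nor x - y vanishes, Cauchy–Schwarz in x bounds the sum by the off-zero norms.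
  have cs : ∀ (V : Finset (ZMod l)) (y : ZMod l) (d : A), (∀ x ∈ V, x ≠ 0 ∧ x ≠ y) →
      ∑ x ∈ V, ∑ a, f x a * g (x - y) (a - d) ≤ ∑ a, offNorm f a * offNorm g (a - d) := by
    intro V y d hV
    rw [Finset.sum_comm]
    refine Finset.sum_le_sum fun a _ => (Real.sum_mul_le_sqrt_mul_sqrt _ _ _).trans ?_
    refine mul_le_mul (Real.sqrt_le_sqrt ?_) (Real.sqrt_le_sqrt ?_) (Real.sqrt_nonneg _)
      (Real.sqrt_nonneg _)
    · refine Finset.sum_le_sum_of_subset_of_nonneg (fun x hx => ?_) fun _ _ _ => sq_nonneg _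
      simp [(hV x hx).1]
    · rw [← Finset.sum_image (f := fun z => g z (a - d) ^ 2) (g := fun x => x - y)
        (fun u _ v _ h => by simpa using h)]
      refine Finset.sum_le_sum_of_subset_of_nonneg (fun z hz => ?_) fun _ _ _ => sq_nonneg _
      obtain ⟨x, hx, rfl⟩ := Finset.mem_image.mp hz
      simp [sub_eq_zero, (hV x hx).2]
  -- The weights 1 + κ and 1 + 1/κ in (u + v)² ≤ (1 + κ)u² + (1 + 1/κ)v² give exactly (1 + κ)²,
  -- which keeps the leading coefficient 1.
  have zero_part : ∑ d, (∑ x, ∑ a, f x a * g (x - 0) (a - d)) ^ 2 ≤ (1 + κ) ^ 2 * X := by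
    have key : ∀ d, (∑ x, ∑ a, f x a * g (x - 0) (a - d)) ^ 2
        ≤ (1 + κ) * (∑ a, f 0 a * g 0 (a - d)) ^ 2
          + (1 + 1 / κ) * (∑ a, offNorm f a * offNorm g (a - d)) ^ 2 := by
      intro d
      have h0 : 0 ≤ ∑ x, ∑ a, f x a * g (x - 0) (a - d) :=
        Finset.sum_nonneg fun x _ => Finset.sum_nonneg fun a _ => mul_nonneg (hf _ _) (hg _ _)
      have h1 : ∑ x, ∑ a, f x a * g (x - 0) (a - d)
          ≤ (∑ a, f 0 a * g 0 (a - d)) + ∑ a, offNorm f a * offNorm g (a - d) := by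
        rw [← Finset.add_sum_erase _ _ (Finset.mem_univ (0 : ZMod l))]
        refine add_le_add (by simp) (cs U 0 d fun x hx => ?_)
        simpa [hU] using hx
      refine (pow_le_pow_left₀ h0 h1 2).trans ?_
      set u := ∑ a, f 0 a * g 0 (a - d)
      set v := ∑ a, offNorm f a * offNorm g (a - d)
      have h2 : 0 ≤ (1 / κ) * (κ * u - v) ^ 2 := by positivity
      have h3 : (1 / κ) * (κ * u - v) ^ 2 = κ * u ^ 2 - 2 * u * v + (1 / κ) * v ^ 2 := by
        field_simp
        ring
      nlinarith
    refine (Finset.sum_le_sum fun d _ => key d).trans ?_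
    rw [Finset.sum_add_distrib, ← Finset.mul_sum, ← Finset.mul_sum]
    calc _ ≤ (1 + κ) * X + (1 + 1 / κ) * (κ ^ 2 * X) := by gcongr
      _ = _ := by field_simp; ring
  -- For y ≠ 0 one splits off x = y and x = 0, each of energy κ after summation over y. The
  -- remaining part does not depend on y, and there are at most l values of y, which yields lκ².
  have off_part : ∑ y ∈ U, ∑ d, (∑ x, ∑ a, f x a * g (x - y) (a - d)) ^ 2
      ≤ (6 * κ + 3 * l * κ ^ 2) * X := by
    have key : ∀ y ∈ U, ∀ d, (∑ x, ∑ a, f x a * g (x - y) (a - d)) ^ 2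
        ≤ 3 * (∑ a, f y a * g 0 (a - d)) ^ 2 + 3 * (∑ a, f 0 a * g (-y) (a - d)) ^ 2
          + 3 * (∑ a, offNorm f a * offNorm g (a - d)) ^ 2 := by
      intro y hy d
      have hy0 : y ≠ 0 := by simpa [hU] using hy
      have h0 : 0 ≤ ∑ x, ∑ a, f x a * g (x - y) (a - d) :=
        Finset.sum_nonneg fun x _ => Finset.sum_nonneg fun a _ => mul_nonneg (hf _ _) (hg _ _)
      have h1 : ∑ x, ∑ a, f x a * g (x - y) (a - d)
          ≤ (∑ a, f y a * g 0 (a - d)) + (∑ a, f 0 a * g (-y) (a - d))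
            + ∑ a, offNorm f a * offNorm g (a - d) := by
        rw [← Finset.add_sum_erase _ _ (Finset.mem_univ y),
          ← Finset.add_sum_erase _ _ (Finset.mem_erase.mpr ⟨hy0.symm, Finset.mem_univ 0⟩),
          ← add_assoc]
        refine add_le_add (by simp) (cs _ y d fun x hx => ?_)
        simp only [Finset.mem_erase] at hx
        exact ⟨hx.1, hx.2.1⟩
      refine (pow_le_pow_left₀ h0 h1 2).trans ?_
      set u := ∑ a, f y a * g 0 (a - d)
      set v := ∑ a, f 0 a * g (-y) (a - d)
      set w := ∑ a, offNorm f a * offNorm g (a - d)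
      nlinarith [sq_nonneg (u - v), sq_nonneg (u - w), sq_nonneg (v - w)]
    refine (Finset.sum_le_sum fun y hy => Finset.sum_le_sum fun d _ => key y hy d).trans ?_
    simp only [Finset.sum_add_distrib, ← Finset.mul_sum]
    have t1 : ∑ y ∈ U, ∑ d, (∑ a, f y a * g 0 (a - d)) ^ 2 ≤ κ * X := by
      rw [Finset.sum_comm]
      exact (Finset.sum_le_sum fun d _ => sum_sq_sum_mul_le U f fun a => hg 0 (a - d)).trans h10
    have t2 : ∑ y ∈ U, ∑ d, (∑ a, f 0 a * g (-y) (a - d)) ^ 2 ≤ κ * X := by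
      rw [Finset.sum_comm]
      refine (Finset.sum_le_sum fun d _ => ?_).trans h01
      have := sum_sq_sum_mul_le U (fun y a => g (-y) (a - d)) (hf 0)
      simp only [mul_comm (g _ _)] at this
      refine this.trans (le_of_eq ?_)
      congr 1
      refine Finset.sum_congr rfl fun a _ => ?_
      rw [mul_comm, offNorm]
      congr 2
      refine Finset.sum_nbij' (fun y => -y) (fun y => -y) ?_ ?_ ?_ ?_ ?_ <;> simp [hU]
    have t3 : ∑ y ∈ U, ∑ d, (∑ a, offNorm f a * offNorm g (a - d)) ^ 2 ≤ l * (κ ^ 2 * X) := by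
      rw [Finset.sum_const, nsmul_eq_mul]
      refine mul_le_mul ?_ h11 (Finset.sum_nonneg fun _ _ => sq_nonneg _) (Nat.cast_nonneg _)
      have : U.card ≤ l := (Finset.card_le_univ _).trans_eq (ZMod.card l)
      exact_mod_cast this
    linarith
  rw [← Finset.add_sum_erase _ _ (Finset.mem_univ (0 : ZMod l))]
  calc _ ≤ (1 + κ) ^ 2 * X + (6 * κ + 3 * l * κ ^ 2) * X := add_le_add zero_part off_part
    _ = _ := by ring

/-- The set of coordinates at which `a` does not vanish. -/
def freqSupport {ι : Type*} [Fintype ι] {l : ι → ℕ} (a : ∀ i, ZMod (l i)) : Finset ι :=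
  {i | a i ≠ 0}

theorem mem_freqSupport {ι : Type*} [Fintype ι] {l : ι → ℕ} {a : ∀ i, ZMod (l i)} {i : ι} :
    i ∈ freqSupport a ↔ a i ≠ 0 := by simp [freqSupport]

theorem sum_pi_fin_succ {n : ℕ} {l : Fin (n + 1) → ℕ} [∀ i, NeZero (l i)]
    (F : (∀ i, ZMod (l i)) → ℝ) :
    ∑ a, F a = ∑ x : ZMod (l 0), ∑ b : ∀ i : Fin n, ZMod (l i.succ), F (Fin.cons x b) := by
  rw [← Fintype.sum_prod_type' fun (x : ZMod (l 0)) (b : ∀ i : Fin n, ZMod (l i.succ)) =>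
    F (Fin.cons x b)]
  exact (Equiv.sum_comp (Fin.consEquiv fun i => ZMod (l i)) F).symm

theorem cons_sub_cons {n : ℕ} {l : Fin (n + 1) → ℕ} (x y : ZMod (l 0))
    (a b : ∀ i : Fin n, ZMod (l i.succ)) :
    (Fin.cons x a - Fin.cons y b : ∀ i, ZMod (l i)) = Fin.cons (x - y) (a - b) := by
  ext i
  refine Fin.cases ?_ (fun j => ?_) i <;> simp

theorem freqSupport_cons_zero {n : ℕ} {l : Fin (n + 1) → ℕ} 
    (b : ∀ i : Fin n, ZMod (l i.succ)) (T : Finset (Fin n)) :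
    freqSupport (Fin.cons 0 b : ∀ i, ZMod (l i)) = T.map (Fin.succEmb n) ↔ freqSupport b = T := by
  simp only [Finset.ext_iff, mem_freqSupport, Finset.mem_map, Fin.coe_succEmb]
  refine ⟨fun h i => ?_, fun h i => ?_⟩
  · simpa using h i.succ
  · refine Fin.cases ?_ (fun j => ?_) i
    · simp
    · simpa using h j

theorem freqSupport_cons_ne {n : ℕ} {l : Fin (n + 1) → ℕ} {x : ZMod (l 0)} (hx : x ≠ 0)
    (b : ∀ i : Fin n, ZMod (l i.succ)) (T : Finset (Fin n)) :
    freqSupport (Fin.cons x b : ∀ i, ZMod (l i)) = insert 0 (T.map (Fin.succEmb n))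
      ↔ freqSupport b = T := by
  simp only [Finset.ext_iff, mem_freqSupport, Finset.mem_insert, Finset.mem_map, Fin.coe_succEmb]
  refine ⟨fun h i => ?_, fun h i => ?_⟩
  · simpa using h i.succ
  · refine Fin.cases ?_ (fun j => ?_) i
    · simpa using hx
    · simpa using h j

/-- If the mass of `f ^ 2` and of `g ^ 2` on the frequencies with given support is controlled by an
Euler product, then so is the `ℓ²` norm of the correlation of `f` and `g`. -/
theorem sum_sq_corr_le (n : ℕ) : ∀ (l : Fin n → ℕ) [∀ i, NeZero (l i)] (κ : Fin n → ℝ),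
    (∀ i, 0 < κ i) → ∀ f g : (∀ i, ZMod (l i)) → ℝ, (∀ a, 0 ≤ f a) → (∀ a, 0 ≤ g a) →
    ∀ B B' : ℝ, 0 ≤ B → 0 ≤ B' →
    (∀ T : Finset (Fin n), ∑ a with freqSupport a = T, f a ^ 2 ≤ B * ∏ i ∈ T, κ i) →
    (∀ T : Finset (Fin n), ∑ a with freqSupport a = T, g a ^ 2 ≤ B' * ∏ i ∈ T, κ i) →
    ∑ d, (∑ a, f a * g (a - d)) ^ 2
      ≤ (∏ i, ((1 + κ i) ^ 2 + 6 * κ i + 3 * l i * κ i ^ 2)) * (B * B') := by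
  induction n with
  | zero =>
    intro l _ κ _ f g hf hg B B' hB hB' h1 h2
    have h1 := h1 ∅
    have h2 := h2 ∅
    have e : ∀ a : (∀ i, ZMod (l i)), freqSupport a = ∅ := fun a => by
      ext i; exact i.elim0
    simp only [e, Finset.filter_true, Finset.prod_empty, mul_one, Finset.univ_unique,
      Finset.sum_singleton] at h1 h2
    simp only [Finset.univ_unique, Finset.sum_singleton, Finset.prod_empty,
      Finset.univ_eq_empty, one_mul, mul_pow]
    refine mul_le_mul h1 (le_of_eq_of_le ?_ h2) (sq_nonneg _) hB
    exact congrArg (fun a => g a ^ 2) (Subsingleton.elim _ _)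
  | succ n ih =>
    intro l _ κ hκ f g hf hg B B' hB hB' h1 h2
    set l' : Fin n → ℕ := fun i => l i.succ
    set κ' : Fin n → ℝ := fun i => κ i.succ
    -- The slice at 0 in the first coordinate satisfies the hypotheses with the same constant; in
    -- `slice1` the off-zero norm satisfies them with an extra factor `κ 0`.
    have slice0 : ∀ (F : (∀ i, ZMod (l i)) → ℝ) (b : ℝ), 
        (∀ T : Finset (Fin (n + 1)), ∑ a with freqSupport a = T, F a ^ 2 ≤ b * ∏ i ∈ T, κ i) →
        ∀ T : Finset (Fin n), ∑ a : ∀ i, ZMod (l' i) with freqSupport a = T,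
          F (Fin.cons 0 a) ^ 2 ≤ b * ∏ i ∈ T, κ' i := by
      intro F b hF T
      have := hF (T.map (Fin.succEmb n))
      rw [Finset.prod_map, Finset.sum_filter, sum_pi_fin_succ,
        ← Finset.add_sum_erase _ _ (Finset.mem_univ (0 : ZMod (l 0)))] at this
      refine le_trans ?_ this
      rw [Finset.sum_filter]
      simp only [freqSupport_cons_zero]
      exact le_add_of_nonneg_right (Finset.sum_nonneg fun _ _ => Finset.sum_nonneg fun _ _ => by
        split_ifs <;> positivity)
    have slice1 : ∀ (F : (∀ i, ZMod (l i)) → ℝ) (b : ℝ), 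
        (∀ T : Finset (Fin (n + 1)), ∑ a with freqSupport a = T, F a ^ 2 ≤ b * ∏ i ∈ T, κ i) →
        ∀ T : Finset (Fin n), ∑ a : ∀ i, ZMod (l' i) with freqSupport a = T,
          offNorm (fun (x : ZMod (l 0)) (a : ∀ i, ZMod (l' i)) => F (Fin.cons x a)) a ^ 2
            ≤ b * κ 0 * ∏ i ∈ T, κ' i := by
      intro F b hF T
      have := hF (insert 0 (T.map (Fin.succEmb n)))
      rw [Finset.prod_insert (by simp), Finset.prod_map, Finset.sum_filter, sum_pi_fin_succ,
        ← Finset.add_sum_erase _ _ (Finset.mem_univ (0 : ZMod (l 0))), ← mul_assoc] at this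
      refine le_trans ?_ this
      refine le_trans ?_ (le_add_of_nonneg_left (Finset.sum_nonneg fun _ _ => by
        split_ifs <;> positivity))
      rw [Finset.sum_filter]
      simp only [offNorm_sq]
      rw [Finset.sum_comm' (t' := Finset.univ) (s' := fun _ => Finset.univ.erase (0 : ZMod (l 0)))
        (by simp)]
      refine Finset.sum_le_sum fun a _ => ?_
      have e : ∀ x ∈ Finset.univ.erase (0 : ZMod (l 0)),
          (if freqSupport (Fin.cons x a : ∀ i, ZMod (l i)) = insert 0 (T.map (Fin.succEmb n))
            then F (Fin.cons x a) ^ 2 else 0)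
          = if freqSupport a = T then F (Fin.cons x a) ^ 2 else 0 := fun x hx => by
        simp only [freqSupport_cons_ne (Finset.ne_of_mem_erase hx) a T]
      rw [Finset.sum_congr rfl e]
      split_ifs <;> simp
    rw [sum_pi_fin_succ]
    simp only [sum_pi_fin_succ (l := l), cons_sub_cons]
    rw [Fin.prod_univ_succ, mul_assoc]
    refine sum_sq_corr_prod_le (f := fun x a => f (Fin.cons x a)) (g := fun x a => g (Fin.cons x a))
      (fun _ _ => hf _) (fun _ _ => hg _) (hκ 0) ?_ ?_ ?_ ?_
    · exact ih l' κ' (fun i => hκ _) _ _ (fun _ => hf _) (fun _ => hg _) B B' hB hB'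
        (slice0 f B h1) (slice0 g B' h2)
    · refine (ih l' κ' (fun i => hκ _) _ _ (offNorm_nonneg _) (fun _ => hg _) (B * κ 0) B'
        (mul_nonneg hB (hκ 0).le) hB' (slice1 f B h1) (slice0 g B' h2)).trans_eq ?_
      ring
    · refine (ih l' κ' (fun i => hκ _) _ _ (fun _ => hf _) (offNorm_nonneg _) B (B' * κ 0) hB
        (mul_nonneg hB' (hκ 0).le) (slice0 f B h1) (slice1 g B' h2)).trans_eq ?_
      ring
    · refine (ih l' κ' (fun i => hκ _) _ _ (offNorm_nonneg _) (offNorm_nonneg _) (B * κ 0)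
        (B' * κ 0) (mul_nonneg hB (hκ 0).le) (mul_nonneg hB' (hκ 0).le) (slice1 f B h1)
        (slice1 g B' h2)).trans_eq ?_
      ring

end energy

/-! ### Exponential sums on the circle -/

section circle

/-- The exponential `x ↦ e(x)` on `ℝ / ℤ`. -/
noncomputable def expo (x : UnitAddCircle) : ℂ := (AddCircle.toCircle x : ℂ)

theorem expo_add (x y : UnitAddCircle) : expo (x + y) = expo x * expo y := by
  simp [expo, AddCircle.toCircle_add]

theorem expo_zero : expo 0 = 1 := by simp [expo, AddCircle.toCircle_zero]

theorem norm_expo (x : UnitAddCircle) : ‖expo x‖ = 1 := Circle.norm_coe _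

theorem expo_neg (x : UnitAddCircle) : expo (-x) = (starRingEnd ℂ) (expo x) := by
  rw [expo, AddCircle.toCircle_neg, Circle.coe_inv_eq_conj, expo]

theorem expo_nsmul (n : ℕ) (x : UnitAddCircle) : expo (n • x) = expo x ^ n := by
  simp [expo, AddCircle.toCircle_nsmul]

theorem expo_sum {ι : Type*} (s : Finset ι) (x : ι → UnitAddCircle) :
    expo (∑ i ∈ s, x i) = ∏ i ∈ s, expo (x i) := by
  classical
  induction s using Finset.induction_on with
  | empty => simp [expo_zero]
  | insert i s hi ih => rw [Finset.sum_insert hi, Finset.prod_insert hi, expo_add, ih]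

theorem exists_coe_eq_norm (x : UnitAddCircle) : ∃ θ : ℝ, x = θ ∧ ‖x‖ = |θ| ∧ |θ| ≤ 1 / 2 := by
  obtain ⟨θ, rfl⟩ := QuotientAddGroup.mk_surjective x
  refine ⟨θ - round θ, ?_, UnitAddCircle.norm_eq, abs_sub_round θ⟩
  rw [AddCircle.coe_sub]
  have : ((round θ : ℝ) : UnitAddCircle) = 0 := by
    rw [AddCircle.coe_eq_zero_iff]; exact ⟨round θ, by simp⟩
  rw [this, sub_zero]

/-- The chord |e(θ) - 1| equals 2|sin πθ|, and Jordan's inequality bounds the sine from below on |θ|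
≤ 1/2. -/
theorem four_mul_norm_le_norm_expo_sub_one (x : UnitAddCircle) : 4 * ‖x‖ ≤ ‖expo x - 1‖ := by
  obtain ⟨θ, rfl, hn, hθ⟩ := exists_coe_eq_norm x
  have e : expo (θ : UnitAddCircle) = Complex.exp (Complex.I * ((2 * Real.pi * θ : ℝ) : ℂ)) := by
    rw [expo, AddCircle.toCircle_apply_mk, Circle.coe_exp, mul_comm Complex.I]
    simp
  have hπ := Real.pi_pos
  rw [hn, e, Complex.norm_exp_I_mul_ofReal_sub_one, Real.norm_eq_abs, abs_mul,
    show 2 * Real.pi * θ / 2 = Real.pi * θ by ring]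
  have h1 : |Real.pi * θ| ≤ Real.pi / 2 := by
    rw [abs_mul, abs_of_pos hπ]; nlinarith
  have h2 := Real.mul_abs_le_abs_sin h1
  rw [abs_mul, abs_of_pos hπ, ← mul_assoc, div_mul_cancel₀ _ hπ.ne'] at h2
  rw [abs_of_pos (two_pos : (0 : ℝ) < 2)]
  linarith

/-- The standard majorant `min (h, 1 / (2 ‖x‖))` for an exponential sum of length `h`. -/
noncomputable def expSumBound (h : ℝ) (x : UnitAddCircle) : ℝ := min h (1 / (2 * ‖x‖))

theorem expSumBound_nonneg {h : ℝ} (hh : 0 ≤ h) (x : UnitAddCircle) : 0 ≤ expSumBound h x :=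
  le_min hh (by positivity)

theorem expSumBound_mono {h h' : ℝ} (hh : h ≤ h') (x : UnitAddCircle) :
    expSumBound h x ≤ expSumBound h' x := min_le_min_right _ hh

theorem norm_sum_expo_le {x : UnitAddCircle} (hx : x ≠ 0) (h k : ℕ) :
    ‖∑ t ∈ Finset.Ico k (k + h), expo (t • x)‖ ≤ expSumBound h x := by
  refine le_min ?_ ?_
  · refine (norm_sum_le _ _).trans ?_
    simp [norm_expo]
  · have hx' : 0 < ‖x‖ := norm_pos_iff.mpr hx
    rw [le_div_iff₀ (by positivity)]
    have h1 := four_mul_norm_le_norm_expo_sub_one x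
    have h2 : (∑ t ∈ Finset.Ico k (k + h), expo (t • x)) * (expo x - 1)
        = expo x ^ (k + h) - expo x ^ k := by
      simp_rw [expo_nsmul]
      exact geom_sum_Ico_mul _ (by omega)
    have h3 : ‖expo x ^ (k + h) - expo x ^ k‖ ≤ 2 := by
      refine (norm_sub_le _ _).trans ?_
      simp only [norm_pow, norm_expo, one_pow]
      norm_num
    rw [← h2, norm_mul] at h3
    nlinarith [norm_nonneg (∑ t ∈ Finset.Ico k (k + h), expo (t • x))]

/-- Both sides of the minimum are at most 2x/(j + 1 + c), where c = x/h is the crossover point, and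
the squares of these majorants telescope to 4x²/c. -/
theorem sum_min_div_sq_le {h x : ℝ} (hh : 0 < h) (hx : 0 < x) (N : ℕ) :
    ∑ j ∈ Finset.range N, (min h (x / (j + 1))) ^ 2 ≤ 4 * x * h := by
  set c := x / h with hc
  have hc0 : 0 < c := by positivity
  have key : ∀ j : ℕ, (min h (x / (j + 1))) ^ 2 ≤ 4 * x ^ 2 * (1 / (j + c) - 1 / ((j + 1 : ℕ) + c)) := by
    intro j
    have h0 : 0 ≤ min h (x / (j + 1)) := le_min hh.le (by positivity)
    have h1 : min h (x / (j + 1)) ≤ 2 * x / (j + 1 + c) := by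
      rw [le_div_iff₀ (by positivity)]
      rcases le_total ((j + 1 : ℝ)) c with hj | hj
      · calc min h (x / (j + 1)) * (j + 1 + c) ≤ h * (c + c) := by
              gcongr
              exact min_le_left _ _
          _ = 2 * x := by rw [hc]; field_simp; ring
      · calc min h (x / (j + 1)) * (j + 1 + c) ≤ x / (j + 1) * ((j + 1) + (j + 1)) := by
              gcongr
              exact min_le_right _ _
          _ = 2 * x := by field_simp; ring
    refine (pow_le_pow_left₀ h0 h1 2).trans ?_
    rw [div_pow, div_eq_mul_one_div, show (2 * x) ^ 2 = 4 * x ^ 2 by ring]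
    gcongr
    push_cast
    rw [div_sub_div _ _ (by positivity) (by positivity), div_le_div_iff₀ (by positivity)
      (by positivity)]
    nlinarith [mul_pos (show (0 : ℝ) < j + 1 + c by positivity) (show (0 : ℝ) < j + 1 + c by positivity)]
  refine (Finset.sum_le_sum fun j _ => key j).trans ?_
  rw [← Finset.mul_sum, Finset.sum_range_sub' (fun j : ℕ => 1 / ((j : ℝ) + c))]
  have : 1 / (((0 : ℕ) : ℝ) + c) - 1 / ((N : ℝ) + c) ≤ h / x := by
    have : 0 ≤ 1 / ((N : ℝ) + c) := by positivity
    have e : 1 / (((0 : ℕ) : ℝ) + c) = h / x := by rw [hc]; simp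
    linarith
  calc _ ≤ 4 * x ^ 2 * (h / x) := by gcongr
    _ = _ := by field_simp

theorem exists_eq_coe_div_of_nsmul_eq_zero {N : ℕ} (hN : 0 < N) {x : UnitAddCircle} (h0 : x ≠ 0)
    (ht : N • x = 0) : ∃ j : ℕ, 0 < j ∧ j < N ∧ x = ((j / N : ℝ) : UnitAddCircle) := by
  have hNR : (0 : ℝ) < N := by exact_mod_cast hN
  obtain ⟨θ, rfl⟩ := QuotientAddGroup.mk_surjective x
  change ((θ : ℝ) : UnitAddCircle) ≠ 0 at h0
  change N • ((θ : ℝ) : UnitAddCircle) = 0 at ht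
  rw [← AddCircle.coe_nsmul, AddCircle.coe_eq_zero_iff] at ht
  obtain ⟨m, hm⟩ := ht
  simp only [zsmul_eq_mul, mul_one, nsmul_eq_mul] at hm
  have hθ : θ = m / N := by field_simp; linarith
  set j := (m % N).toNat with hj
  have hmod : 0 ≤ m % (N : ℤ) := Int.emod_nonneg _ (by omega)
  have hlt : m % (N : ℤ) < N := Int.emod_lt_of_pos _ (by omega)
  have hjm : (j : ℤ) = m % N := Int.toNat_of_nonneg hmod
  have hmj : (m : ℝ) = j + N * (m / (N : ℤ) : ℤ) := by
    have := Int.emod_add_mul_ediv m N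
    rw [← hjm] at this
    exact_mod_cast this.symm
  have hxj : ((θ : ℝ) : UnitAddCircle) = ((j / N : ℝ) : UnitAddCircle) := by
    rw [hθ, hmj, add_div, mul_div_cancel_left₀ _ hNR.ne', AddCircle.coe_add]
    have : (((m / (N : ℤ) : ℤ) : ℝ) : UnitAddCircle) = 0 := by
      rw [AddCircle.coe_eq_zero_iff]; exact ⟨m / (N : ℤ), by simp⟩
    rw [this, add_zero]
  have hj0 : j ≠ 0 := by
    intro hj0
    rw [hxj, hj0] at h0
    simp at h0
  exact ⟨j, by omega, by omega, hxj⟩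

/-- The non-zero N-torsion points are j/N with 0 < j < N. The distance to the nearest integer is
measured from one end or the other, so the sum splits into two sums that are reflections of each
other. -/
theorem sum_expSumBound_sq_torsion_le {N : ℕ} (hN : 0 < N) {h : ℝ} (hh : 0 < h)
    (P : Finset UnitAddCircle) (hP : ∀ x ∈ P, x ≠ 0 ∧ N • x = 0) :
    ∑ x ∈ P, expSumBound h x ^ 2 ≤ 4 * N * h := by
  classical
  have hNR : (0 : ℝ) < N := by exact_mod_cast hN
  have hsub : P ⊆ (Finset.range (N - 1)).image (fun j : ℕ => (((j + 1 : ℕ) / N : ℝ) : UnitAddCircle)) := by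
    intro x hx
    obtain ⟨j, hj0, hjN, hxj⟩ := exists_eq_coe_div_of_nsmul_eq_zero hN (hP x hx).1 (hP x hx).2
    refine Finset.mem_image.mpr ⟨j - 1, Finset.mem_range.mpr (by omega), ?_⟩
    rw [Nat.sub_add_cancel (by omega)]
    exact hxj.symm
  refine (Finset.sum_le_sum_of_subset_of_nonneg hsub fun _ _ _ => sq_nonneg _).trans ?_
  refine (Finset.sum_image_le_of_nonneg (fun _ _ => sq_nonneg _)).trans ?_
  have key : ∀ j ∈ Finset.range (N - 1), expSumBound h (((j + 1 : ℕ) / N : ℝ) : UnitAddCircle) ^ 2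
      ≤ (min h (N / 2 / (j + 1))) ^ 2 + (min h (N / 2 / ((N - 1 - 1 - j : ℕ) + 1))) ^ 2 := by
    intro j hj
    have hj := Finset.mem_range.mp hj
    have hnorm := AddCircle.norm_div_natCast (p := 1) (m := j + 1) (n := N)
    rw [Nat.mod_eq_of_lt (by omega), mul_one, one_mul] at hnorm
    rw [expSumBound, hnorm]
    have e1 : ((N - 1 - 1 - j : ℕ) : ℝ) + 1 = ((N - (j + 1) : ℕ) : ℝ) := by
      have : N - 1 - 1 - j + 1 = N - (j + 1) := by omega
      exact_mod_cast this
    rw [e1]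
    have e2 : ∀ a : ℕ, 0 < a → 1 / (2 * ((a : ℝ) / N)) = N / 2 / a := fun a ha => by
      have : (0 : ℝ) < a := by exact_mod_cast ha
      field_simp
    rcases min_choice (j + 1) (N - (j + 1)) with hm | hm
    · rw [hm, e2 _ (by omega)]
      push_cast
      exact le_add_of_nonneg_right (sq_nonneg _)
    · rw [hm, e2 _ (by omega)]
      exact le_add_of_nonneg_left (sq_nonneg _)
  refine (Finset.sum_le_sum key).trans ?_
  rw [Finset.sum_add_distrib, Finset.sum_range_reflect
    (fun j : ℕ => (min h ((N : ℝ) / 2 / (j + 1))) ^ 2) (N - 1)]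
  have := sum_min_div_sq_le hh (show (0 : ℝ) < N / 2 by positivity) (N - 1)
  linarith

end circle

/-! ### Finite Fourier expansions with frequencies ∑ a_i / l_i -/

section expansion

theorem sum_range_expo_eq_zero {x : UnitAddCircle} (hx : x ≠ 0) {N : ℕ} (hN : N • x = 0) :
    ∑ n ∈ Finset.range N, expo (n • x) = 0 := by
  have h1 := four_mul_norm_le_norm_expo_sub_one x
  have hx' : 0 < ‖x‖ := norm_pos_iff.mpr hx
  have h2 : expo x - 1 ≠ 0 := by
    intro h0
    rw [h0, norm_zero] at h1
    linarith
  have h3 : (∑ n ∈ Finset.range N, expo (n • x)) * (expo x - 1) = 0 := by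
    simp_rw [expo_nsmul]
    rw [geom_sum_mul, ← expo_nsmul, hN, expo_zero, sub_self]
  exact (mul_eq_zero.mp h3).resolve_right h2

theorem nsmul_pi_eq_zero_iff {ι : Type*} {l : ι → ℕ} [∀ i, Fact (l i).Prime] {g : ℕ} (hg : ∀ i, ¬ l i ∣ g) {a : ∀ i, ZMod (l i)} :
    g • a = 0 ↔ a = 0 := by
  refine ⟨fun h => funext fun i => ?_, fun h => by simp [h]⟩
  have := congrFun h i
  rw [Pi.smul_apply, nsmul_eq_mul, Pi.zero_apply, mul_eq_zero, ZMod.natCast_eq_zero_iff] at this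
  exact this.resolve_left (hg i)

variable {ι : Type*} [Fintype ι] {l : ι → ℕ}

/-- The point `∑ a i / l i` of `ℝ / ℤ`. -/
noncomputable def freqPoint [∀ i, NeZero (l i)] (a : ∀ i, ZMod (l i)) : UnitAddCircle :=
  ∑ i, ZMod.toAddCircle (a i)

section
variable [∀ i, NeZero (l i)]

theorem freqPoint_zero : freqPoint (0 : ∀ i, ZMod (l i)) = 0 := by simp [freqPoint]

theorem freqPoint_sub (a b : ∀ i, ZMod (l i)) :
    freqPoint (a - b) = freqPoint a - freqPoint b := by
  simp [freqPoint, Finset.sum_sub_distrib]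

theorem freqPoint_nsmul (g : ℕ) (a : ∀ i, ZMod (l i)) :
    freqPoint (g • a) = g • freqPoint a := by
  rw [freqPoint, freqPoint, Finset.smul_sum]
  exact Finset.sum_congr rfl fun i _ => map_nsmul _ _ _

theorem prod_nsmul_freqPoint {T : Finset ι} {a : ∀ i, ZMod (l i)} (h : freqSupport a ⊆ T) :
    (∏ i ∈ T, l i) • freqPoint a = 0 := by
  rw [← freqPoint_nsmul]
  have : (∏ i ∈ T, l i) • a = 0 := by
    ext i
    by_cases hi : a i = 0
    · simp [hi]
    · have hd := Finset.dvd_prod_of_mem l (h (mem_freqSupport.mpr hi))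
      have hz : ((∏ i ∈ T, l i : ℕ) : ZMod (l i)) = 0 :=
        (ZMod.natCast_eq_zero_iff _ _).mpr hd
      rw [Pi.smul_apply, nsmul_eq_mul, hz, zero_mul, Pi.zero_apply]
  rw [this, freqPoint_zero]

end

section
variable [DecidableEq ι] [∀ i, Fact (l i).Prime]

/-- Multiplication by the product of all the other primes kills every summand except the i-th, and
that product is prime to l_i. -/
theorem freqPoint_eq_zero_iff (hl : Function.Injective l) {a : ∀ i, ZMod (l i)} :
    freqPoint a = 0 ↔ a = 0 := by
  refine ⟨fun h => ?_, fun h => by rw [h, freqPoint_zero]⟩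
  by_contra ha
  obtain ⟨i, hi⟩ : ∃ i, a i ≠ 0 := by
    by_contra! hc
    exact ha (funext hc)
  have hsm : (∏ j ∈ Finset.univ.erase i, l j) • freqPoint a = 0 := by rw [h, smul_zero]
  rw [freqPoint, Finset.smul_sum, ← Finset.add_sum_erase _ _ (Finset.mem_univ i),
    Finset.sum_eq_zero (s := Finset.univ.erase i), add_zero, ← map_nsmul,
    ZMod.toAddCircle_eq_zero, nsmul_eq_mul, mul_eq_zero, ZMod.natCast_eq_zero_iff] at hsm
  · have hd := hsm.resolve_right hi
    rw [(Fact.out : (l i).Prime).prime.dvd_finsetProd_iff] at hd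
    obtain ⟨j, hj, hd⟩ := hd
    have := (Nat.prime_dvd_prime_iff_eq Fact.out Fact.out).mp hd
    exact Finset.ne_of_mem_erase hj (hl this).symm
  · intro j hj
    have hz : ((∏ j ∈ Finset.univ.erase i, l j : ℕ) : ZMod (l j)) = 0 :=
      (ZMod.natCast_eq_zero_iff _ _).mpr (Finset.dvd_prod_of_mem l hj)
    rw [← map_nsmul, nsmul_eq_mul, hz, zero_mul, map_zero]

/-- Frequencies with support T give distinct non-zero torsion points of order dividing ∏ l_i over T,
and multiplication by g preserves this because g is prime to all l_i. -/
theorem sum_freqSupport_expSumBound_sq_le (hl : Function.Injective l) {g : ℕ}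
    (hg : ∀ i, ¬ l i ∣ g) {h : ℝ} (hh : 0 < h) {T : Finset ι} (hT : T.Nonempty) :
    ∑ a : ∀ i, ZMod (l i) with freqSupport a = T, expSumBound h (g • freqPoint a) ^ 2
      ≤ 4 * (∏ i ∈ T, (l i : ℝ)) * h := by
  have hinj : Function.Injective fun a : ∀ i, ZMod (l i) => g • freqPoint a := by
    intro a b hab
    simp only [← freqPoint_nsmul] at hab
    rw [← sub_eq_zero, ← freqPoint_sub, ← smul_sub, freqPoint_eq_zero_iff hl,
      nsmul_pi_eq_zero_iff hg, sub_eq_zero] at hab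
    exact hab
  rw [← Finset.sum_image (f := fun x => expSumBound h x ^ 2)
    (g := fun a : ∀ i, ZMod (l i) => g • freqPoint a) hinj.injOn]
  have := sum_expSumBound_sq_torsion_le (N := ∏ i ∈ T, l i)
    (Finset.prod_pos fun i _ => (Fact.out : (l i).Prime).pos) hh
    (Finset.image (fun a => g • freqPoint a) {a : ∀ i, ZMod (l i) | freqSupport a = T}) ?_
  · push_cast at this
    exact this
  · intro x hx
    obtain ⟨a, ha, rfl⟩ := Finset.mem_image.mp hx
    have ha : freqSupport a = T := by simpa using ha
    refine ⟨?_, ?_⟩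
    · rw [← freqPoint_nsmul, Ne, freqPoint_eq_zero_iff hl, nsmul_pi_eq_zero_iff hg]
      rintro rfl
      obtain ⟨i, hi⟩ := hT
      rw [← ha, mem_freqSupport] at hi
      exact hi rfl
    · rw [smul_comm, prod_nsmul_freqPoint ha.subset, smul_zero]

end

/-- `X` is the exponential sum with coefficients `b`. -/
def HasExpansion [DecidableEq ι] [∀ i, NeZero (l i)] (X : ℤ → ℝ) (b : (∀ i, ZMod (l i)) → ℂ) : Prop :=
  ∀ n : ℤ, (X n : ℂ) = ∑ a, b a * expo (n • freqPoint a)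

section
variable [DecidableEq ι] [∀ i, Fact (l i).Prime]

theorem sum_range_expo_freqPoint (hl : Function.Injective l) (a : ∀ i, ZMod (l i)) :
    ∑ n ∈ Finset.range (∏ i, l i), expo ((n : ℤ) • freqPoint a)
      = if a = 0 then ((∏ i, l i : ℕ) : ℂ) else 0 := by
  split_ifs with ha
  · subst ha
    simp [freqPoint_zero, expo_zero]
  · simp only [natCast_zsmul]
    exact sum_range_expo_eq_zero (by rwa [Ne, freqPoint_eq_zero_iff hl])
      (prod_nsmul_freqPoint (Finset.subset_univ _))

theorem HasExpansion.mean_eq (hl : Function.Injective l) {X : ℤ → ℝ}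
    {b : (∀ i, ZMod (l i)) → ℂ} (hX : HasExpansion X b) :
    ((mean (∏ i, l i) X : ℝ) : ℂ) = b 0 := by
  have hQ : ((∏ i, l i : ℕ) : ℂ) ≠ 0 := by
    exact_mod_cast (Finset.prod_pos fun i _ => (Fact.out : (l i).Prime).pos).ne'
  rw [mean, Complex.ofReal_div, Complex.ofReal_sum, Complex.ofReal_natCast, div_eq_iff hQ]
  simp_rw [fun n : ℕ => hX (n : ℤ)]
  rw [Finset.sum_comm]
  simp_rw [← Finset.mul_sum, sum_range_expo_freqPoint hl]
  simp

/-- Because Y is real its expansion may be conjugated. The product then has a correlation as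
coefficient, the form treated by `sum_sq_corr_le`. -/
theorem HasExpansion.mul {X Y : ℤ → ℝ} {b c : (∀ i, ZMod (l i)) → ℂ}
    (hX : HasExpansion X b) (hY : HasExpansion Y c) :
    HasExpansion (fun n => X n * Y n)
      (fun d => ∑ a, b a * (starRingEnd ℂ) (c (a - d))) := by
  intro n
  have hY' : (Y n : ℂ) = ∑ a, (starRingEnd ℂ) (c a) * expo (-(n • freqPoint a)) := by
    rw [← Complex.conj_ofReal (Y n), hY n, map_sum]
    simp [expo_neg]
  rw [Complex.ofReal_mul, hX n, hY', Finset.sum_mul_sum]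
  simp_rw [Finset.sum_mul]
  rw [Finset.sum_comm (γ := ∀ i, ZMod (l i)) (s := Finset.univ) (t := Finset.univ)
    (f := fun d a => b a * (starRingEnd ℂ) (c (a - d)) * expo (n • freqPoint d))]
  refine Finset.sum_congr rfl fun a _ => ?_
  rw [← Equiv.sum_comp (Equiv.subLeft a)
    (fun d => b a * (starRingEnd ℂ) (c (a - d)) * expo (n • freqPoint d))]
  refine Finset.sum_congr rfl fun d _ => ?_
  simp only [Equiv.subLeft_apply, sub_sub_cancel]
  rw [freqPoint_sub, smul_sub, sub_eq_add_neg, expo_add]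
  ring

theorem HasExpansion.mean_sq_eq (hl : Function.Injective l) {X : ℤ → ℝ}
    {b : (∀ i, ZMod (l i)) → ℂ} (hX : HasExpansion X b) :
    mean (∏ i, l i) (fun n => X n ^ 2) = ∑ a, ‖b a‖ ^ 2 := by
  have h := (hX.mul hX).mean_eq hl
  simp only [sub_zero, Complex.mul_conj'] at h
  rw [mean_congr (fun n => sq (X n))]
  exact_mod_cast h

theorem HasExpansion.sub_const {X : ℤ → ℝ} {b : (∀ i, ZMod (l i)) → ℂ} (hX : HasExpansion X b)
    {c : ℝ} (hc : b 0 = c) :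
    HasExpansion (fun n => X n - c) (fun a => if a = 0 then 0 else b a) := by
  intro n
  rw [Complex.ofReal_sub, hX n, ← hc, sub_eq_iff_eq_add,
    ← Finset.add_sum_erase _ _ (Finset.mem_univ (0 : ∀ i, ZMod (l i))),
    ← Finset.add_sum_erase (s := Finset.univ) _ (Finset.mem_univ (0 : ∀ i, ZMod (l i)))]
  simp only [if_true, zero_add, freqPoint_zero, smul_zero, expo_zero, mul_one]
  rw [add_comm]
  congr 1
  refine Finset.sum_congr rfl fun a ha => ?_
  rw [if_neg (Finset.ne_of_mem_erase ha)]

theorem HasExpansion.sum_comp_add {X : ℤ → ℝ} {b : (∀ i, ZMod (l i)) → ℂ}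
    (hX : HasExpansion X b) (R : Finset ℕ) (g : ℕ) :
    HasExpansion (fun n => ∑ t ∈ R, X (n + g * t))
      (fun a => b a * ∑ t ∈ R, expo (t • (g • freqPoint a))) := by
  intro n
  rw [Complex.ofReal_sum]
  simp_rw [fun t : ℕ => hX (n + g * t), Finset.mul_sum, Finset.sum_mul]
  rw [Finset.sum_comm]
  refine Finset.sum_congr rfl fun a _ => Finset.sum_congr rfl fun t _ => ?_
  rw [add_smul, expo_add, mul_assoc, mul_comm (expo (n • _))]
  congr 3
  rw [mul_comm, mul_smul]
  simp

theorem HasExpansion.const_mul {X : ℤ → ℝ} {b : (∀ i, ZMod (l i)) → ℂ}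
    (hX : HasExpansion X b) (c : ℝ) : HasExpansion (fun n => c * X n) (fun a => c * b a) := by
  intro n
  rw [Complex.ofReal_mul, hX n, Finset.mul_sum]
  exact Finset.sum_congr rfl fun _ _ => by ring

end
end expansion

/-! ### Fourier coefficients of the sieve and the variance -/

section siftExpansion

/-- The Fourier coefficients of the indicator function of the complement of `Ω`. -/
noncomputable def localCoeff {l : ℕ} [NeZero l] (Ω : Finset (ZMod l)) (c : ZMod l) : ℂ :=
  (l : ℂ)⁻¹ * ∑ y, (if y ∈ Ω then 0 else 1) * ZMod.stdAddChar (-(c * y))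

theorem expo_toAddCircle {l : ℕ} [NeZero l] (z : ZMod l) :
    expo (ZMod.toAddCircle z) = ZMod.stdAddChar z := rfl

theorem sum_localCoeff_mul {l : ℕ} [NeZero l] (Ω : Finset (ZMod l)) (x : ZMod l) :
    ∑ c, localCoeff Ω c * ZMod.stdAddChar (c * x) = if x ∈ Ω then 0 else 1 := by
  have hl : (l : ℂ) ≠ 0 := by exact_mod_cast NeZero.ne l
  simp_rw [localCoeff, mul_assoc, ← Finset.mul_sum, Finset.sum_mul]
  rw [Finset.sum_comm]
  have key : ∀ y : ZMod l, ∑ c, (if y ∈ Ω then (0 : ℂ) else 1) * ZMod.stdAddChar (-(c * y))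
      * ZMod.stdAddChar (c * x) = if y = x then (if x ∈ Ω then 0 else 1) * (l : ℂ) else 0 := by
    intro y
    simp_rw [mul_assoc, ← AddChar.map_add_eq_mul, ← Finset.mul_sum]
    have e : ∀ c : ZMod l, -(c * y) + c * x = c * (x - y) := fun c => by ring
    simp_rw [e, AddChar.sum_mulShift _ (ZMod.isPrimitive_stdAddChar l), ZMod.card, sub_eq_zero,
      eq_comm (a := x)]
    split_ifs with h1 h2 <;> simp_all
  simp_rw [key]
  rw [Finset.sum_ite_eq' Finset.univ x]
  simp only [Finset.mem_univ, if_true]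
  field_simp

theorem sum_not_mem {l : ℕ} [NeZero l] (Ω : Finset (ZMod l)) :
    ∑ y : ZMod l, (if y ∈ Ω then (0 : ℂ) else 1) = l - Ω.card := by
  have : ∀ y : ZMod l, (if y ∈ Ω then (0 : ℂ) else 1) = 1 - if y ∈ Ω then 1 else 0 := fun y => by
    split_ifs <;> simp
  simp_rw [this, Finset.sum_sub_distrib]
  simp [ZMod.card]

theorem localCoeff_zero {l : ℕ} [NeZero l] (Ω : Finset (ZMod l)) :
    localCoeff Ω 0 = ((1 - (Ω.card : ℝ) / l : ℝ) : ℂ) := by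
  have hl : (l : ℂ) ≠ 0 := by exact_mod_cast NeZero.ne l
  simp only [localCoeff, zero_mul, neg_zero, AddChar.map_zero_eq_one, mul_one]
  rw [sum_not_mem]
  push_cast
  field_simp

/-- Away from frequency 0 the constant 1 contributes nothing, so the coefficient is minus that of
the indicator of Ω, a sum of |Ω| unimodular terms divided by l. -/
theorem norm_localCoeff_le {l : ℕ} [NeZero l] (Ω : Finset (ZMod l)) {c : ZMod l} (hc : c ≠ 0) :
    ‖localCoeff Ω c‖ ≤ (Ω.card : ℝ) / l := by
  have h0 : ∑ y : ZMod l, (ZMod.stdAddChar (-(c * y)) : ℂ) = 0 := by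
    have e : ∀ y : ZMod l, -(c * y) = y * (-c) := fun y => by ring
    simp_rw [e, AddChar.sum_mulShift _ (ZMod.isPrimitive_stdAddChar l)]
    simp [hc]
  have h1 : ∑ y : ZMod l, (if y ∈ Ω then (0 : ℂ) else 1) * ZMod.stdAddChar (-(c * y))
      = -∑ y ∈ Ω, ZMod.stdAddChar (-(c * y)) := by
    have : ∀ y : ZMod l, (if y ∈ Ω then (0 : ℂ) else 1) * ZMod.stdAddChar (-(c * y))
        = ZMod.stdAddChar (-(c * y)) - if y ∈ Ω then ZMod.stdAddChar (-(c * y)) else 0 := fun y => by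
      split_ifs <;> simp
    simp_rw [this, Finset.sum_sub_distrib, h0]
    simp
  rw [localCoeff, h1, norm_mul, norm_neg, norm_inv, Complex.norm_natCast, div_eq_inv_mul]
  gcongr
  refine (norm_sum_le _ _).trans ?_
  simp only [← expo_toAddCircle, norm_expo]
  simp

set_option linter.unusedSectionVars false

variable {ι : Type*} [Fintype ι] [DecidableEq ι] {l : ι → ℕ} [∀ i, Fact (l i).Prime]
  {Ω : (p : ℕ) → Finset (ZMod p)} {s : ℕ}

/-- The Fourier coefficients of the sieve indicator. -/
noncomputable def siftCoeff (Ω : (p : ℕ) → Finset (ZMod p)) (a : ∀ i, ZMod (l i)) : ℂ :=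
  ∏ i, localCoeff (Ω (l i)) (a i)

theorem hasExpansion_sift (hl : Function.Injective l) :
    HasExpansion (l := l) (sift (Finset.univ.image l) Ω) (siftCoeff Ω) := by
  intro n
  rw [sift, Finset.prod_image hl.injOn, Complex.ofReal_prod]
  have : ∀ i, (((if (n : ZMod (l i)) ∈ Ω (l i) then 0 else 1 : ℝ)) : ℂ)
      = ∑ c : ZMod (l i), localCoeff (Ω (l i)) c * expo (n • ZMod.toAddCircle c) := fun i => by
    rw [apply_ite (fun x : ℝ => (x : ℂ)), Complex.ofReal_zero, Complex.ofReal_one,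
      ← sum_localCoeff_mul]
    refine Finset.sum_congr rfl fun c _ => ?_
    rw [← map_zsmul, expo_toAddCircle, zsmul_eq_mul, mul_comm c]
  simp_rw [this]
  rw [Finset.prod_univ_sum, Fintype.piFinset_univ]
  refine Finset.sum_congr rfl fun a _ => ?_
  rw [Finset.prod_mul_distrib, siftCoeff, freqPoint, Finset.smul_sum, expo_sum]

theorem siftCoeff_zero (hl : Function.Injective l) :
    siftCoeff (l := l) Ω 0 = (siftDensity (Finset.univ.image l) Ω : ℂ) := by
  rw [siftCoeff, siftDensity, Finset.prod_image hl.injOn, Complex.ofReal_prod]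
  exact Finset.prod_congr rfl fun i _ => localCoeff_zero _

theorem norm_siftCoeff_le (a : ∀ i, ZMod (l i)) :
    ‖siftCoeff Ω a‖ ≤ (∏ i ∈ freqSupport a, ((Ω (l i)).card : ℝ) / l i)
      * ∏ i ∈ (freqSupport a)ᶜ, (1 - ((Ω (l i)).card : ℝ) / l i) := by
  rw [siftCoeff, norm_prod, ← Finset.prod_mul_prod_compl (freqSupport a)]
  refine mul_le_mul ?_ ?_ (Finset.prod_nonneg fun _ _ => norm_nonneg _)
    (Finset.prod_nonneg fun _ _ => by positivity)
  · exact Finset.prod_le_prod (fun _ _ => norm_nonneg _) fun i hi =>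
      norm_localCoeff_le _ (mem_freqSupport.mp hi)
  · refine Finset.prod_le_prod (fun _ _ => norm_nonneg _) fun i hi => ?_
    have : a i = 0 := by simpa [mem_freqSupport] using hi
    rw [this, localCoeff_zero, Complex.norm_real, Real.norm_of_nonneg]
    exact sub_nonneg.mpr (card_div_le_one (Fact.out : (l i).Prime).pos)

/-- The Fourier coefficients of the centred count. -/
noncomputable def devCoeff (Ω : (p : ℕ) → Finset (ZMod p)) (g h : ℕ) (a : ∀ i, ZMod (l i)) : ℂ :=
  if a = 0 then 0 else siftCoeff Ω a * ∑ t ∈ Finset.Icc 1 h, expo (t • (g • freqPoint a))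

theorem hasExpansion_siftDev (hl : Function.Injective l) (g h : ℕ) :
    HasExpansion (l := l) (siftDev (Finset.univ.image l) Ω g h) (devCoeff Ω g h) := by
  refine ((hasExpansion_sift (Ω := Ω) hl).sum_comp_add (Finset.Icc 1 h) g).sub_const ?_
  rw [siftCoeff_zero hl]
  simp [freqPoint_zero, expo_zero, mul_comm]

theorem norm_devCoeff_le (hl : Function.Injective l) {g h : ℕ} (hg : ∀ i, ¬ l i ∣ g)
    {a : ∀ i, ZMod (l i)} (ha : a ≠ 0) :
    ‖devCoeff Ω g h a‖ ≤ ((∏ i ∈ freqSupport a, ((Ω (l i)).card : ℝ) / l i)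
      * ∏ i ∈ (freqSupport a)ᶜ, (1 - ((Ω (l i)).card : ℝ) / l i))
        * expSumBound h (g • freqPoint a) := by
  rw [devCoeff, if_neg ha, norm_mul]
  refine mul_le_mul (norm_siftCoeff_le a) ?_ (norm_nonneg _) ?_
  · have hx : g • freqPoint a ≠ 0 := by
      rwa [← freqPoint_nsmul, Ne, freqPoint_eq_zero_iff hl, nsmul_pi_eq_zero_iff hg]
    have := norm_sum_expo_le hx h 1
    rwa [show Finset.Ico 1 (1 + h) = Finset.Icc 1 h by ext; simp; omega] at this
  · exact mul_nonneg (Finset.prod_nonneg fun _ _ => by positivity) (Finset.prod_nonneg fun i _ =>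
      sub_nonneg.mpr (card_div_le_one (Fact.out : (l i).Prime).pos))

theorem freqSupport_eq_empty {a : ∀ i, ZMod (l i)} : freqSupport a = ∅ ↔ a = 0 := by
  rw [Finset.eq_empty_iff_forall_notMem, funext_iff]
  simp [mem_freqSupport]

theorem sum_eq_sum_freqSupport (f : (∀ i, ZMod (l i)) → ℝ) :
    ∑ a, f a = ∑ T : Finset ι, ∑ a with freqSupport a = T, f a :=
  (Finset.sum_fiberwise _ _ _).symm

/-- The Euler product that governs the variance. -/
noncomputable def varFactor (S : Finset ℕ) (Ω : (p : ℕ) → Finset (ZMod p)) : ℝ :=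
  ∏ p ∈ S, (((Ω p).card : ℝ) ^ 2 / p + (1 - ((Ω p).card : ℝ) / p) ^ 2)

theorem prod_sq_div_eq (T : Finset ι) (ν : ι → ℝ) :
    ∏ i ∈ T, ν i ^ 2 / l i = (∏ i ∈ T, (ν i / l i) ^ 2) * ∏ i ∈ T, (l i : ℝ) := by
  rw [← Finset.prod_mul_distrib]
  refine Finset.prod_congr rfl fun i _ => ?_
  have : (l i : ℝ) ≠ 0 := by exact_mod_cast (Fact.out : (l i).Prime).ne_zero
  field_simp

/-- Parseval, with the frequencies grouped by support T. A group has squared coefficients at most w²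
times the squared majorant of a geometric sum, and `sum_freqSupport_expSumBound_sq_le` adds these
up. -/
theorem mean_siftDev_sq_le_of_image (hl : Function.Injective l) {g h : ℕ} (hg : ∀ i, ¬ l i ∣ g) :
    mean (∏ i, l i) (fun n => siftDev (Finset.univ.image l) Ω g h n ^ 2)
      ≤ 4 * h * varFactor (Finset.univ.image l) Ω := by
  rcases Nat.eq_zero_or_pos h with rfl | hh
  · simp [siftDev_zero, mean]
  have hh' : (0 : ℝ) < h := by exact_mod_cast hh
  rw [(hasExpansion_siftDev hl g h).mean_sq_eq hl, sum_eq_sum_freqSupport, varFactor,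
    Finset.prod_image hl.injOn]
  -- Expanding `varFactor` as a sum over subsets T matches it term by term with the grouping by
  -- support.
  rw [Finset.prod_add, Finset.powerset_univ, Finset.mul_sum]
  refine Finset.sum_le_sum fun T _ => ?_
  rcases T.eq_empty_or_nonempty with rfl | hT
  · refine (Finset.sum_nonpos fun a ha => ?_).trans ?_
    · have : a = 0 := by simpa [freqSupport_eq_empty] using ha
      simp [devCoeff, this]
    · have : 0 ≤ ∏ i, (1 - ((Ω (l i)).card : ℝ) / l i) ^ 2 :=
        Finset.prod_nonneg fun _ _ => sq_nonneg _
      simp only [Finset.prod_empty, Finset.sdiff_empty, one_mul]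
      positivity
  · set w := (∏ i ∈ T, ((Ω (l i)).card : ℝ) / l i)
      * ∏ i ∈ Tᶜ, (1 - ((Ω (l i)).card : ℝ) / l i) with hw
    calc _ ≤ ∑ a : ∀ i, ZMod (l i) with freqSupport a = T,
          w ^ 2 * expSumBound h (g • freqPoint a) ^ 2 := by
          refine Finset.sum_le_sum fun a ha => ?_
          have haT : freqSupport a = T := (Finset.mem_filter.mp ha).2
          have ha0 : a ≠ 0 := by
            rintro rfl
            rw [freqSupport_eq_empty.mpr rfl] at haT
            exact hT.ne_empty haT.symm
          have := norm_devCoeff_le (Ω := Ω) (h := h) hl hg ha0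
          rw [haT] at this
          rw [← mul_pow]
          exact pow_le_pow_left₀ (norm_nonneg _) this 2
      _ ≤ w ^ 2 * (4 * (∏ i ∈ T, (l i : ℝ)) * h) := by
          rw [← Finset.mul_sum]
          exact mul_le_mul_of_nonneg_left
            (sum_freqSupport_expSumBound_sq_le hl hg hh' hT) (sq_nonneg _)
      _ = _ := by
          rw [hw, mul_pow, ← Finset.prod_pow, ← Finset.prod_pow, Finset.compl_eq_univ_sdiff]
          rw [prod_sq_div_eq]
          ring

theorem exists_enumeration {S : Finset ℕ} (hS : ∀ p ∈ S, p.Prime) :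
    ∃ (n : ℕ) (l : Fin n → ℕ), (∀ i, Fact (l i).Prime) ∧ Function.Injective l ∧
      Finset.univ.image l = S := by
  refine ⟨S.card, S.orderEmbOfFin rfl, fun i => ⟨hS _ (S.orderEmbOfFin_mem rfl i)⟩,
    (S.orderEmbOfFin rfl).injective, ?_⟩
  ext p
  simp

theorem mean_siftDev_sq_le {S : Finset ℕ} (hS : ∀ p ∈ S, p.Prime) {g : ℕ}
    (hg : ∀ p ∈ S, ¬ p ∣ g) (h : ℕ) :
    mean (∏ p ∈ S, p) (fun n => siftDev S Ω g h n ^ 2) ≤ 4 * h * varFactor S Ω := by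
  obtain ⟨n, l, hp, hl, rfl⟩ := exists_enumeration hS
  rw [Finset.prod_image hl.injOn]
  exact mean_siftDev_sq_le_of_image hl fun i => hg _ (Finset.mem_image_of_mem l (Finset.mem_univ i))

end siftExpansion

/-! ### Few primes p give a small p-th part of a torsion point -/

section roots

theorem card_primes_dvd_le {m : ℕ} (hm : m ≠ 0) {R : Finset ℕ} (hR : ∀ p ∈ R, p.Prime ∧ p ∣ m) :
    (R.card : ℝ) ≤ 2 * Real.log m := by
  have h1 : 2 ^ R.card ≤ m := by
    refine le_trans ?_ (Nat.le_of_dvd (Nat.pos_of_ne_zero hm) (Finset.prod_primes_dvd m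
      (fun p hp => (hR p hp).1.prime) fun p hp => (hR p hp).2))
    exact Finset.pow_card_le_prod _ _ _ fun p hp => (hR p hp).1.two_le
  have h2 : (R.card : ℝ) * Real.log 2 ≤ Real.log m := by
    rw [← Real.log_pow]
    exact Real.log_le_log (by positivity) (by exact_mod_cast h1)
  have h3 := Real.log_two_gt_d9
  have h4 : (0 : ℝ) ≤ R.card := Nat.cast_nonneg _
  nlinarith

/-- With x = c/N and θ a representative of y p, both b = Nθ and i = pθ - c/N are integers, so p
divides c + N i. There are only 2I + 1 possible i, the numbers c + N i are non-zero since 0 < c < N,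
and each has O(log) prime factors. -/
theorem card_small_roots_le {N : ℕ} (hN : 0 < N) {x : UnitAddCircle} (hx0 : x ≠ 0)
    (hx : N • x = 0) {y : ℕ → UnitAddCircle} {R : Finset ℕ} {I : ℕ}
    (hR : ∀ p ∈ R, p.Prime ∧ p • y p = x ∧ N • y p = 0 ∧ p * ‖y p‖ ≤ I) :
    (R.card : ℝ) ≤ (2 * I + 1) * (2 * Real.log (N * (I + 1))) := by
  have hNR : (0 : ℝ) < N := by exact_mod_cast hN
  obtain ⟨c, hc0, hcN, hxc⟩ := exists_eq_coe_div_of_nsmul_eq_zero hN hx0 hx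
  set v : ℤ → ℕ := fun i => ((c : ℤ) + N * i).natAbs with hv
  have hv0 : ∀ i, v i ≠ 0 := by
    intro i hi
    have h1 : (c : ℤ) + N * i = 0 := Int.natAbs_eq_zero.mp hi
    have h2 : (N : ℤ) ∣ c := ⟨-i, by linarith⟩
    exact absurd (Nat.le_of_dvd hc0 (Int.natCast_dvd_natCast.mp h2)) (by omega)
  have hvle : ∀ i ∈ Finset.Icc (-(I : ℤ)) I, (v i : ℝ) ≤ N * (I + 1) := by
    intro i hi
    rw [Finset.mem_Icc] at hi
    have h1 : |((c : ℤ) + N * i)| ≤ N * (I + 1) := by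
      have h2 : |i| ≤ I := abs_le.mpr hi
      calc |((c : ℤ) + N * i)| ≤ |(c : ℤ)| + |(N : ℤ) * i| := abs_add_le _ _
        _ = c + N * |i| := by rw [abs_mul, Nat.abs_cast, Nat.abs_cast]
        _ ≤ N + N * I := by gcongr
        _ = _ := by ring
    have h3 : ((v i : ℕ) : ℤ) ≤ N * (I + 1) := by rw [hv, Int.natCast_natAbs]; exact h1
    exact_mod_cast h3
  have hsub : R ⊆ (Finset.Icc (-(I : ℤ)) I).biUnion fun i => R.filter (· ∣ v i) := by
    intro p hp
    obtain ⟨-, hpx, hpN, hpI⟩ := hR p hp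
    obtain ⟨θ, hθ, hn, -⟩ := exists_coe_eq_norm (y p)
    rw [hθ, ← AddCircle.coe_nsmul, AddCircle.coe_eq_zero_iff] at hpN
    obtain ⟨b, hb⟩ := hpN
    rw [hθ, hxc, ← AddCircle.coe_nsmul, ← sub_eq_zero, ← AddCircle.coe_sub,
      AddCircle.coe_eq_zero_iff] at hpx
    obtain ⟨i, hi⟩ := hpx
    simp only [zsmul_eq_mul, mul_one, nsmul_eq_mul] at hb hi
    have hpb : (p : ℤ) * b = c + N * i := by
      have : (p : ℝ) * b = c + N * i := by
        rw [hb, hi]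
        field_simp
        ring
      exact_mod_cast this
    -- Strict inequality |i| < I + 1 comes from c/N < 1, and integrality gives |i| ≤ I.
    have hiI : |i| ≤ I := by
      have h1 : |(i : ℝ)| < I + 1 := by
        rw [hi]
        have hcN' : (c : ℝ) / N < 1 := by
          rw [div_lt_one hNR]; exact_mod_cast hcN
        have hc' : 0 ≤ (c : ℝ) / N := by positivity
        calc |(p : ℝ) * θ - c / N| ≤ |(p : ℝ) * θ| + |(c : ℝ) / N| := abs_sub _ _
          _ = p * ‖y p‖ + c / N := by rw [abs_mul, Nat.abs_cast, hn, abs_of_nonneg hc']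
          _ < I + 1 := by linarith
      have h2 : |i| < I + 1 := by exact_mod_cast h1
      omega
    refine Finset.mem_biUnion.mpr ⟨i, Finset.mem_Icc.mpr (abs_le.mp hiI), ?_⟩
    refine Finset.mem_filter.mpr ⟨hp, ?_⟩
    have : (p : ℤ) ∣ c + N * i := ⟨b, hpb.symm⟩
    exact Int.natCast_dvd.mp this
  have hcard : (R.card : ℝ) ≤ ∑ i ∈ Finset.Icc (-(I : ℤ)) I, ((R.filter (· ∣ v i)).card : ℝ) := by
    exact_mod_cast (Finset.card_le_card hsub).trans Finset.card_biUnion_le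
  refine hcard.trans ((Finset.sum_le_sum fun i hi => ?_).trans_eq
    (b := ∑ i ∈ Finset.Icc (-(I : ℤ)) I, 2 * Real.log (N * (I + 1))) ?_)
  · refine (card_primes_dvd_le (hv0 i) fun p hp => ?_).trans ?_
    · rw [Finset.mem_filter] at hp
      exact ⟨(hR p hp.1).1, hp.2⟩
    · have := Real.log_le_log (by exact_mod_cast Nat.pos_of_ne_zero (hv0 i)) (hvle i hi)
      linarith
  · rw [Finset.sum_const, Int.card_Icc, nsmul_eq_mul]
    congr 1
    have : ((I : ℤ) + 1 - -(I : ℤ)).toNat = 2 * I + 1 := by omega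
    rw [this]
    push_cast
    ring

/-- The point `x` has few small `p`-th parts when `p` runs over the primes in a short range. -/
theorem sum_sq_kernel_le {N : ℕ} (hN : 0 < N) {x : UnitAddCircle} (hx0 : x ≠ 0)
    (hx : N • x = 0) {y : ℕ → UnitAddCircle} {R : Finset ℕ} {j : ℕ}
    (hR : ∀ p ∈ R, p.Prime ∧ p • y p = x ∧ N • y p = 0 ∧ 16 ^ j ≤ p ∧ p < 16 ^ (j + 1)) :
    ∑ p ∈ R, (expSumBound p (y p) / p) ^ 2 ≤ 1200 * 4 ^ j * (1 + Real.log N) := by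
  classical
  have hlogN : 0 ≤ Real.log N := Real.log_natCast_nonneg N
  have hp0 : ∀ p ∈ R, (0 : ℝ) < p := fun p hp => by exact_mod_cast (hR p hp).1.pos
  -- The threshold 16 · 2^j balances the two parts: about 4^j log N bad primes contribute at most 1
  -- each, and at most 16^(j+1) good primes contribute O(4^(-j)) each.
  set bad := R.filter fun p : ℕ => (p : ℝ) * ‖y p‖ ≤ (16 * 2 ^ j : ℕ) with hbad
  set good := R.filter fun p : ℕ => ¬ (p : ℝ) * ‖y p‖ ≤ (16 * 2 ^ j : ℕ) with hgood
  have h2j : (1 : ℝ) ≤ 2 ^ j := one_le_pow₀ (by norm_num)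
  have e4 : (4 : ℝ) ^ j = 2 ^ j * 2 ^ j := by rw [← mul_pow]; norm_num
  have hb : (bad.card : ℝ) ≤ 1150 * 4 ^ j * (1 + Real.log N) := by
    have h1 := card_small_roots_le (I := 16 * 2 ^ j) hN hx0 hx (R := bad) (y := y) fun p hp => by
      rw [hbad, Finset.mem_filter] at hp
      exact ⟨(hR p hp.1).1, (hR p hp.1).2.1, (hR p hp.1).2.2.1, hp.2⟩
    have hNR : (0 : ℝ) < N := by exact_mod_cast hN
    push_cast at h1
    rw [Real.log_mul hNR.ne' (by positivity)] at h1
    have h2 : Real.log (16 * 2 ^ j + 1) ≤ 16 * 2 ^ j := by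
      have := Real.log_le_sub_one_of_pos (show (0 : ℝ) < 16 * 2 ^ j + 1 by positivity)
      linarith
    refine h1.trans ?_
    calc (2 * (16 * 2 ^ j) + 1) * (2 * (Real.log N + Real.log (16 * 2 ^ j + 1)))
        ≤ (2 * (16 * 2 ^ j) + 2 ^ j) * (2 * (Real.log N * 2 ^ j + 16 * 2 ^ j)) := by
          have h3 : 0 ≤ Real.log (16 * 2 ^ j + 1) := Real.log_nonneg (by linarith)
          gcongr
          exact le_mul_of_one_le_right hlogN h2j
      _ = 66 * 4 ^ j * Real.log N + 1056 * 4 ^ j := by rw [e4]; ring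
      _ ≤ 1150 * 4 ^ j * Real.log N + 1150 * 4 ^ j := by gcongr <;> norm_num
      _ = _ := by ring
  have hB : ∑ p ∈ bad, (expSumBound p (y p) / p) ^ 2 ≤ bad.card := by
    refine (Finset.sum_le_sum (g := fun _ => (1 : ℝ)) fun p hp => ?_).trans (by simp)
    have hp := hp0 p (Finset.filter_subset _ _ hp)
    refine pow_le_one₀ (div_nonneg (expSumBound_nonneg hp.le _) hp.le) ?_
    rw [div_le_one hp]
    exact min_le_left _ _
  have hG : ∑ p ∈ good, (expSumBound p (y p) / p) ^ 2 ≤ 50 * 4 ^ j := by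
    have h1 : ∀ p ∈ good, (expSumBound p (y p) / p) ^ 2 ≤ 1 / (1024 * 4 ^ j) := fun p hp => by
      rw [hgood, Finset.mem_filter] at hp
      have hpp := hp0 p hp.1
      have hlt := not_le.mp hp.2
      push_cast at hlt
      have hy : 0 < ‖y p‖ := by
        by_contra hc
        have : (p : ℝ) * ‖y p‖ ≤ 0 := mul_nonpos_of_nonneg_of_nonpos hpp.le (not_lt.mp hc)
        have : (0 : ℝ) < 16 * 2 ^ j := by positivity
        linarith
      have h2 : expSumBound p (y p) / p ≤ 1 / (32 * 2 ^ j) := by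
        calc expSumBound p (y p) / p ≤ 1 / (2 * ‖y p‖) / p := by
              gcongr
              exact min_le_right _ _
          _ = 1 / (2 * (p * ‖y p‖)) := by field_simp
          _ ≤ 1 / (2 * (16 * 2 ^ j)) := by gcongr
          _ = _ := by ring
      refine (pow_le_pow_left₀ (div_nonneg (expSumBound_nonneg hpp.le _) hpp.le) h2 2).trans_eq ?_
      rw [e4, div_pow, one_pow]
      ring
    have h2 : (good.card : ℝ) ≤ 16 ^ (j + 1) := by
      have : good ⊆ Finset.range (16 ^ (j + 1)) := fun p hp => by
        rw [hgood, Finset.mem_filter] at hp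
        exact Finset.mem_range.mpr (hR p hp.1).2.2.2.2
      have := Finset.card_le_card this
      rw [Finset.card_range] at this
      exact_mod_cast this
    refine (Finset.sum_le_sum h1).trans ?_
    rw [Finset.sum_const, nsmul_eq_mul]
    calc (good.card : ℝ) * (1 / (1024 * 4 ^ j)) ≤ 16 ^ (j + 1) * (1 / (1024 * 4 ^ j)) := by gcongr
      _ = (1 / 64) * 4 ^ j := by
          rw [pow_succ, show (16 : ℝ) ^ j = 4 ^ j * 4 ^ j by rw [← mul_pow]; norm_num]
          field_simp
          norm_num
      _ ≤ _ := by gcongr; norm_num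
  rw [← Finset.sum_filter_add_sum_filter_not R fun p : ℕ => (p : ℝ) * ‖y p‖ ≤ (16 * 2 ^ j : ℕ)]
  have : (50 : ℝ) * 4 ^ j ≤ 50 * 4 ^ j * (1 + Real.log N) :=
    le_mul_of_one_le_right (by positivity) (by linarith)
  linarith

end roots

/-! ### A majorant for the Fourier coefficients -/

section concentration

variable {ι : Type*} [Fintype ι] {l : ι → ℕ} {Ω : (p : ℕ) → Finset (ZMod p)} {s : ℕ}

/-- A majorant for the Fourier coefficients of the centred count. -/
noncomputable def majorant [DecidableEq ι] [∀ i, NeZero (l i)] (s : ℕ) (H : ℝ)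
    (a : ∀ i, ZMod (l i)) : ℝ :=
  if a = 0 then 0 else (∏ i ∈ freqSupport a, (s : ℝ) / l i) * expSumBound H (freqPoint a)

theorem majorant_nonneg [DecidableEq ι] [∀ i, NeZero (l i)] {H : ℝ} (hH : 0 ≤ H)
    (a : ∀ i, ZMod (l i)) : 0 ≤ majorant s H a := by
  rw [majorant]
  split_ifs
  · exact le_rfl
  · exact mul_nonneg (Finset.prod_nonneg fun _ _ => by positivity) (expSumBound_nonneg hH _)

theorem freqSupport_nsmul [∀ i, Fact (l i).Prime] {g : ℕ} (hg : ∀ i, ¬ l i ∣ g)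
    (a : ∀ i, ZMod (l i)) : freqSupport (g • a) = freqSupport a := by
  ext i
  rw [mem_freqSupport, mem_freqSupport, Pi.smul_apply, nsmul_eq_mul, Ne, mul_eq_zero,
    ZMod.natCast_eq_zero_iff]
  simp [hg i]

variable [DecidableEq ι] [∀ i, Fact (l i).Prime]

theorem norm_devCoeff_le_majorant (hl : Function.Injective l) {g h : ℕ} (hg : ∀ i, ¬ l i ∣ g)
    (hΩ : ∀ i, (Ω (l i)).card ≤ s) {H : ℝ} (hH : (h : ℝ) ≤ H) (a : ∀ i, ZMod (l i)) :
    ‖devCoeff Ω g h a‖ ≤ majorant s H (g • a) := by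
  by_cases ha : a = 0
  · simp [devCoeff, majorant, ha]
  rw [majorant, if_neg (by rwa [nsmul_pi_eq_zero_iff hg]), freqSupport_nsmul hg, freqPoint_nsmul]
  refine (norm_devCoeff_le hl hg ha).trans ?_
  have hθ : ∀ i, 0 ≤ 1 - ((Ω (l i)).card : ℝ) / l i := fun i =>
    sub_nonneg.mpr (card_div_le_one (Fact.out : (l i).Prime).pos)
  refine mul_le_mul ?_ (expSumBound_mono hH _) (expSumBound_nonneg (Nat.cast_nonneg _) _)
    (Finset.prod_nonneg fun _ _ => by positivity)
  calc _ ≤ (∏ i ∈ freqSupport a, (s : ℝ) / l i) * 1 := by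
        refine mul_le_mul ?_ (Finset.prod_le_one (fun i _ => hθ i) fun i _ =>
          sub_le_self _ (by positivity)) (Finset.prod_nonneg fun i _ => hθ i)
          (Finset.prod_nonneg fun _ _ => by positivity)
        refine Finset.prod_le_prod (fun _ _ => by positivity) fun i _ => ?_
        gcongr
        exact hΩ i
    _ = _ := mul_one _

/-- The support of d lies in the union of the supports of a and a - d, so 2^|supp d| can be
distributed over the two majorants at the price of doubling s. This later absorbs a factor |supp d|.
-/
theorem two_pow_mul_majorant_le {H : ℝ} (hH : 0 ≤ H) (a d : ∀ i, ZMod (l i)) :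
    2 ^ (freqSupport d).card * (majorant s H a * majorant s H (a - d))
      ≤ majorant (2 * s) H a * majorant (2 * s) H (a - d) := by
  have key : ∀ a : ∀ i, ZMod (l i), majorant (2 * s) H a
      = 2 ^ (freqSupport a).card * majorant s H a := fun a => by
    unfold majorant
    split_ifs
    · simp
    · rw [← mul_assoc, ← Finset.prod_const, ← Finset.prod_mul_distrib]
      congr 1
      refine Finset.prod_congr rfl fun i _ => ?_
      push_cast
      ring
  have hsub : freqSupport d ⊆ freqSupport a ∪ freqSupport (a - d) := fun i hi => by
    rw [Finset.mem_union, mem_freqSupport, mem_freqSupport]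
    rw [mem_freqSupport] at hi
    by_contra! hc
    refine hi ?_
    have := hc.2
    rw [Pi.sub_apply, hc.1, zero_sub, neg_eq_zero] at this
    exact this
  have hcard : (freqSupport d).card ≤ (freqSupport a).card + (freqSupport (a - d)).card :=
    (Finset.card_le_card hsub).trans (Finset.card_union_le _ _)
  rw [key a, key (a - d)]
  calc _ ≤ 2 ^ ((freqSupport a).card + (freqSupport (a - d)).card)
        * (majorant s H a * majorant s H (a - d)) := by
        have := majorant_nonneg (s := s) hH a
        have := majorant_nonneg (s := s) hH (a - d)
        gcongr
        norm_num
    _ = _ := by rw [pow_add]; ring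

theorem sum_freqSupport_majorant_sq_le (hl : Function.Injective l) {H : ℝ} (hH : 0 < H)
    (T : Finset ι) :
    ∑ a : ∀ i, ZMod (l i) with freqSupport a = T, majorant s H a ^ 2
      ≤ 4 * H * ∏ i ∈ T, (s : ℝ) ^ 2 / l i := by
  rcases T.eq_empty_or_nonempty with rfl | hT
  · refine (Finset.sum_nonpos fun a ha => ?_).trans (by positivity)
    have : a = 0 := freqSupport_eq_empty.mp (Finset.mem_filter.mp ha).2
    simp [majorant, this]
  · calc _ ≤ ∑ a : ∀ i, ZMod (l i) with freqSupport a = T,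
          (∏ i ∈ T, (s : ℝ) / l i) ^ 2 * expSumBound H (1 • freqPoint a) ^ 2 := by
          refine Finset.sum_le_sum fun a ha => ?_
          rw [one_smul, majorant, (Finset.mem_filter.mp ha).2]
          split_ifs
          · rw [zero_pow two_ne_zero]
            positivity
          · rw [mul_pow]
      _ ≤ (∏ i ∈ T, (s : ℝ) / l i) ^ 2 * (4 * (∏ i ∈ T, (l i : ℝ)) * H) := by
          rw [← Finset.mul_sum]
          refine mul_le_mul_of_nonneg_left (sum_freqSupport_expSumBound_sq_le hl (fun i => ?_) hH hT)
            (sq_nonneg _)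
          exact (Fact.out : (l i).Prime).one_lt.ne' ∘ Nat.dvd_one.mp
      _ = _ := by
          rw [prod_sq_div_eq, Finset.prod_pow]
          ring

end concentration

/-! ### Concentration of the shifted averages for most primes -/

section greedy

variable {n : ℕ} {l : Fin n → ℕ} [∀ i, Fact (l i).Prime]
  {Ω : (p : ℕ) → Finset (ZMod p)} {s : ℕ}

/-- `sum_sq_corr_le` with κ_i = s²/l_i. The local factor is 1 + (8s² + s⁴/l + 3s⁴)/l, hence the
constant 12. -/
theorem sum_sq_corr_majorant_le (hl : Function.Injective l) (hs : 1 ≤ s) {H : ℝ} (hH : 0 < H) :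
    ∑ d : ∀ i, ZMod (l i), (∑ a, majorant s H a * majorant s H (a - d)) ^ 2
      ≤ (∏ i, (1 + 12 * (s : ℝ) ^ 4 / l i)) * (16 * H ^ 2) := by
  have hs' : (1 : ℝ) ≤ s := by exact_mod_cast hs
  have hl1 : ∀ i, (1 : ℝ) ≤ l i := fun i => by exact_mod_cast (Fact.out : (l i).Prime).one_lt.le
  have h := sum_sq_corr_le n l (fun i => (s : ℝ) ^ 2 / l i)
    (fun i => div_pos (by positivity) (by linarith [hl1 i])) (majorant s H) (majorant s H)
    (majorant_nonneg hH.le) (majorant_nonneg hH.le) (4 * H) (4 * H) (by positivity) (by positivity)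
    (sum_freqSupport_majorant_sq_le hl hH) (sum_freqSupport_majorant_sq_le hl hH)
  refine h.trans ?_
  rw [show 4 * H * (4 * H) = 16 * H ^ 2 by ring]
  refine mul_le_mul_of_nonneg_right (Finset.prod_le_prod (fun i _ => by positivity) fun i _ => ?_)
    (by positivity)
  have hli := hl1 i
  have e : (1 + (s : ℝ) ^ 2 / l i) ^ 2 + 6 * ((s : ℝ) ^ 2 / l i) + 3 * l i * ((s : ℝ) ^ 2 / l i) ^ 2
      = 1 + (8 * s ^ 2 + s ^ 4 / l i + 3 * s ^ 4) / l i := by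
    field_simp
    ring
  rw [e]
  gcongr
  have h1 : (s : ℝ) ^ 4 / l i ≤ s ^ 4 := div_le_self (by positivity) hli
  have h2 : (s : ℝ) ^ 2 ≤ s ^ 4 := pow_le_pow_right₀ hs' (by norm_num)
  linarith

/-- The average of the squared deviation along progressions modulo `p` over `p` consecutive
starting points. -/
noncomputable def shiftAvg (S : Finset ℕ) (Ω : (p : ℕ) → Finset (ZMod p)) (p T : ℕ) (n : ℤ) : ℝ :=
  (1 / p : ℝ) * ∑ r ∈ Finset.range p, siftDev S Ω p T (n + r) ^ 2

/-- Parseval for the average over p consecutive starting points: the coefficient at d is 1/p times a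
correlation of deviation coefficients times a geometric sum of length p. For the difference p the
coefficients are majorised at p • a, so the correlation is bounded at p • d. The bound uses `H` in
place of T, to allow one majorant for all p. -/
theorem mean_shiftAvg_sub_sq_le (hl : Function.Injective l) {p T : ℕ} (hp : 0 < p)
    (hpl : ∀ i, ¬ l i ∣ p) (hΩ : ∀ i, (Ω (l i)).card ≤ s) {H : ℝ} (hT : (T : ℝ) ≤ H) :
    mean (∏ i, l i) (fun m => (shiftAvg (Finset.univ.image l) Ω p T m
        - mean (∏ i, l i) (shiftAvg (Finset.univ.image l) Ω p T)) ^ 2)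
      ≤ ∑ d : ∀ i, ZMod (l i), (∑ a, majorant s H a * majorant s H (a - p • d)) ^ 2
        * (if d = 0 then 0 else (expSumBound p (freqPoint d) / p) ^ 2) := by
  have hH : 0 ≤ H := (Nat.cast_nonneg T).trans hT
  set b : (∀ i, ZMod (l i)) → ℂ := devCoeff Ω p T with hb
  have hX := hasExpansion_siftDev (Ω := Ω) hl p T
  have hU : HasExpansion (l := l) (shiftAvg (Finset.univ.image l) Ω p T) fun d =>
      ((1 / p : ℝ) : ℂ) * ((∑ a, b a * (starRingEnd ℂ) (b (a - d)))
        * ∑ t ∈ Finset.range p, expo (t • (1 • freqPoint d))) := by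
    have h1 := ((hX.mul hX).sum_comp_add (Finset.range p) 1).const_mul (1 / p)
    intro m
    rw [← h1 m, shiftAvg]
    simp [sq]
  rw [(hU.sub_const (hU.mean_eq hl).symm).mean_sq_eq hl]
  refine Finset.sum_le_sum fun d _ => ?_
  split_ifs with hd
  · simp
  have hpos : (0 : ℝ) < p := by exact_mod_cast hp
  have hbij : Function.Bijective fun a : ∀ i, ZMod (l i) => p • a := by
    rw [← Finite.injective_iff_bijective]
    intro a a' h
    rw [← sub_eq_zero, ← nsmul_pi_eq_zero_iff hpl, smul_sub]
    exact sub_eq_zero.mpr h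
  have h1 : ‖∑ a, b a * (starRingEnd ℂ) (b (a - d))‖
      ≤ ∑ a, majorant s H a * majorant s H (a - p • d) := by
    rw [← hbij.sum_comp fun a => majorant s H a * majorant s H (a - p • d)]
    refine (norm_sum_le _ _).trans (Finset.sum_le_sum fun a _ => ?_)
    rw [norm_mul, RCLike.norm_conj, ← smul_sub]
    exact mul_le_mul (norm_devCoeff_le_majorant hl hpl hΩ hT a)
      (norm_devCoeff_le_majorant hl hpl hΩ hT _) (norm_nonneg _) (majorant_nonneg hH _)
  have h2 : ‖∑ t ∈ Finset.range p, expo (t • (1 • freqPoint d))‖ ≤ expSumBound p (freqPoint d) := by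
    have := norm_sum_expo_le (x := freqPoint d) (by rwa [Ne, freqPoint_eq_zero_iff hl]) p 0
    rw [one_smul]
    rwa [zero_add, ← Finset.range_eq_Ico] at this
  rw [norm_mul, norm_mul, Complex.norm_real, Real.norm_of_nonneg (by positivity), ← mul_pow]
  refine pow_le_pow_left₀ (by positivity) ?_ 2
  calc _ ≤ 1 / (p : ℝ) * ((∑ a, majorant s H a * majorant s H (a - p • d))
        * expSumBound p (freqPoint d)) := by
        refine mul_le_mul_of_nonneg_left (mul_le_mul h1 h2 (norm_nonneg _) ?_) (by positivity)
        exact (norm_nonneg _).trans h1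
    _ = _ := by ring

/-- After the substitution e = p • d the correlation is the same for all p, so the sum over p falls
on the kernel alone, and `sum_sq_kernel_le` controls it for each fixed e. The energy of the
correlation then supplies the Euler product. -/
theorem sum_mean_shiftAvg_sub_sq_le_of_image (hl : Function.Injective l) (hs : 1 ≤ s)
    (hΩ : ∀ i, (Ω (l i)).card ≤ s) {h j : ℕ} (hh : 0 < h) (hlh : ∀ i, l i ≤ h) {R : Finset ℕ}
    (hR : ∀ p ∈ R, p.Prime ∧ (∀ i, ¬ l i ∣ p) ∧ 16 ^ j ≤ p ∧ p < 16 ^ (j + 1)) :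
    ∑ p ∈ R, mean (∏ i, l i) (fun m => (shiftAvg (Finset.univ.image l) Ω p (h / p) m
        - mean (∏ i, l i) (shiftAvg (Finset.univ.image l) Ω p (h / p))) ^ 2)
      ≤ 19200 * 4 ^ j * (1 + Real.log h) * (h / 16 ^ j) ^ 2
        * ∏ i, (1 + 192 * (s : ℝ) ^ 4 / l i) := by
  have hhR : (0 : ℝ) < h := by exact_mod_cast hh
  have hlogh : 0 ≤ Real.log h := Real.log_natCast_nonneg h
  set H : ℝ := h / 16 ^ j with hHdef
  have hH : 0 < H := by positivity
  set M : (∀ i, ZMod (l i)) → ℝ := fun d => ∑ a, majorant s H a * majorant s H (a - d) with hM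
  set k : ℕ → (∀ i, ZMod (l i)) → ℝ := fun p d =>
    if d = 0 then 0 else (expSumBound p (freqPoint d) / p) ^ 2 with hk
  -- `σ p` divides a frequency by p; `freqPoint (σ p e)` is a p-th part of the point of e.
  set σ : ℕ → (∀ i, ZMod (l i)) → (∀ i, ZMod (l i)) := fun p e i => (p : ZMod (l i))⁻¹ * e i with hσ
  have hpσ : ∀ p ∈ R, ∀ e, p • σ p e = e := fun p hp e => by
    ext i
    have : (p : ZMod (l i)) ≠ 0 := by
      rw [Ne, ZMod.natCast_eq_zero_iff]; exact (hR p hp).2.1 i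
    rw [Pi.smul_apply, nsmul_eq_mul, hσ, mul_inv_cancel_left₀ this]
  have hσp : ∀ p ∈ R, ∀ d, σ p (p • d) = d := fun p hp d => by
    ext i
    have : (p : ZMod (l i)) ≠ 0 := by
      rw [Ne, ZMod.natCast_eq_zero_iff]; exact (hR p hp).2.1 i
    simp only [hσ]
    rw [Pi.smul_apply, nsmul_eq_mul, inv_mul_cancel_left₀ this]
  have step : ∀ p ∈ R, mean (∏ i, l i) (fun m => (shiftAvg (Finset.univ.image l) Ω p (h / p) m
        - mean (∏ i, l i) (shiftAvg (Finset.univ.image l) Ω p (h / p))) ^ 2)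
      ≤ ∑ e, M e ^ 2 * k p (σ p e) := by
    intro p hp
    have hp0 := (hR p hp).1.pos
    refine (mean_shiftAvg_sub_sq_le hl hp0 (hR p hp).2.1 hΩ (H := H) ?_).trans_eq ?_
    · refine Nat.cast_div_le.trans ?_
      rw [hHdef]
      gcongr
      exact_mod_cast (hR p hp).2.2.1
    · have hbij : Function.Bijective fun a : ∀ i, ZMod (l i) => p • a :=
        Function.bijective_iff_has_inverse.mpr ⟨σ p, hσp p hp, hpσ p hp⟩
      rw [← hbij.sum_comp fun e => M e ^ 2 * k p (σ p e)]
      refine Finset.sum_congr rfl fun d _ => ?_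
      rw [hσp p hp]
  refine (Finset.sum_le_sum step).trans ?_
  rw [Finset.sum_comm]
  have inner : ∀ e, ∑ p ∈ R, M e ^ 2 * k p (σ p e)
      ≤ 1200 * 4 ^ j * (1 + Real.log h)
        * (∑ a, majorant (2 * s) H a * majorant (2 * s) H (a - e)) ^ 2 := by
    intro e
    rw [← Finset.mul_sum]
    by_cases he : e = 0
    · have : ∑ p ∈ R, k p (σ p e) = 0 := Finset.sum_eq_zero fun p _ => by
        have : σ p e = 0 := by ext i; simp [hσ, he]
        simp [hk, this]
      rw [this, mul_zero]
      positivity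
    have hsupp : 1 ≤ (freqSupport e).card := by
      rw [Nat.one_le_iff_ne_zero, Ne, Finset.card_eq_zero, freqSupport_eq_empty]
      exact he
    set N := ∏ i ∈ freqSupport e, l i with hN
    have hN0 : 0 < N := Finset.prod_pos fun i _ => (Fact.out : (l i).Prime).pos
    have h1 : ∑ p ∈ R, k p (σ p e) ≤ 1200 * 4 ^ j * (1 + Real.log N) := by
      have h2 := sum_sq_kernel_le hN0 (x := freqPoint e) (by rwa [Ne, freqPoint_eq_zero_iff hl])
        (prod_nsmul_freqPoint subset_rfl) (y := fun p => freqPoint (σ p e)) (R := R) (j := j)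
        fun p hp => ⟨(hR p hp).1, by rw [← freqPoint_nsmul, hpσ p hp],
          prod_nsmul_freqPoint fun i hi => by
            rw [mem_freqSupport] at hi ⊢
            exact right_ne_zero_of_mul hi, (hR p hp).2.2⟩
      refine le_trans (Finset.sum_le_sum fun p _ => ?_) h2
      simp only [hk]
      split_ifs
      · positivity
      · exact le_rfl
    have hlogN : Real.log N ≤ (freqSupport e).card * Real.log h := by
      rw [← Real.log_pow]
      refine Real.log_le_log (by exact_mod_cast hN0) ?_
      have : N ≤ h ^ (freqSupport e).card := Finset.prod_le_pow_card _ _ _ fun i _ => hlh i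
      exact_mod_cast this
    set w := (freqSupport e).card with hw
    have hw1 : (1 : ℝ) ≤ w := by exact_mod_cast hsupp
    -- The kernel bound carries log N ≤ w log h with w the size of the support of e. The factor w is
    -- absorbed by `two_pow_mul_majorant_le`, whence 2s and the constant 192 = 12 · 2⁴.
    have hw2 : (w : ℝ) ≤ (2 ^ w) ^ 2 := by
      have : w < 2 ^ w := Nat.lt_two_pow_self
      have : (w : ℝ) ≤ 2 ^ w := by exact_mod_cast this.le
      have h1 : (1 : ℝ) ≤ 2 ^ w := one_le_pow₀ (by norm_num)
      nlinarith
    have hM0 : 0 ≤ M e := Finset.sum_nonneg fun a _ =>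
      mul_nonneg (majorant_nonneg hH.le _) (majorant_nonneg hH.le _)
    have hM2 : 2 ^ w * M e ≤ ∑ a, majorant (2 * s) H a * majorant (2 * s) H (a - e) := by
      rw [hM, Finset.mul_sum]
      exact Finset.sum_le_sum fun a _ => two_pow_mul_majorant_le hH.le a e
    calc M e ^ 2 * ∑ p ∈ R, k p (σ p e)
        ≤ M e ^ 2 * (1200 * 4 ^ j * (w * (1 + Real.log h))) := by
          refine mul_le_mul_of_nonneg_left (h1.trans ?_) (sq_nonneg _)
          refine mul_le_mul_of_nonneg_left ?_ (by positivity)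
          nlinarith
      _ ≤ M e ^ 2 * (1200 * 4 ^ j * ((2 ^ w) ^ 2 * (1 + Real.log h))) := by gcongr
      _ = 1200 * 4 ^ j * (1 + Real.log h) * (2 ^ w * M e) ^ 2 := by ring
      _ ≤ _ := by gcongr
  refine (Finset.sum_le_sum fun e _ => inner e).trans ?_
  rw [← Finset.mul_sum]
  have := sum_sq_corr_majorant_le (s := 2 * s) hl (by omega) hH
  calc _ ≤ 1200 * 4 ^ j * (1 + Real.log h)
        * ((∏ i, (1 + 12 * ((2 * s : ℕ) : ℝ) ^ 4 / l i)) * (16 * H ^ 2)) :=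
        mul_le_mul_of_nonneg_left this (by positivity)
    _ = _ := by
        have : ∀ i, 1 + 12 * ((2 * s : ℕ) : ℝ) ^ 4 / l i = 1 + 192 * (s : ℝ) ^ 4 / l i := fun i => by
          push_cast; ring
        simp_rw [this]
        ring

/-- For most primes `p` in a range the averages `shiftAvg` have small variance. -/
theorem sum_mean_shiftAvg_sub_sq_le {S : Finset ℕ} (hS : ∀ p ∈ S, p.Prime) (hs : 1 ≤ s)
    (hΩ : ∀ p ∈ S, (Ω p).card ≤ s) {h j : ℕ} (hh : 0 < h) (hSh : ∀ p ∈ S, p ≤ h) {R : Finset ℕ}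
    (hR : ∀ p ∈ R, p.Prime ∧ p ∉ S ∧ 16 ^ j ≤ p ∧ p < 16 ^ (j + 1)) :
    ∑ p ∈ R, mean (∏ l ∈ S, l) (fun m => (shiftAvg S Ω p (h / p) m
        - mean (∏ l ∈ S, l) (shiftAvg S Ω p (h / p))) ^ 2)
      ≤ 19200 * 4 ^ j * (1 + Real.log h) * (h / 16 ^ j) ^ 2
        * ∏ l ∈ S, (1 + 192 * (s : ℝ) ^ 4 / l) := by
  obtain ⟨n, l, hp, hl, rfl⟩ := exists_enumeration hS
  have hm : ∀ i, l i ∈ Finset.univ.image l := fun i => Finset.mem_image_of_mem l (Finset.mem_univ i)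
  rw [Finset.prod_image hl.injOn, Finset.prod_image hl.injOn]
  refine sum_mean_shiftAvg_sub_sq_le_of_image hl hs (fun i => hΩ _ (hm i)) hh
    (fun i => hSh _ (hm i)) fun p hp' => ⟨(hR p hp').1, fun i hd => ?_, (hR p hp').2.2⟩
  have := (Nat.prime_dvd_prime_iff_eq (hp i).out (hR p hp').1).mp hd
  exact (hR p hp').2.1 (this ▸ hm i)

end greedy

/-! ### Chebyshev and Mertens bounds -/

section mertens

theorem sum_log_le {h : ℕ} {S : Finset ℕ} (hS : ∀ p ∈ S, p.Prime ∧ p ≤ h) :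
    ∑ p ∈ S, Real.log p ≤ Real.log 4 * h := by
  refine le_trans ?_ (Chebyshev.theta_le_log4_mul_x (Nat.cast_nonneg h))
  rw [Chebyshev.theta_eq_sum_Icc, Nat.floor_natCast]
  refine Finset.sum_le_sum_of_subset_of_nonneg (fun p hp => ?_) fun p _ _ =>
    Real.log_natCast_nonneg p
  simp [(hS p hp).1, (hS p hp).2]

/-- The product of p^⌊h/p⌋ divides h!, which is at most h^h; replacing ⌊h/p⌋ by h/p costs ∑ log p =
O(h). -/
theorem sum_log_div_le {h : ℕ} (hh : 0 < h) {S : Finset ℕ} (hS : ∀ p ∈ S, p.Prime ∧ p ≤ h) :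
    ∑ p ∈ S, Real.log p / p ≤ Real.log h + Real.log 4 := by
  have hhR : (0 : ℝ) < h := by exact_mod_cast hh
  have hdvd : ∏ p ∈ S, p ^ (h / p) ∣ h.factorial := by
    refine Finset.prod_dvd_of_isRelPrime (fun p hp q hq hpq => ?_) fun p hp => ?_
    · exact Nat.coprime_iff_isRelPrime.mp
        (Nat.Coprime.pow _ _ ((Nat.coprime_primes (hS p hp).1 (hS q hq).1).mpr hpq))
    · rw [(hS p hp).1.pow_dvd_factorial_iff (Nat.lt_succ_self _)]
      have hlog : 1 ≤ Nat.log p h := Nat.log_pos (hS p hp).1.one_lt (hS p hp).2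
      have := Finset.single_le_sum (f := fun i => h / p ^ i) (s := Finset.Ico 1 (Nat.log p h).succ)
        (fun _ _ => Nat.zero_le _) (Finset.mem_Ico.mpr ⟨le_rfl, by omega⟩)
      simpa using this
  have h1 : ∏ p ∈ S, p ^ (h / p) ≤ h ^ h :=
    (Nat.le_of_dvd (Nat.factorial_pos _) hdvd).trans (Nat.factorial_le_pow h)
  have h2 : ∑ p ∈ S, ((h / p : ℕ) : ℝ) * Real.log p ≤ h * Real.log h := by
    have h3 : Real.log ((∏ p ∈ S, p ^ (h / p) : ℕ) : ℝ) ≤ Real.log ((h ^ h : ℕ) : ℝ) :=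
      Real.log_le_log (by exact_mod_cast Finset.prod_pos fun p hp => pow_pos (hS p hp).1.pos _)
        (by exact_mod_cast h1)
    push_cast at h3
    rw [Real.log_pow, Real.log_prod fun p hp => pow_ne_zero _ (by exact_mod_cast (hS p hp).1.ne_zero)]
      at h3
    simpa [Real.log_pow] using h3
  have h4 := sum_log_le hS
  have h5 : h * ∑ p ∈ S, Real.log p / p
      ≤ ∑ p ∈ S, ((h / p : ℕ) : ℝ) * Real.log p + ∑ p ∈ S, Real.log p := by
    rw [Finset.mul_sum, ← Finset.sum_add_distrib]
    refine Finset.sum_le_sum fun p hp => ?_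
    have h6 : (h : ℝ) / p ≤ (h / p : ℕ) + 1 := by
      have := (Nat.lt_floor_add_one ((h : ℝ) / p)).le
      rwa [Nat.floor_div_natCast, Nat.floor_natCast] at this
    calc h * (Real.log p / p) = h / p * Real.log p := by ring
      _ ≤ ((h / p : ℕ) + 1) * Real.log p := by gcongr
      _ = _ := by ring
  refine le_of_mul_le_mul_left (h5.trans ((add_le_add h2 h4).trans_eq ?_)) hhR
  ring

theorem rpow_neg_le_sub {δ : ℝ} (hδ : 0 < δ) (n : ℕ) :
    ((n + 2 : ℕ) : ℝ) ^ (-(1 + δ))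
      ≤ 1 / δ * (((n + 1 : ℕ) : ℝ) ^ (-δ) - ((n + 2 : ℕ) : ℝ) ^ (-δ)) := by
  have hx : (0 : ℝ) < ((n + 2 : ℕ) : ℝ) := by positivity
  have hy : (0 : ℝ) < ((n + 1 : ℕ) : ℝ) := by positivity
  set x : ℝ := ((n + 2 : ℕ) : ℝ) with hxdef
  set y : ℝ := ((n + 1 : ℕ) : ℝ) with hydef
  have hxy : x = y + 1 := by rw [hxdef, hydef]; push_cast; ring
  have h1 : 1 + δ / x ≤ (y / x) ^ (-δ) := by
    rw [Real.rpow_def_of_pos (by positivity)]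
    have h2 : Real.log (y / x) ≤ -(1 / x) := by
      have := Real.log_le_sub_one_of_pos (show 0 < y / x by positivity)
      have e : y / x - 1 = -(1 / x) := by rw [hxy]; field_simp; ring
      linarith
    have h3 : δ / x ≤ Real.log (y / x) * -δ := by
      have : δ / x = (1 / x) * δ := by ring
      nlinarith
    linarith [Real.add_one_le_exp (Real.log (y / x) * -δ)]
  have h4 : x ^ (-δ) * (1 + δ / x) ≤ y ^ (-δ) := by
    rw [Real.div_rpow hy.le hx.le, le_div_iff₀ (by positivity)] at h1
    linarith
  have h5 : x ^ (-(1 + δ)) = x ^ (-δ) / x := by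
    rw [show -(1 + δ) = -δ - 1 by ring, Real.rpow_sub_one hx.ne']
  rw [h5, one_div, inv_mul_eq_div, le_div_iff₀ hδ]
  calc x ^ (-δ) / x * δ = x ^ (-δ) * (1 + δ / x) - x ^ (-δ) := by ring
    _ ≤ _ := by linarith

/-- The Euler product over S is a sum over S-smooth integers, hence at most ζ(1 + δ), which a
telescoping comparison bounds by 1 + 1/δ. -/
theorem prod_inv_one_sub_rpow_le {δ : ℝ} (hδ : 0 < δ) {S : Finset ℕ} (hS : ∀ p ∈ S, p.Prime) :
    ∏ p ∈ S, (1 - (p : ℝ) ^ (-(1 + δ)))⁻¹ ≤ 1 + 1 / δ := by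
  let f : ℕ →* ℝ :=
    { toFun := fun n => (n : ℝ) ^ (-(1 + δ))
      map_one' := by simp
      map_mul' := fun m n => by
        push_cast
        exact Real.mul_rpow (Nat.cast_nonneg _) (Nat.cast_nonneg _) }
  have hf : ∀ n, 0 ≤ f n := fun n => by change 0 ≤ (n : ℝ) ^ (-(1 + δ)); positivity
  have hbound : ∀ n, ∑ i ∈ Finset.range n, f i ≤ 1 + 1 / δ := by
    intro n
    have key : ∀ n : ℕ, ∑ i ∈ Finset.range (n + 2), f i
        ≤ 1 + 1 / δ * (1 - ((n + 1 : ℕ) : ℝ) ^ (-δ)) := by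
      intro n
      induction n with
      | zero =>
        have h0 : f 0 = 0 := by
          change ((0 : ℕ) : ℝ) ^ (-(1 + δ)) = 0
          rw [Nat.cast_zero, Real.zero_rpow (by linarith)]
        simp [Finset.sum_range_succ, h0]
      | succ n ih =>
        rw [Finset.sum_range_succ]
        have := rpow_neg_le_sub hδ n
        have e : f (n + 2) = ((n + 2 : ℕ) : ℝ) ^ (-(1 + δ)) := rfl
        rw [e]
        rw [show n + 1 + 1 = n + 2 by ring]
        linarith
    have h2 : ∑ i ∈ Finset.range n, f i ≤ ∑ i ∈ Finset.range (n + 2), f i :=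
      Finset.sum_le_sum_of_subset_of_nonneg (Finset.range_mono (by omega)) fun i _ _ => hf i
    refine h2.trans ((key n).trans ?_)
    have : (0 : ℝ) ≤ ((n + 1 : ℕ) : ℝ) ^ (-δ) := by positivity
    have h3 : 1 / δ * (1 - ((n + 1 : ℕ) : ℝ) ^ (-δ)) ≤ 1 / δ * 1 := by gcongr; linarith
    linarith
  have hsum : Summable f := summable_of_sum_range_le hf hbound
  have h := EulerProduct.prod_filter_prime_geometric_eq_tsum_factoredNumbers hsum S
  rw [Finset.filter_true_of_mem hS] at h
  change ∏ p ∈ S, (1 - f p)⁻¹ ≤ _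
  rw [h]
  refine (hsum.tsum_subtype_le _ _ hf).trans ?_
  exact hsum.tsum_le_of_sum_range_le hbound

/-- Mertens' upper bound for `∏ (1 - 1 / p)⁻¹`. -/
theorem exists_prod_inv_one_sub_le : ∃ C : ℝ, 1 ≤ C ∧ ∀ h : ℕ, 0 < h → ∀ S : Finset ℕ,
    (∀ p ∈ S, p.Prime ∧ p ≤ h) → ∏ p ∈ S, (1 - 1 / (p : ℝ))⁻¹ ≤ C * (1 + Real.log h) := by
  refine ⟨2 * Real.exp 6, ?_, fun h hh S hS => ?_⟩
  · have := Real.add_one_le_exp (6 : ℝ)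
    linarith
  have hlog : 0 ≤ Real.log h := Real.log_natCast_nonneg h
  set L := 1 + Real.log h with hL
  have hL1 : 1 ≤ L := by linarith
  -- At this δ the passage from p^(-1) to p^(-1-δ) costs exp(2δ ∑ log p / p) ≤ e⁶, while ζ(1 + δ) ≤
  -- 2L.
  set δ := 1 / L with hδdef
  have hδ : 0 < δ := by positivity
  have key : ∀ p ∈ S, (1 - 1 / (p : ℝ))⁻¹
      ≤ Real.exp (2 * δ * (Real.log p / p)) * (1 - (p : ℝ) ^ (-(1 + δ)))⁻¹ := by
    intro p hp
    have hp2 : (2 : ℝ) ≤ p := by exact_mod_cast (hS p hp).1.two_le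
    have hp0 : (0 : ℝ) < p := by linarith
    have hlp : 0 ≤ Real.log p := Real.log_natCast_nonneg p
    have e : (p : ℝ) ^ (-(1 + δ)) = 1 / p * Real.exp (-(δ * Real.log p)) := by
      rw [neg_add, Real.rpow_add hp0, Real.rpow_neg_one, Real.rpow_def_of_pos hp0, one_div]
      ring_nf
    have h1 : 1 - δ * Real.log p ≤ Real.exp (-(δ * Real.log p)) := by
      linarith [Real.add_one_le_exp (-(δ * Real.log p))]
    have h1' : Real.exp (-(δ * Real.log p)) ≤ 1 := Real.exp_le_one_iff.mpr (by
      have : 0 ≤ δ * Real.log p := by positivity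
      linarith)
    have hinv : 1 / (p : ℝ) ≤ 1 / 2 := by gcongr
    have hinv0 : 0 < 1 / (p : ℝ) := by positivity
    set u := Real.exp (-(δ * Real.log p))
    have hu0 : 0 < u := Real.exp_pos _
    have hpos1 : 0 < 1 - 1 / (p : ℝ) := by linarith
    have hpos2 : 0 < 1 - 1 / (p : ℝ) * u := by nlinarith
    rw [e, ← div_eq_mul_inv, le_div_iff₀ hpos2, inv_mul_le_iff₀ hpos1]
    set t := δ * Real.log p with ht
    have ht0 : 0 ≤ t := by positivity
    have h2 : 2 * δ * (Real.log p / p) = 2 * t * (1 / p) := by rw [ht]; ring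
    rw [h2]
    have h3 : 1 + 2 * t * (1 / p) ≤ Real.exp (2 * t * (1 / p)) := by
      linarith [Real.add_one_le_exp (2 * t * (1 / p))]
    have h4 : 1 - 1 / (p : ℝ) * u ≤ (1 - 1 / (p : ℝ)) * (1 + 2 * t * (1 / p)) := by
      have h5 : 0 ≤ t * (1 / (p : ℝ)) := by positivity
      have h6 : t * (1 / (p : ℝ)) * (1 / p) ≤ t * (1 / p) * (1 / 2) := by gcongr
      have h7 : 1 / (p : ℝ) * (1 - t) ≤ 1 / p * u := by gcongr
      nlinarith
    exact h4.trans (by gcongr)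
  have hnn : ∀ p ∈ S, 0 ≤ (1 - 1 / (p : ℝ))⁻¹ := fun p hp => by
    have hp2 : (2 : ℝ) ≤ p := by exact_mod_cast (hS p hp).1.two_le
    have : 1 / (p : ℝ) ≤ 1 / 2 := by gcongr
    exact inv_nonneg.mpr (by linarith)
  refine (Finset.prod_le_prod hnn key).trans ?_
  rw [Finset.prod_mul_distrib, ← Real.exp_sum, ← Finset.mul_sum]
  have h1 := prod_inv_one_sub_rpow_le hδ fun p hp => (hS p hp).1
  have h2 := sum_log_div_le hh hS
  have h3 : 2 * δ * ∑ p ∈ S, Real.log p / p ≤ 6 := by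
    have hlog4 : Real.log 4 ≤ 3 := by
      have := Real.log_le_sub_one_of_pos (show (0 : ℝ) < 4 by norm_num)
      linarith
    calc 2 * δ * ∑ p ∈ S, Real.log p / p ≤ 2 * δ * (3 * L) := by
          gcongr
          linarith
      _ = 6 := by rw [hδdef]; field_simp; norm_num
  have h4 : 1 + 1 / δ ≤ 2 * L := by
    rw [hδdef, one_div_one_div]; linarith
  calc _ ≤ Real.exp 6 * (2 * L) :=
        mul_le_mul (Real.exp_le_exp.mpr h3) (h1.trans h4)
          (Finset.prod_nonneg fun p hp => inv_nonneg.mpr (sub_nonneg.mpr ?_)) (Real.exp_pos _).le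
    _ = _ := by ring
  refine Real.rpow_le_one_of_one_le_of_nonpos ?_ (by linarith)
  exact_mod_cast (hS p hp).1.one_lt.le

theorem exists_prod_one_add_div_le (c : ℕ) : ∃ C : ℝ, 1 ≤ C ∧ ∀ h : ℕ, 0 < h → ∀ S : Finset ℕ,
    (∀ p ∈ S, p.Prime ∧ p ≤ h) → ∏ p ∈ S, (1 + (c : ℝ) / p) ≤ C * (1 + Real.log h) ^ c := by
  obtain ⟨C, hC, hmain⟩ := exists_prod_inv_one_sub_le
  refine ⟨C ^ c, one_le_pow₀ hC, fun h hh S hS => ?_⟩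
  rw [← mul_pow]
  have h1 := hmain h hh S hS
  have hnn : ∀ p ∈ S, 0 ≤ (1 - 1 / (p : ℝ))⁻¹ ∧ 1 + 1 / (p : ℝ) ≤ (1 - 1 / (p : ℝ))⁻¹ := fun p hp => by
    have hp2 : (2 : ℝ) ≤ p := by exact_mod_cast (hS p hp).1.two_le
    have h2 : 1 / (p : ℝ) ≤ 1 / 2 := by gcongr
    have h3 : 0 < 1 / (p : ℝ) := by positivity
    refine ⟨inv_nonneg.mpr (by linarith), ?_⟩
    rw [← one_div (1 - 1 / (p : ℝ)), le_div_iff₀ (by linarith)]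
    nlinarith
  refine le_trans ?_ (pow_le_pow_left₀ (Finset.prod_nonneg fun p hp => (hnn p hp).1) h1 c)
  rw [← Finset.prod_pow]
  refine Finset.prod_le_prod (fun p _ => by positivity) fun p hp => ?_
  refine le_trans ?_ (pow_le_pow_left₀ (by positivity) (hnn p hp).2 c)
  have := one_add_mul_le_pow (a := 1 / (p : ℝ)) (by
    have : (0 : ℝ) ≤ 1 / p := by positivity
    linarith) c
  rwa [mul_one_div] at this

/-- Primes up to √h are counted trivially, and the others have log p ≥ (log h)/2, so Chebyshev's
bound counts them. The 9 is 1 + 2 + 6. -/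
theorem card_primes_mul_log_le {h : ℕ} (hh : 0 < h) {S : Finset ℕ}
    (hS : ∀ p ∈ S, p.Prime ∧ p ≤ h) : S.card * (1 + Real.log h) ≤ 9 * h := by
  have hhR : (0 : ℝ) < h := by exact_mod_cast hh
  have hlog : 0 ≤ Real.log h := Real.log_natCast_nonneg h
  have hcard : (S.card : ℝ) ≤ h := by
    have : S ⊆ Finset.Icc 1 h := fun p hp => Finset.mem_Icc.mpr ⟨(hS p hp).1.pos, (hS p hp).2⟩
    have := Finset.card_le_card this
    rw [Nat.card_Icc, Nat.add_sub_cancel] at this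
    exact_mod_cast this
  have hsmall : ((S.filter fun p => p * p ≤ h).card : ℝ) ≤ √h := by
    refine Real.le_sqrt_of_sq_le ?_
    have h1 : S.filter (fun p => p * p ≤ h) ⊆ Finset.Icc 1 (Nat.sqrt h) := fun p hp => by
      rw [Finset.mem_filter] at hp
      exact Finset.mem_Icc.mpr ⟨(hS p hp.1).1.pos, Nat.le_sqrt.mpr hp.2⟩
    have h2 := Finset.card_le_card h1
    rw [Nat.card_Icc, Nat.add_sub_cancel] at h2
    have h3 : (S.filter fun p => p * p ≤ h).card ^ 2 ≤ h :=
      (Nat.pow_le_pow_left h2 2).trans (Nat.sqrt_le' h)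
    exact_mod_cast h3
  have hlarge : ((S.filter fun p => ¬ p * p ≤ h).card : ℝ) * Real.log h ≤ 2 * (Real.log 4 * h) := by
    have h1 := sum_log_le (h := h) (S := S.filter fun p => ¬ p * p ≤ h) fun p hp =>
      hS p (Finset.filter_subset _ _ hp)
    have h2 : ((S.filter fun p => ¬ p * p ≤ h).card : ℝ) * Real.log h
        ≤ ∑ p ∈ S.filter fun p => ¬ p * p ≤ h, 2 * Real.log p := by
      rw [← nsmul_eq_mul, ← Finset.sum_const]
      refine Finset.sum_le_sum fun p hp => ?_
      rw [Finset.mem_filter] at hp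
      rw [← Real.log_rpow (by exact_mod_cast (hS p hp.1).1.pos)]
      refine Real.log_le_log hhR ?_
      have : h ≤ p ^ 2 := by rw [sq]; omega
      exact_mod_cast this
    rw [← Finset.mul_sum] at h2
    linarith
  have hsqrt : √h * Real.log h ≤ 2 * h := by
    have h1 : Real.log h ≤ 2 * √h := by
      have h2 := Real.log_le_sub_one_of_pos (Real.sqrt_pos.mpr hhR)
      rw [Real.log_sqrt hhR.le] at h2
      linarith [Real.sqrt_nonneg (h : ℝ)]
    calc √h * Real.log h ≤ √h * (2 * √h) := by gcongr
      _ = 2 * (√h * √h) := by ring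
      _ = 2 * h := by rw [Real.mul_self_sqrt hhR.le]
  have hlog4 : Real.log 4 ≤ 3 := by
    have := Real.log_le_sub_one_of_pos (show (0 : ℝ) < 4 by norm_num)
    linarith
  have hsplit : (S.card : ℝ) = (S.filter fun p => p * p ≤ h).card
      + (S.filter fun p => ¬ p * p ≤ h).card := by
    exact_mod_cast (Finset.card_filter_add_card_filter_not fun p => p * p ≤ h).symm
  have h3 : ((S.filter fun p => p * p ≤ h).card : ℝ) * Real.log h ≤ √h * Real.log h := by gcongr
  rw [mul_add, mul_one]
  nth_rewrite 2 [hsplit]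
  nlinarith

end mertens

/-! ### Conditional variance and one step of the induction over small primes -/

section insertion

variable {S : Finset ℕ} {Ω : (p : ℕ) → Finset (ZMod p)} {h p s : ℕ}

theorem sum_range_zmod (p : ℕ) [NeZero p] (φ : ZMod p → ℝ) :
    ∑ i ∈ Finset.range p, φ i = ∑ z, φ z := by
  have := sum_range_eq_sum_zmod p fun n => φ (n : ZMod p)
  simpa using this

theorem sum_range_succ_zmod (p : ℕ) [NeZero p] (φ : ZMod p → ℝ) :
    ∑ i ∈ Finset.range p, φ ((i + 1 : ℕ) : ZMod p) = ∑ z, φ z := by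
  have := sum_range_zmod p fun z => φ (z + 1)
  rw [← Equiv.sum_comp (Equiv.addRight (1 : ZMod p)) φ]
  simpa using this

/-- The mean is the best centre in mean square, so any convenient centre may be used to bound a
variance. -/
theorem mean_sub_sq_le {N : ℕ} (hN : 0 < N) {f : ℤ → ℝ} {A : ℝ} (hA : mean N f = 0) :
    mean N (fun c => f c ^ 2) ≤ mean N (fun c => (A - f c) ^ 2) := by
  have e : ∀ c, (A - f c) ^ 2 = (A ^ 2 + (-2 * A) * f c) + f c ^ 2 := fun c => by ring
  rw [mean_congr e, mean_add, mean_add, mean_const hN, mean_const_mul, hA]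
  nlinarith [sq_nonneg A]

theorem siftCount_succ (g T : ℕ) (n : ℤ) :
    siftCount S Ω g (T + 1) n = siftCount S Ω g T n + sift S Ω (n + g * (T + 1 : ℕ)) := by
  rw [siftCount, Finset.sum_Icc_succ_top (by omega), siftCount]

/-- The conditional variance is controlled by the deviations in progressions modulo `p`. -/
theorem condVar_le_shiftAvg (hp : p.Prime) (hs : (Ω p).card ≤ s) (n : ℤ) :
    condVar S Ω 1 h p n ≤ 2 * s ^ 2 * (shiftAvg S Ω p (h / p) (n + 1 - p) + 1) := by
  have : NeZero p := ⟨hp.ne_zero⟩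
  have hp0 : (0 : ℝ) < p := by exact_mod_cast hp.pos
  set W : ZMod p → ℝ := fun z => ∑ t ∈ Finset.Icc 1 h, if (t : ZMod p) = z then sift S Ω (n + t) else 0
    with hW
  set T := h / p with hT
  set k : ℝ := T * siftDensity S Ω with hk
  have hhit : ∀ c : ℤ, hitCount S Ω 1 h p n c = ∑ ω ∈ Ω p, W (ω - c) := by
    intro c
    rw [hitCount, hW]
    simp only
    rw [Finset.sum_comm]
    refine Finset.sum_congr rfl fun t _ => ?_
    have e : ∀ ω : ZMod p, ((t : ZMod p) = ω - c ↔ ((c + (1 : ℕ) * t : ℤ) : ZMod p) = ω) := fun ω => by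
      push_cast
      rw [eq_sub_iff_add_eq, one_mul, add_comm]
    simp only [e, Finset.sum_ite_eq]
    simp
  have hsq : ∀ c : ℤ, (((Ω p).card : ℝ) * k - hitCount S Ω 1 h p n c) ^ 2
      ≤ s * ∑ ω ∈ Ω p, (W (ω - c) - k) ^ 2 := by
    intro c
    have e : ((Ω p).card : ℝ) * k - hitCount S Ω 1 h p n c = ∑ ω ∈ Ω p, -(W (ω - c) - k) := by
      rw [hhit, Finset.sum_neg_distrib, Finset.sum_sub_distrib]
      simp
    rw [e]
    refine (sq_sum_le_card_mul_sum_sq).trans ?_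
    simp only [neg_sq]
    exact mul_le_mul_of_nonneg_right (by exact_mod_cast hs)
      (Finset.sum_nonneg fun _ _ => sq_nonneg _)
  have h1 : condVar S Ω 1 h p n ≤ s ^ 2 * (1 / p * ∑ z, (W z - k) ^ 2) := by
    -- This A recentres the hit count at |Ω p| · k, with k the expected number of survivors in a
    -- class of length T = ⌊h/p⌋. The deviations then split class by class.
    have h2 := mean_sub_sq_le hp.pos (A := ((Ω p).card : ℝ) / p * siftCount S Ω 1 h n
      - (Ω p).card * k) (mean_fluct (S := S) (Ω := Ω) (g := 1) (h := h) hp.pos n)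
    refine h2.trans ?_
    have h3 : ∀ c, (((Ω p).card : ℝ) / p * siftCount S Ω 1 h n - (Ω p).card * k
        - fluct S Ω 1 h p n c) ^ 2 ≤ s * ∑ ω ∈ Ω p, (W (ω - c) - k) ^ 2 := fun c => by
      refine le_trans (le_of_eq ?_) (hsq c)
      rw [fluct]
      ring
    refine (mean_mono h3).trans ?_
    rw [mean_const_mul, mean_sum]
    have h4 : ∀ ω ∈ Ω p, mean p (fun c => (W (ω - c) - k) ^ 2) = 1 / p * ∑ z, (W z - k) ^ 2 := by
      intro ω _
      rw [mean, div_eq_mul_one_div, mul_comm]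
      congr 1
      have := sum_range_zmod p fun z => (W (ω - z) - k) ^ 2
      rw [← Equiv.sum_comp (Equiv.subLeft ω) fun z => (W z - k) ^ 2]
      simpa using this
    rw [Finset.sum_congr rfl h4, Finset.sum_const, nsmul_eq_mul, sq, mul_assoc]
    have : 0 ≤ 1 / (p : ℝ) * ∑ z, (W z - k) ^ 2 :=
      mul_nonneg (by positivity) (Finset.sum_nonneg fun _ _ => sq_nonneg _)
    gcongr
  refine h1.trans ?_
  have h2 : ∑ z, (W z - k) ^ 2 ≤ ∑ r ∈ Finset.range p,
      (2 * siftDev S Ω p T (n + 1 - p + r) ^ 2 + 2) := by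
    rw [← sum_range_succ_zmod p fun z => (W z - k) ^ 2]
    refine Finset.sum_le_sum fun r hr => ?_
    have hr := Finset.mem_range.mp hr
    have hcls : W ((r + 1 : ℕ) : ZMod p) = siftCount S Ω p ((h + p - (r + 1)) / p) (n + 1 - p + r) := by
      have h5 := classCount_eq (S := S) (Ω := Ω) (g := 1) (h := h) (p := p) (r := r + 1)
        (Finset.mem_Icc.mpr ⟨by omega, by omega⟩) n
      rw [one_mul] at h5
      have e2 : n + ((1 : ℕ) : ℤ) * (((r + 1 : ℕ) : ℤ) - p) = n + 1 - p + r := by push_cast; ring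
      rw [e2] at h5
      rw [← h5, classCount, hW]
      refine Finset.sum_congr rfl fun t _ => ?_
      simp only [ZMod.natCast_eq_natCast_iff, Nat.cast_one, one_mul]
    -- A class has length T or T + 1, so its count differs from that of length T by at most one
    -- survivor. This accounts for the additive 1 in the conclusion.
    have hT1 : (h + p - (r + 1)) / p = T ∨ (h + p - (r + 1)) / p = T + 1 := by
      have a1 : T ≤ (h + p - (r + 1)) / p := Nat.div_le_div_right (by omega)
      have a2 : (h + p - (r + 1)) / p ≤ (h + p) / p := Nat.div_le_div_right (by omega)
      rw [Nat.add_div_right _ hp.pos] at a2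
      omega
    have hdev : W ((r + 1 : ℕ) : ZMod p) - k = siftDev S Ω p T (n + 1 - p + r)
        + (W ((r + 1 : ℕ) : ZMod p) - siftCount S Ω p T (n + 1 - p + r)) := by
      rw [siftDev, hk]; ring
    have he : 0 ≤ W ((r + 1 : ℕ) : ZMod p) - siftCount S Ω p T (n + 1 - p + r) ∧
        W ((r + 1 : ℕ) : ZMod p) - siftCount S Ω p T (n + 1 - p + r) ≤ 1 := by
      rw [hcls]
      rcases hT1 with h6 | h6
      · rw [h6]; simp
      · rw [h6, siftCount_succ, add_sub_cancel_left]
        exact ⟨sift_nonneg _, sift_le_one _⟩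
    rw [hdev]
    set u := siftDev S Ω p T (n + 1 - p + r)
    set e := W ((r + 1 : ℕ) : ZMod p) - siftCount S Ω p T (n + 1 - p + r)
    nlinarith [sq_nonneg (u - e), he.1, he.2]
  have h3 : 1 / (p : ℝ) * ∑ z, (W z - k) ^ 2 ≤ 2 * (shiftAvg S Ω p T (n + 1 - p) + 1) := by
    refine (mul_le_mul_of_nonneg_left h2 (by positivity)).trans_eq ?_
    rw [shiftAvg, Finset.sum_add_distrib, ← Finset.mul_sum, Finset.sum_const, Finset.card_range,
      nsmul_eq_mul]
    field_simp
  calc _ ≤ (s : ℝ) ^ 2 * (2 * (shiftAvg S Ω p T (n + 1 - p) + 1)) := by gcongr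
    _ = _ := by ring

theorem shiftAvg_periodic (p T : ℕ) :
    Function.Periodic (shiftAvg S Ω p T) ((∏ l ∈ S, l : ℕ) : ℤ) := by
  intro n
  unfold shiftAvg
  congr 1
  refine Finset.sum_congr rfl fun r _ => ?_
  have := siftDev_periodic (S := S) (Ω := Ω) (g := p) (h := T) (n + r)
  rw [add_right_comm, this]

theorem mean_shiftAvg (hp : 0 < p) (T : ℕ) :
    mean (∏ l ∈ S, l) (shiftAvg S Ω p T)
      = mean (∏ l ∈ S, l) (fun n => siftDev S Ω p T n ^ 2) := by
  have hp0 : (p : ℝ) ≠ 0 := by exact_mod_cast hp.ne'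
  unfold shiftAvg
  rw [mean_const_mul, mean_sum]
  have : ∀ r ∈ Finset.range p, mean (∏ l ∈ S, l) (fun n => siftDev S Ω p T (n + r) ^ 2)
      = mean (∏ l ∈ S, l) (fun n => siftDev S Ω p T n ^ 2) := fun r _ => by
    refine mean_comp_add (f := fun n => siftDev S Ω p T n ^ 2) (fun n => ?_) r
    simp only [siftDev_periodic n]
  rw [Finset.sum_congr rfl this, Finset.sum_const, Finset.card_range, nsmul_eq_mul]
  field_simp

theorem varFactor_nonneg : 0 ≤ varFactor S Ω :=
  Finset.prod_nonneg fun _ _ => by positivity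

theorem varFactor_insert (hp : p ∉ S) :
    varFactor (insert p S) Ω
      = (((Ω p).card : ℝ) ^ 2 / p + (1 - ((Ω p).card : ℝ) / p) ^ 2) * varFactor S Ω :=
  Finset.prod_insert hp

/-- One step of the induction over primes: bounds for the two error terms give a bound for the
moment after the prime `p` has been added. -/
theorem mean_siftDev_insert_le_of_le (hS : ∀ p ∈ S, p.Prime) (hp : p.Prime) (hmem : p ∉ S) (m : ℕ)
    (hs : 1 ≤ s) (hν : 1 ≤ (Ω p).card) (hθ : (1 : ℝ) / (2 * s) ≤ 1 - ((Ω p).card : ℝ) / p)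
    {K Z a y y₂ : ℝ} (hZ : 0 ≤ Z) (ha : 0 ≤ a) (hy : 0 ≤ y) (hy₂ : 0 ≤ y₂)
    (hK : (2 * s) ^ (2 * m) * 4 ^ (m + 1) * a ≤ K)
    (hE : mean (∏ l ∈ S, l) (fun n => siftDev S Ω 1 h n ^ (2 * (m + 1)))
      ≤ (K * (h * varFactor S Ω) + Z) ^ (m + 1))
    (hmix : mean (∏ l ∈ S, l) (fun n => siftDev S Ω 1 h n ^ (2 * m) * condVar S Ω 1 h p n)
      ≤ (K * (h * varFactor S Ω) + Z) ^ m * (a * (h / p * varFactor S Ω) + y))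
    (hD : mean (∏ l ∈ S, l) (fun n => mean p fun c => fluct S Ω 1 h p n c ^ (2 * (m + 1)))
      ≤ (K * (h * varFactor S Ω) + Z) ^ m * y₂) :
    mean (∏ l ∈ insert p S, l) (fun n => siftDev (insert p S) Ω 1 h n ^ (2 * (m + 1)))
      ≤ (K * (h * varFactor (insert p S) Ω)
        + (Z + (2 * s) ^ (2 * m) * 4 ^ (m + 1) * (y + y₂))) ^ (m + 1) := by
  have hs' : (1 : ℝ) ≤ s := by exact_mod_cast hs
  have hp0 : (0 : ℝ) < p := by exact_mod_cast hp.pos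
  have hV := varFactor_nonneg (S := S) (Ω := Ω)
  set V := varFactor S Ω
  set G : ℝ := (2 * s) ^ (2 * m) * 4 ^ (m + 1) with hG
  have hG0 : 0 ≤ G := by positivity
  have hK0 : 0 ≤ K := le_trans (by positivity) hK
  set B := K * (h * V) + Z with hB
  have hB0 : 0 ≤ B := by positivity
  set θ := 1 - ((Ω p).card : ℝ) / p with hθd
  have hθ0 : 0 < θ := lt_of_lt_of_le (by positivity) hθ
  have hθ1 : θ ≤ 1 := sub_le_self _ (by positivity)
  have hν' : (1 : ℝ) ≤ (Ω p).card := by exact_mod_cast hν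
  refine (mean_siftDev_insert_le hS hp hmem m).trans ?_
  rw [varFactor_insert hmem]
  set x : ℝ := K * (h * V) / p + G * (y + y₂) with hx
  have hx0 : 0 ≤ x := by positivity
  -- The factor (2sθ)^(2m) ≥ 1 is inserted so that B^m becomes (θ² B)^m, matching the decay of the
  -- leading term.
  have h1 : 4 ^ (m + 1) * (B ^ m * (a * (h / p * V) + y) + B ^ m * y₂) ≤ (θ ^ 2 * B) ^ m * x := by
    have h2 : 1 ≤ (2 * s * θ) ^ (2 * m) := by
      refine one_le_pow₀ ?_
      rw [div_le_iff₀ (by positivity)] at hθ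
      linarith
    have h3 : G * (a * (h / p * V) + y + y₂) ≤ x := by
      have : G * a * (h / p * V) ≤ K * (h / p * V) := by gcongr
      have e : K * (h * V) / p = K * (h / p * V) := by ring
      rw [hx, e]
      linarith
    calc 4 ^ (m + 1) * (B ^ m * (a * (h / p * V) + y) + B ^ m * y₂)
        = 1 * (4 ^ (m + 1) * B ^ m * (a * (h / p * V) + y + y₂)) := by ring
      _ ≤ (2 * s * θ) ^ (2 * m) * (4 ^ (m + 1) * B ^ m * (a * (h / p * V) + y + y₂)) := by
          gcongr
      _ = (θ ^ 2 * B) ^ m * (G * (a * (h / p * V) + y + y₂)) := by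
          rw [hG, mul_pow (2 * (s : ℝ)) θ, mul_pow (θ ^ 2) B, ← pow_mul θ]
          ring
      _ ≤ _ := by gcongr
  calc _ ≤ θ ^ (2 * (m + 1)) * B ^ (m + 1)
        + 4 ^ (m + 1) * (B ^ m * (a * (h / p * V) + y) + B ^ m * y₂) := by
        refine add_le_add (mul_le_mul_of_nonneg_left hE (by positivity))
          (mul_le_mul_of_nonneg_left (add_le_add hmix hD) (by positivity))
    _ ≤ (θ ^ 2 * B) ^ (m + 1) + (θ ^ 2 * B) ^ m * x := by
        rw [mul_pow, ← pow_mul]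
        gcongr
    _ ≤ (θ ^ 2 * B + x) ^ (m + 1) := pow_succ_add_le (by positivity) hx0 m
    _ ≤ _ := by
        refine pow_le_pow_left₀ (by positivity) ?_ _
        have e1 : θ ^ 2 * Z ≤ Z := mul_le_of_le_one_left hZ (pow_le_one₀ hθ0.le hθ1)
        have e2 : K * (h * V) / p ≤ K * (h * V) * (((Ω p).card : ℝ) ^ 2 / p) := by
          rw [mul_div_assoc']
          exact div_le_div_of_nonneg_right
            (le_mul_of_one_le_right (by positivity) (one_le_pow₀ hν')) hp0.le
        rw [hx, hB]
        nlinarith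

end insertion

/-! ### Greedy insertion of a dyadic-type block of primes -/

section block

variable {S : Finset ℕ} {Ω : (p : ℕ) → Finset (ZMod p)} {h p s m : ℕ}

theorem prod_primes_pos (hS : ∀ p ∈ S, p.Prime) : 0 < ∏ l ∈ S, l :=
  Finset.prod_pos fun l hl => (hS l hl).pos

theorem siftDev_pow_periodic (g k : ℕ) :
    Function.Periodic (fun n => siftDev S Ω g h n ^ k) ((∏ l ∈ S, l : ℕ) : ℤ) := by
  intro n; simp only [siftDev_periodic n]

/-- The mixed term when the average over shifts is concentrated around its mean. -/
theorem mean_pow_mul_condVar_le_of_concentrated (hS : ∀ p ∈ S, p.Prime) (hp : p.Prime)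
    (hmem : p ∉ S) (hs : (Ω p).card ≤ s) {B L M ε : ℝ} (hB : 0 < B) (hM : 0 ≤ M)
    (hε : 0 ≤ ε) (hBL : h ≤ L * B)
    (hE : mean (∏ l ∈ S, l) (fun n => siftDev S Ω 1 h n ^ (2 * (m + 1))) ≤ B ^ (m + 1))
    (hE' : mean (∏ l ∈ S, l) (fun n => siftDev S Ω 1 h n ^ (4 * m)) ≤ (h * M) ^ (2 * m))
    (hvar : mean (∏ l ∈ S, l) (fun n => (shiftAvg S Ω p (h / p) n
        - mean (∏ l ∈ S, l) (shiftAvg S Ω p (h / p))) ^ 2) ≤ ε ^ 2) :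
    mean (∏ l ∈ S, l) (fun n => siftDev S Ω 1 h n ^ (2 * m) * condVar S Ω 1 h p n)
      ≤ B ^ m * (16 * s ^ 2 * (h / p * varFactor S Ω)
        + (4 * s ^ 2 + 2 * s ^ 2 * (M * L) ^ m * ε)) := by
  have hp0 : (0 : ℝ) < p := by exact_mod_cast hp.pos
  set Q := ∏ l ∈ S, l with hQ
  have hQ0 : 0 < Q := prod_primes_pos hS
  set U := shiftAvg S Ω p (h / p) with hU
  set μ := mean Q U with hμ
  have hμle : μ ≤ 4 * (h / p * varFactor S Ω) := by
    rw [hμ, hU, mean_shiftAvg hp.pos]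
    refine (mean_siftDev_sq_le hS (fun l hl hd => hmem ?_) _).trans ?_
    · rwa [← (Nat.prime_dvd_prime_iff_eq (hS l hl) hp).mp hd]
    · rw [mul_assoc]
      have := varFactor_nonneg (S := S) (Ω := Ω)
      have := Nat.cast_div_le (α := ℝ) (m := h) (n := p)
      gcongr
  have hμ0 : 0 ≤ μ := mean_nonneg fun n => by
    rw [hU, shiftAvg]; positivity
  set f : ℤ → ℝ := fun n => siftDev S Ω 1 h n ^ (2 * m) with hf
  have hf0 : ∀ n, 0 ≤ f n := fun n => (even_two_mul m).pow_nonneg _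
  have hmf : mean Q f ≤ 2 * B ^ m := mean_pow_two_mul_le hQ0 hB m hE
  set w : ℤ → ℝ := fun n => U (n + (1 - p)) - μ with hw
  -- Cauchy–Schwarz against the crude moment of order 4m loses only powers of M and L relative to
  -- B^m, and ε is small enough to compensate. The shift by 1 - p is harmless by periodicity.
  have hcs : mean Q (fun n => f n * w n) ≤ (h * M) ^ m * ε := by
    refine le_of_sq_le_sq ((mean_mul_sq_le Q f w).trans ?_) (by positivity)
    have e1 : mean Q (fun n => f n ^ 2) ≤ ((h * M) ^ m) ^ 2 := by
      rw [← pow_mul, mul_comm m 2]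
      refine le_trans (le_of_eq (mean_congr fun n => ?_)) hE'
      rw [hf]; simp only; rw [← pow_mul]; ring_nf
    have e2 : mean Q (fun n => w n ^ 2) ≤ ε ^ 2 := by
      refine le_trans (le_of_eq ?_) hvar
      refine mean_comp_add (f := fun n => (U n - μ) ^ 2) (fun n => ?_) (1 - p)
      simp only [hU, hQ, shiftAvg_periodic (S := S) (Ω := Ω) p (h / p) n]
    rw [mul_pow]
    exact mul_le_mul e1 e2 (mean_nonneg fun _ => sq_nonneg _) (by positivity)
  have hpt : ∀ n, f n * condVar S Ω 1 h p n
      ≤ 2 * s ^ 2 * (μ + 1) * f n + 2 * s ^ 2 * (f n * w n) := fun n => by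
    have h1 := mul_le_mul_of_nonneg_left (condVar_le_shiftAvg (S := S) (h := h) hp hs n) (hf0 n)
    refine h1.trans_eq ?_
    have e : n + 1 - (p : ℤ) = n + (1 - p) := by ring
    rw [e, hw]; simp only [← hU]; ring
  refine (mean_mono hpt).trans ?_
  rw [mean_add, mean_const_mul, mean_const_mul]
  have hB' : (h : ℝ) ^ m ≤ L ^ m * B ^ m := by
    rw [← mul_pow]; exact pow_le_pow_left₀ (by positivity) hBL m
  calc 2 * (s : ℝ) ^ 2 * (μ + 1) * mean Q f + 2 * s ^ 2 * mean Q (fun n => f n * w n)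
      ≤ 2 * (s : ℝ) ^ 2 * (4 * (h / p * varFactor S Ω) + 1) * (2 * B ^ m)
        + 2 * s ^ 2 * ((h * M) ^ m * ε) := by
        have h4 : 0 ≤ 4 * (h / p * varFactor S Ω) := hμ0.trans hμle
        have h5 : 0 ≤ mean Q f := mean_nonneg hf0
        gcongr
    _ ≤ 2 * (s : ℝ) ^ 2 * (4 * (h / p * varFactor S Ω) + 1) * (2 * B ^ m)
        + 2 * s ^ 2 * ((L ^ m * B ^ m * M ^ m) * ε) := by
        rw [mul_pow]
        gcongr
    _ = _ := by rw [mul_pow]; ring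

/-- The mixed term, bounded by Hölder's inequality. -/
theorem mean_pow_mul_condVar_le (hp : p.Prime) {B F : ℝ} (hB : 0 < B) (hF : 0 < F)
    (hE : mean (∏ l ∈ S, l) (fun n => siftDev S Ω 1 h n ^ (2 * (m + 1))) ≤ B ^ (m + 1))
    (hfl : mean (∏ l ∈ S, l) (fun n => mean p fun c => fluct S Ω 1 h p n c ^ (2 * (m + 1)))
      ≤ F ^ (m + 1)) :
    mean (∏ l ∈ S, l) (fun n => siftDev S Ω 1 h n ^ (2 * m) * condVar S Ω 1 h p n)
      ≤ B ^ m * (2 * F) := by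
  refine (mean_pow_mul_sq_le hB hF m hE (le_trans (mean_mono fun n => ?_) hfl)
    fun n => condVar_nonneg n).trans_eq (by ring)
  exact mean_le_pow_of_pow_succ hp.pos m

/-- Conditions on the sieving data of the prime `p` for intervals of length `h ≥ p`. -/
def IsSmallPrime (Ω : (p : ℕ) → Finset (ZMod p)) (s h p : ℕ) : Prop :=
  p.Prime ∧ p ≤ h ∧ (Ω p).card ≤ s ∧ 1 ≤ (Ω p).card ∧ (1 : ℝ) / (2 * s) ≤ 1 - ((Ω p).card : ℝ) / p

/-- `M` bounds the Euler products that occur in the moment estimates of order `2 (m + 1)`. -/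
structure EulerBound (Ω : (p : ℕ) → Finset (ZMod p)) (s m h : ℕ) (M : ℝ) : Prop where
  one_le : 1 ≤ M
  moment : ∀ S : Finset ℕ, (∀ p ∈ S, IsSmallPrime Ω s h p) → ∀ g T : ℕ, (∀ p ∈ S, ¬ p ∣ g) →
    1 ≤ T → mean (∏ l ∈ S, l) (fun n => siftDev S Ω g T n ^ (2 * (m + 1))) ≤ (T * M) ^ (m + 1)
  moment' : ∀ S : Finset ℕ, (∀ p ∈ S, IsSmallPrime Ω s h p) →
    mean (∏ l ∈ S, l) (fun n => siftDev S Ω 1 h n ^ (4 * m)) ≤ (h * M) ^ (2 * m)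
  prod : ∀ S : Finset ℕ, (∀ p ∈ S, IsSmallPrime Ω s h p) → ∏ l ∈ S, (1 + 192 * (s : ℝ) ^ 4 / l) ≤ M

/-- The class lengths are at most h/p + 1 ≤ 2h/p, so the 9 s² of `mean_fluct_pow_le` becomes 18 s².
-/
theorem EulerBound.fluct {M : ℝ} (hM : EulerBound Ω s m h M)
    (hS : ∀ p ∈ S, IsSmallPrime Ω s h p) (hp : IsSmallPrime Ω s h p) (hmem : p ∉ S) :
    mean (∏ l ∈ S, l) (fun n => mean p fun c => fluct S Ω 1 h p n c ^ (2 * (m + 1)))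
      ≤ (18 * s ^ 2 * M * (h / p)) ^ (m + 1) := by
  have hp0 : (0 : ℝ) < p := by exact_mod_cast hp.1.pos
  have hM1 := hM.one_le
  have hhp : (1 : ℝ) ≤ h / p := by
    rw [le_div_iff₀ hp0, one_mul]; exact_mod_cast hp.2.1
  have hB : 1 ≤ (2 * (h / p) * M : ℝ) := by nlinarith
  refine (mean_fluct_pow_le (fun l hl => (hS l hl).1) hp.1 hp.1.not_dvd_one hp.2.2.1 m hB
    fun T hT => ?_).trans_eq (by ring)
  rcases Nat.eq_zero_or_pos T with rfl | hT0
  · simp only [siftDev_zero]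
    rw [zero_pow (by omega), mean_const (prod_primes_pos fun l hl => (hS l hl).1)]
    positivity
  refine (hM.moment S hS _ T (fun l hl hd => hmem ?_) hT0).trans ?_
  · rw [one_mul] at hd
    rwa [← (Nat.prime_dvd_prime_iff_eq (hS l hl).1 hp.1).mp hd]
  · refine pow_le_pow_left₀ (by positivity) ?_ _
    gcongr
    linarith

/-- Adding the primes of one block `[16 ^ j, 16 ^ (j + 1))`. -/
theorem mean_siftDev_block_le (hs : 1 ≤ s) (hm : 1 ≤ m) {j : ℕ} {K L M : ℝ} (hL : L = 1 + Real.log h)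
    (hh : 0 < h) (hM : EulerBound Ω s m h M)
    (hK : (2 * s : ℝ) ^ (2 * m) * 4 ^ (m + 1) * (16 * s ^ 2) ≤ K) :
    ∀ (N : ℕ) (S R : Finset ℕ) (Z : ℝ), R.card = N → (∀ p ∈ S, IsSmallPrime Ω s h p) →
      (∀ p ∈ R, IsSmallPrime Ω s h p ∧ p ∉ S ∧ 16 ^ j ≤ p ∧ p < 16 ^ (j + 1)) →
      h ≤ L * Z →
      mean (∏ l ∈ S, l) (fun n => siftDev S Ω 1 h n ^ (2 * (m + 1)))
        ≤ (K * (h * varFactor S Ω) + Z) ^ (m + 1) →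
      mean (∏ l ∈ R ∪ S, l) (fun n => siftDev (R ∪ S) Ω 1 h n ^ (2 * (m + 1)))
        ≤ (K * (h * varFactor (R ∪ S) Ω) + (Z + (2 * s : ℝ) ^ (2 * m) * 4 ^ (m + 1) *
          (N * (4 * s ^ 2 + 2 * s ^ 2 * (M * L) ^ m * (139 * (L * M) * (h / 16 ^ j) * (3 / 4) ^ j)
            + (18 * s ^ 2 * M) ^ (m + 1) * L ^ m * (h / 16 ^ j) / 16 ^ j)
          + min (N : ℝ) (8 ^ j) * (36 * s ^ 2 * M * (h / 16 ^ j))))) ^ (m + 1) := by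
  have hs' : (1 : ℝ) ≤ s := by exact_mod_cast hs
  have hhR : (0 : ℝ) < h := by exact_mod_cast hh
  have hL1 : 1 ≤ L := by
    have := Real.log_natCast_nonneg h
    linarith
  have hM1 := hM.one_le
  set G : ℝ := (2 * s : ℝ) ^ (2 * m) * 4 ^ (m + 1) with hG
  have hG0 : 0 ≤ G := by positivity
  have hK0 : 0 ≤ K := le_trans (by positivity) hK
  set H : ℝ := h / 16 ^ j with hH
  have hH0 : 0 < H := by positivity
  set ε : ℝ := 139 * (L * M) * H * (3 / 4) ^ j with hε
  have hε0 : 0 ≤ ε := by positivity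
  set y₁ : ℝ := 4 * s ^ 2 + 2 * s ^ 2 * (M * L) ^ m * ε with hy₁
  have hy₁0 : 0 ≤ y₁ := by positivity
  set y₂ : ℝ := (18 * s ^ 2 * M) ^ (m + 1) * L ^ m * H / 16 ^ j with hy₂
  have hy₂0 : 0 ≤ y₂ := by positivity
  set y₃ : ℝ := 36 * s ^ 2 * M * H with hy₃
  have hy₃0 : 0 ≤ y₃ := by positivity
  intro N
  induction N with
  | zero =>
    intro S R Z hR hS _ _ hE
    rw [Finset.card_eq_zero] at hR
    subst hR
    simpa using hE
  | succ N ih =>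
    intro S R Z hcard hS hR hZ hE
    have hSp : ∀ p ∈ S, p.Prime := fun p hp => (hS p hp).1
    have hZ0 : 0 < Z := by
      by_contra hcon
      nlinarith
    have hV := varFactor_nonneg (S := S) (Ω := Ω)
    set B := K * (h * varFactor S Ω) + Z with hB
    have hZB : Z ≤ B := le_add_of_nonneg_left (by positivity)
    have hB0 : 0 < B := hZ0.trans_le hZB
    have hBL : h ≤ L * B := hZ.trans (by gcongr)
    have hfl : ∀ p ∈ R, mean (∏ l ∈ S, l)
        (fun n => mean p fun c => fluct S Ω 1 h p n c ^ (2 * (m + 1)))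
        ≤ (18 * s ^ 2 * M * H) ^ (m + 1) := fun p hp => by
      refine (hM.fluct hS (hR p hp).1 (hR p hp).2.1).trans ?_
      refine pow_le_pow_left₀ (by positivity) ?_ _
      have : (16 : ℝ) ^ j ≤ p := by exact_mod_cast (hR p hp).2.2.1
      rw [hH]
      gcongr
    have hD : ∀ p ∈ R, mean (∏ l ∈ S, l)
        (fun n => mean p fun c => fluct S Ω 1 h p n c ^ (2 * (m + 1))) ≤ B ^ m * y₂ := fun p hp => by
      refine (hfl p hp).trans ?_
      -- The hypothesis 1 ≤ m enters here: the pure moment of the fluctuation gains a further factor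
      -- 16^(-j).
      have e1 : H ^ m ≤ L ^ m * B ^ m / 16 ^ j := by
        rw [hH, div_pow, ← mul_pow]
        have : (16 : ℝ) ^ j ≤ (16 ^ j) ^ m :=
          le_self_pow₀ (one_le_pow₀ (by norm_num)) (by omega)
        gcongr
      calc (18 * (s : ℝ) ^ 2 * M * H) ^ (m + 1) = (18 * s ^ 2 * M) ^ (m + 1) * H * H ^ m := by
            rw [mul_pow]; ring
        _ ≤ (18 * s ^ 2 * M) ^ (m + 1) * H * (L ^ m * B ^ m / 16 ^ j) := by gcongr
        _ = _ := by rw [hy₂]; ring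
    -- Choice of the next prime. While at least 8^j primes remain, one has variance no larger than
    -- the average and costs y₁. Afterwards any prime is taken, at the Hölder cost y₃, which happens
    -- fewer than 8^j times.
    obtain ⟨p, hpR, y, hy0, hyle, hmix⟩ : ∃ p ∈ R, ∃ y : ℝ, 0 ≤ y ∧
        y + min (N : ℝ) (8 ^ j) * y₃ ≤ y₁ + min ((N + 1 : ℕ) : ℝ) (8 ^ j) * y₃ ∧
        mean (∏ l ∈ S, l) (fun n => siftDev S Ω 1 h n ^ (2 * m) * condVar S Ω 1 h p n)
          ≤ B ^ m * (16 * s ^ 2 * (h / p * varFactor S Ω) + y) := by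
      rcases le_or_gt (8 ^ j) (N + 1) with hbig | hsmall
      · have hsum := sum_mean_shiftAvg_sub_sq_le hSp hs (fun p hp => (hS p hp).2.2.1) hh
          (fun p hp => (hS p hp).2.1) (j := j) (R := R)
          fun p hp => ⟨(hR p hp).1.1, (hR p hp).2.1, (hR p hp).2.2⟩
        have hne : R.Nonempty := by rw [← Finset.card_pos, hcard]; omega
        obtain ⟨p, hpR, hp⟩ : ∃ p ∈ R, mean (∏ l ∈ S, l) (fun n => (shiftAvg S Ω p (h / p) n
            - mean (∏ l ∈ S, l) (shiftAvg S Ω p (h / p))) ^ 2) ≤ ε ^ 2 := by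
          refine Finset.exists_le_of_sum_le hne (hsum.trans ?_)
          rw [Finset.sum_const, hcard, nsmul_eq_mul, ← hL, ← hH]
          have hb : (8 : ℝ) ^ j ≤ ((N + 1 : ℕ) : ℝ) := by exact_mod_cast hbig
          -- Dividing by the number of remaining primes leaves 4^j / 8^j ≤ (9/16)^j, the square of
          -- (3/4)^j; and 139² exceeds 19200.
          calc 19200 * 4 ^ j * L * H ^ 2 * ∏ l ∈ S, (1 + 192 * (s : ℝ) ^ 4 / l)
              ≤ 139 ^ 2 * (8 * (3 / 4) ^ 2) ^ j * L ^ 2 * H ^ 2 * M ^ 2 := by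
                have a1 : L ≤ L ^ 2 := le_self_pow₀ hL1 (by norm_num)
                have a2 : M ≤ M ^ 2 := le_self_pow₀ hM1 (by norm_num)
                have a3 := (hM.prod S hS).trans a2
                have a4 : (0 : ℝ) ≤ ∏ l ∈ S, (1 + 192 * (s : ℝ) ^ 4 / l) :=
                  Finset.prod_nonneg fun l _ => by positivity
                have a5 : (4 : ℝ) ^ j ≤ (8 * (3 / 4) ^ 2) ^ j :=
                  pow_le_pow_left₀ (by norm_num) (by norm_num) j
                have a6 : 19200 * (4 : ℝ) ^ j * L * H ^ 2
                    ≤ 139 ^ 2 * (8 * (3 / 4) ^ 2) ^ j * L ^ 2 * H ^ 2 := by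
                  gcongr
                  norm_num
                exact mul_le_mul a6 a3 a4 (by positivity)
            _ = 8 ^ j * ε ^ 2 := by rw [hε, mul_pow, ← pow_mul]; ring
            _ ≤ _ := by gcongr
        refine ⟨p, hpR, y₁, hy₁0, ?_, ?_⟩
        · gcongr
          omega
        · exact mean_pow_mul_condVar_le_of_concentrated hSp (hR p hpR).1.1 (hR p hpR).2.1
            (hR p hpR).1.2.2.1 hB0 (by linarith) hε0 hBL hE (hM.moment' S hS) hp
      · obtain ⟨p, hpR⟩ : R.Nonempty := by rw [← Finset.card_pos, hcard]; omega
        refine ⟨p, hpR, y₃, hy₃0, ?_, ?_⟩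
        · have hb : ((N + 1 : ℕ) : ℝ) ≤ 8 ^ j := by exact_mod_cast hsmall.le
          have hb' : (N : ℝ) ≤ 8 ^ j := le_trans (by push_cast; linarith) hb
          rw [min_eq_left hb, min_eq_left hb']
          push_cast
          linarith
        · refine (mean_pow_mul_condVar_le (hR p hpR).1.1 hB0 (by positivity) hE
            (hfl p hpR)).trans ?_
          have : 0 ≤ 16 * (s : ℝ) ^ 2 * (h / p * varFactor S Ω) := by positivity
          refine mul_le_mul_of_nonneg_left ?_ (by positivity)
          rw [hy₃]
          linarith
    have hstep := mean_siftDev_insert_le_of_le hSp (hR p hpR).1.1 (hR p hpR).2.1 m hs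
      (hR p hpR).1.2.2.2.1 (hR p hpR).1.2.2.2.2 hZ0.le (by positivity) hy0 hy₂0 hK hE hmix (hD p hpR)
    have hfin := ih (insert p S) (R.erase p) (Z + G * (y + y₂))
      (by rw [Finset.card_erase_of_mem hpR, hcard]; rfl)
      (fun l hl => by
        rcases Finset.mem_insert.mp hl with rfl | hl
        · exact (hR _ hpR).1
        · exact hS l hl)
      (fun l hl => by
        have hl' := Finset.mem_of_mem_erase hl
        refine ⟨(hR l hl').1, ?_, (hR l hl').2.2⟩
        rw [Finset.mem_insert, not_or]
        exact ⟨Finset.ne_of_mem_erase hl, (hR l hl').2.1⟩)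
      (hZ.trans (by
        refine mul_le_mul_of_nonneg_left ?_ (by linarith)
        have : 0 ≤ G * (y + y₂) := by positivity
        linarith)) hstep
    have hun : R.erase p ∪ insert p S = R ∪ S := by
      rw [Finset.union_insert, ← Finset.insert_union, Finset.insert_erase hpR]
    rw [hun] at hfin
    refine hfin.trans ?_
    have hV' := varFactor_nonneg (S := R ∪ S) (Ω := Ω)
    refine pow_le_pow_left₀ (by positivity) ?_ _
    have : G * (y + y₂) + G * (N * (y₁ + y₂) + min (N : ℝ) (8 ^ j) * y₃)
        ≤ G * ((N + 1 : ℕ) * (y₁ + y₂) + min ((N + 1 : ℕ) : ℝ) (8 ^ j) * y₃) := by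
      rw [← mul_add]
      refine mul_le_mul_of_nonneg_left ?_ hG0
      push_cast at hyle ⊢
      linarith
    linarith

end block

/-! ### All primes up to the length of the interval -/

/-- The decay exp(-√L/4), with L = 1 + log h, is what both Rankin's trick and the starting block
provide; it must beat every power of L. -/
theorem exists_pow_mul_exp_neg_sqrt_le (A : ℕ) : ∃ C : ℝ, 1 ≤ C ∧ ∀ L : ℝ, 0 ≤ L →
    L ^ A * Real.exp (-(√L / 4)) ≤ C := by
  refine ⟨16 ^ A * (2 * A).factorial, ?_, fun L hL => ?_⟩
  · exact one_le_mul_of_one_le_of_one_le (one_le_pow₀ (by norm_num))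
      (by exact_mod_cast Nat.factorial_pos _)
  have h1 := Real.pow_div_factorial_le_exp (√L / 4) (by positivity) (2 * A)
  rw [div_pow, pow_mul, Real.sq_sqrt hL, pow_mul, div_div, div_le_iff₀ (by positivity)] at h1
  rw [Real.exp_neg, ← div_eq_mul_inv, div_le_iff₀ (Real.exp_pos _)]
  refine h1.trans_eq ?_
  norm_num
  ring

section smallPrimes

variable {S : Finset ℕ} {Ω : (p : ℕ) → Finset (ZMod p)} {h p s m : ℕ}

theorem prod_one_add_mul_rpow_le {C : ℝ} {c : ℕ} (hC : 0 ≤ C) (hc : C ≤ c) :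
    ∏ p ∈ S, (1 + C * (p : ℝ) ^ (-1 : ℝ)) ≤ ∏ p ∈ S, (1 + (c : ℝ) / p) := by
  refine Finset.prod_le_prod (fun p _ => by positivity) fun p _ => ?_
  rw [Real.rpow_neg_one, div_eq_mul_inv]
  gcongr

/-- The crude moment bound with τ = 1, applied in the orders 2(m+1) and 4m = 2((2m-1)+1), gives
products of 1 + C/p. A single exponent c dominates these and the product with 192 s⁴, and Mertens
turns them into a power of log h. -/
theorem exists_eulerBound (s m : ℕ) (hs : 1 ≤ s) (hm : 1 ≤ m) : ∃ (C : ℝ) (c : ℕ), 1 ≤ C ∧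
    ∀ (Ω : (p : ℕ) → Finset (ZMod p)) (h : ℕ), 0 < h →
      EulerBound Ω s m h (C * (1 + Real.log h) ^ c) := by
  obtain ⟨C₁, hC₁, h₁⟩ := exists_mean_siftDev_pow_le s m hs
  obtain ⟨C₂, hC₂, h₂⟩ := exists_mean_siftDev_pow_le s (2 * m - 1) hs
  set c : ℕ := ⌈C₁⌉₊ + ⌈C₂⌉₊ + 192 * s ^ 4 with hc
  have hc₁ : C₁ ≤ c := (Nat.le_ceil C₁).trans (by exact_mod_cast (by omega))
  have hc₂ : C₂ ≤ c := (Nat.le_ceil C₂).trans (by exact_mod_cast (by omega))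
  have hc₃ : 192 * (s : ℝ) ^ 4 ≤ c := by
    have : 192 * s ^ 4 ≤ c := by omega
    exact_mod_cast this
  obtain ⟨C, hC, hprod⟩ := exists_prod_one_add_div_le c
  refine ⟨C, c, hC, fun Ω h hh => ?_⟩
  have hL : 1 ≤ 1 + Real.log h := by
    have := Real.log_natCast_nonneg h
    linarith
  have hpr : ∀ S : Finset ℕ, (∀ p ∈ S, IsSmallPrime Ω s h p) →
      ∏ p ∈ S, (1 + (c : ℝ) / p) ≤ C * (1 + Real.log h) ^ c := fun S hS =>
    hprod h hh S fun p hp => ⟨(hS p hp).1, (hS p hp).2.1⟩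
  refine ⟨one_le_mul_of_one_le_of_one_le hC (one_le_pow₀ hL), fun S hS g T hg hT => ?_,
    fun S hS => ?_, fun S hS => ?_⟩
  · refine (h₁ 1 zero_le_one le_rfl Ω S (fun p hp => (hS p hp).1) (fun p hp => (hS p hp).2.2.1)
      g hg T hT).trans ?_
    rw [Real.rpow_one]
    refine pow_le_pow_left₀ (mul_nonneg (by positivity)
      (Finset.prod_nonneg fun p _ => by positivity)) ?_ _
    exact mul_le_mul_of_nonneg_left
      ((prod_one_add_mul_rpow_le (by linarith) hc₁).trans (hpr S hS)) (by positivity)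
  · have := h₂ 1 zero_le_one le_rfl Ω S (fun p hp => (hS p hp).1) (fun p hp => (hS p hp).2.2.1)
      1 (fun p hp => (hS p hp).1.not_dvd_one) h hh
    have e1 : 2 * m - 1 + 1 = 2 * m := by omega
    have e2 : 2 * (2 * m) = 4 * m := by omega
    rw [e1, e2, Real.rpow_one] at this
    refine this.trans ?_
    refine pow_le_pow_left₀ (mul_nonneg (by positivity)
      (Finset.prod_nonneg fun p _ => by positivity)) ?_ _
    exact mul_le_mul_of_nonneg_left
      ((prod_one_add_mul_rpow_le (by linarith) hc₂).trans (hpr S hS)) (by positivity)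
  · refine le_trans (Finset.prod_le_prod (fun p _ => by positivity) fun p _ => ?_) (hpr S hS)
    gcongr

theorem sqrt_sub_le_log_div_sqrt {L : ℝ} (hL : 1 ≤ L) : √L - 1 ≤ (L - 1) / √L := by
  have h1 : 1 ≤ √L := Real.one_le_sqrt.mpr hL
  rw [le_div_iff₀ (by linarith)]
  nlinarith [Real.sq_sqrt (by linarith : 0 ≤ L)]

/-- Rankin's trick: the moments are small when all primes are very small. -/
theorem exists_mean_siftDev_verySmall_le (s m : ℕ) (hs : 1 ≤ s) : ∃ C : ℝ, 1 ≤ C ∧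
    ∀ (Ω : (p : ℕ) → Finset (ZMod p)) (h : ℕ), 0 < h → ∀ S : Finset ℕ,
      (∀ p ∈ S, IsSmallPrime Ω s h p ∧ p < 16 ^ ⌊√(1 + Real.log h)⌋₊) →
      mean (∏ l ∈ S, l) (fun n => siftDev S Ω 1 h n ^ (2 * (m + 1)))
        ≤ (C * (h / (1 + Real.log h))) ^ (m + 1) := by
  obtain ⟨C₁, hC₁, h₁⟩ := exists_mean_siftDev_pow_le s m hs
  set c : ℕ := ⌈C₁ * Real.exp 3⌉₊ with hc
  obtain ⟨C₂, hC₂, hprod⟩ := exists_prod_one_add_div_le c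
  obtain ⟨C₃, hC₃, hexp⟩ := exists_pow_mul_exp_neg_sqrt_le (c + 1)
  refine ⟨Real.exp 1 * C₂ * C₃, ?_, fun Ω h hh S hS => ?_⟩
  · have : 1 ≤ Real.exp 1 := Real.one_le_exp (by norm_num)
    exact one_le_mul_of_one_le_of_one_le (one_le_mul_of_one_le_of_one_le this hC₂) hC₃
  have hhR : (0 : ℝ) < h := by exact_mod_cast hh
  have hlog : 0 ≤ Real.log h := Real.log_natCast_nonneg h
  set L := 1 + Real.log h with hL
  have hL1 : 1 ≤ L := by linarith
  have hsq : 1 ≤ √L := Real.one_le_sqrt.mpr hL1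
  have hsq0 : 0 < √L := by linarith
  have hinv : 1 / √L ≤ 1 := by rw [div_le_one hsq0]; exact hsq
  -- For p < 16^√L one has p^(1/√L) ≤ e³, so lowering the exponent to τ = 1 - 1/√L costs a constant
  -- in each Euler factor, while h^(-1/√L) saves more than any power of L.
  refine (h₁ (1 - 1 / √L) (by linarith) (by linarith [show 0 ≤ 1 / √L by positivity]) Ω S
    (fun p hp => (hS p hp).1.1) (fun p hp => (hS p hp).1.2.2.1) 1
    (fun p hp => (hS p hp).1.1.not_dvd_one) h hh).trans ?_
  refine pow_le_pow_left₀ (mul_nonneg (by positivity)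
      (Finset.prod_nonneg fun p _ => by positivity)) ?_ _
  have hP : ∏ p ∈ S, (1 + C₁ * (p : ℝ) ^ (-(1 - 1 / √L))) ≤ C₂ * L ^ c := by
    refine le_trans (Finset.prod_le_prod (fun p _ => by positivity) fun p hp => ?_)
      (hprod h hh S fun p hp => ⟨(hS p hp).1.1, (hS p hp).1.2.1⟩)
    have hp0 : (0 : ℝ) < p := by exact_mod_cast (hS p hp).1.1.pos
    have hlogp : Real.log p ≤ 3 * √L := by
      have h2 : Real.log p ≤ Real.log ((16 : ℝ) ^ ⌊√L⌋₊) :=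
        Real.log_le_log hp0 (by exact_mod_cast (hS p hp).2.le)
      rw [Real.log_pow] at h2
      have h3 : Real.log 16 ≤ 3 := by
        rw [show (16 : ℝ) = 2 ^ 4 by norm_num, Real.log_pow]
        have := Real.log_two_lt_d9
        push_cast
        linarith
      have h4 := Nat.floor_le hsq0.le
      have h5 : 0 ≤ Real.log 16 := Real.log_nonneg (by norm_num)
      nlinarith
    have h6 : (p : ℝ) ^ (-(1 - 1 / √L)) ≤ Real.exp 3 / p := by
      rw [show -(1 - 1 / √L) = 1 / √L - 1 by ring, Real.rpow_sub hp0, Real.rpow_one,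
        Real.rpow_def_of_pos hp0]
      gcongr
      rw [mul_one_div, div_le_iff₀ hsq0]
      exact hlogp
    have h7 : C₁ * Real.exp 3 ≤ c := Nat.le_ceil _
    calc 1 + C₁ * (p : ℝ) ^ (-(1 - 1 / √L)) ≤ 1 + C₁ * (Real.exp 3 / p) := by gcongr
      _ = 1 + C₁ * Real.exp 3 / p := by ring
      _ ≤ _ := by gcongr
  have hh' : (h : ℝ) ^ (1 - 1 / √L) ≤ h * (Real.exp 1 * Real.exp (-(√L / 4))) := by
    rw [Real.rpow_sub hhR, Real.rpow_one, div_eq_mul_inv, Real.rpow_def_of_pos hhR, ← Real.exp_neg,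
      ← Real.exp_add]
    gcongr
    have := sqrt_sub_le_log_div_sqrt hL1
    rw [mul_one_div, show Real.log h = L - 1 by rw [hL]; ring]
    linarith
  have hE := hexp L (by linarith)
  calc (h : ℝ) ^ (1 - 1 / √L) * ∏ p ∈ S, (1 + C₁ * (p : ℝ) ^ (-(1 - 1 / √L)))
      ≤ h * (Real.exp 1 * Real.exp (-(√L / 4))) * (C₂ * L ^ c) :=
        mul_le_mul hh' hP (Finset.prod_nonneg fun p _ => by positivity) (by positivity)
    _ = Real.exp 1 * C₂ * (L ^ (c + 1) * Real.exp (-(√L / 4))) * (h / L) := by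
        rw [pow_succ]
        field_simp
    _ ≤ Real.exp 1 * C₂ * C₃ * (h / L) := by gcongr

/-- The total error of one block of primes. -/
theorem block_error_le {s m j N h : ℕ} {L M : ℝ} (hL : 1 ≤ L) (hM : 1 ≤ M)
    (hN : N ≤ 16 ^ (j + 1)) :
    N * (4 * (s : ℝ) ^ 2 + 2 * s ^ 2 * (M * L) ^ m * (139 * (L * M) * (h / 16 ^ j) * (3 / 4) ^ j)
        + (18 * s ^ 2 * M) ^ (m + 1) * L ^ m * (h / 16 ^ j) / 16 ^ j)
      + min (N : ℝ) (8 ^ j) * (36 * s ^ 2 * M * (h / 16 ^ j))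
    ≤ 4 * s ^ 2 * N + h * ((4448 * s ^ 2 + 16 * (18 * s ^ 2) ^ (m + 1) + 36 * s ^ 2)
        * (M * L) ^ (m + 1)) * (3 / 4) ^ j := by
  have hN' : (N : ℝ) ≤ 16 * 16 ^ j := by
    have : N ≤ 16 * 16 ^ j := by rw [← pow_succ']; exact hN
    exact_mod_cast this
  have h16 : (0 : ℝ) < 16 ^ j := by positivity
  have hML : 1 ≤ M * L := one_le_mul_of_one_le_of_one_le hM hL
  set X : ℝ := (M * L) ^ (m + 1) with hX
  have hX0 : 0 ≤ X := by positivity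
  have a1 : (N : ℝ) * (2 * s ^ 2 * (M * L) ^ m * (139 * (L * M) * (h / 16 ^ j) * (3 / 4) ^ j))
      ≤ h * (4448 * s ^ 2 * X) * (3 / 4) ^ j := by
    calc _ ≤ (16 * 16 ^ j) * (2 * (s : ℝ) ^ 2 * (M * L) ^ m
          * (139 * (L * M) * (h / 16 ^ j) * (3 / 4) ^ j)) := by gcongr
      _ = _ := by rw [hX, pow_succ (M * L)]; field_simp; ring
  have a2 : (N : ℝ) * ((18 * s ^ 2 * M) ^ (m + 1) * L ^ m * (h / 16 ^ j) / 16 ^ j)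
      ≤ h * (16 * (18 * s ^ 2) ^ (m + 1) * X) * (3 / 4) ^ j := by
    have b1 : (1 / 16 : ℝ) ^ j ≤ (3 / 4) ^ j := pow_le_pow_left₀ (by norm_num) (by norm_num) j
    have b2 : L ^ m ≤ L ^ (m + 1) := pow_le_pow_right₀ hL (by omega)
    calc _ ≤ (16 * 16 ^ j) * ((18 * (s : ℝ) ^ 2 * M) ^ (m + 1) * L ^ (m + 1)
          * (h / 16 ^ j) / 16 ^ j) := by gcongr
      _ = h * (16 * (18 * s ^ 2) ^ (m + 1) * X) * (1 / 16) ^ j := by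
          rw [hX, mul_pow (18 * (s : ℝ) ^ 2) M, mul_pow M L, one_div, inv_pow]
          field_simp
      _ ≤ _ := by gcongr
  have a3 : min (N : ℝ) (8 ^ j) * (36 * s ^ 2 * M * (h / 16 ^ j))
      ≤ h * (36 * s ^ 2 * X) * (3 / 4) ^ j := by
    have b1 : (8 / 16 : ℝ) ^ j ≤ (3 / 4) ^ j := pow_le_pow_left₀ (by norm_num) (by norm_num) j
    have b2 : M ≤ X := (le_mul_of_one_le_right (by linarith) hL).trans
      (le_self_pow₀ hML (by omega))
    calc _ ≤ (8 : ℝ) ^ j * (36 * s ^ 2 * X * (h / 16 ^ j)) := by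
          gcongr
          exact min_le_right _ _
      _ = h * (36 * s ^ 2 * X) * (8 / 16) ^ j := by rw [div_pow]; ring
      _ ≤ _ := by gcongr
  linarith

set_option maxHeartbeats 1000000 in
/-- The moments for a set of primes not exceeding the length of the interval. -/
theorem exists_mean_siftDev_small_le (s m : ℕ) (hs : 1 ≤ s) (hm : 1 ≤ m) : ∃ C : ℝ, 1 ≤ C ∧
    ∀ (Ω : (p : ℕ) → Finset (ZMod p)) (h : ℕ), 0 < h → ∀ S : Finset ℕ,
      (∀ p ∈ S, IsSmallPrime Ω s h p) →
      mean (∏ l ∈ S, l) (fun n => siftDev S Ω 1 h n ^ (2 * (m + 1)))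
        ≤ (C * (h * varFactor S Ω + h / (1 + Real.log h))) ^ (m + 1) := by
  obtain ⟨C₀, hC₀, hstart⟩ := exists_mean_siftDev_verySmall_le s m hs
  obtain ⟨C₁, c, hC₁, heuler⟩ := exists_eulerBound s m hs hm
  obtain ⟨C₂, hC₂, hexp⟩ := exists_pow_mul_exp_neg_sqrt_le ((c + 1) * (m + 1) + 1)
  set G : ℝ := (2 * s : ℝ) ^ (2 * m) * 4 ^ (m + 1) with hG
  have hG0 : 0 ≤ G := by positivity
  set K : ℝ := G * (16 * s ^ 2) with hK
  set Y : ℝ := 4448 * s ^ 2 + 16 * (18 * s ^ 2) ^ (m + 1) + 36 * s ^ 2 with hY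
  have hY0 : 0 ≤ Y := by positivity
  have hK0 : 0 ≤ K := by positivity
  set E : ℝ := C₀ + G * (36 * s ^ 2) + 8 * G * Y * C₁ ^ (m + 1) * C₂ with hE
  have hE1 : 1 ≤ E := by
    have : 0 ≤ G * (36 * (s : ℝ) ^ 2) + 8 * G * Y * C₁ ^ (m + 1) * C₂ := by positivity
    rw [hE]; linarith
  refine ⟨K + E, by linarith, fun Ω h hh S hS => ?_⟩
  have hhR : (0 : ℝ) < h := by exact_mod_cast hh
  have hlog : 0 ≤ Real.log h := Real.log_natCast_nonneg h
  set L := 1 + Real.log h with hL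
  have hL1 : 1 ≤ L := by linarith
  have hL0 : 0 < L := by linarith
  set M := C₁ * L ^ c with hM
  have hMb := heuler Ω h hh
  rw [← hL, ← hM] at hMb
  have hM1 := hMb.one_le
  set j₀ := ⌊√L⌋₊ with hj₀
  set W : ℝ := G * (Y * (M * L) ^ (m + 1)) with hW
  have hW0 : 0 ≤ W := by positivity
  -- Induction over the blocks from `j₀` on. The last term is the partial sum of the geometric
  -- series ∑ (3/4)^j from j₀ to j₀ + i - 1, and the cardinality term collects the cost 4s² of each
  -- prime.
  have key : ∀ i : ℕ, mean (∏ l ∈ S.filter (· < 16 ^ (j₀ + i)), l)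
      (fun n => siftDev (S.filter (· < 16 ^ (j₀ + i))) Ω 1 h n ^ (2 * (m + 1)))
      ≤ (K * (h * varFactor (S.filter (· < 16 ^ (j₀ + i))) Ω)
        + (C₀ * (h / L) + G * (4 * s ^ 2) * (S.filter (· < 16 ^ (j₀ + i))).card
          + h * W * (4 * (3 / 4) ^ j₀ - 4 * (3 / 4) ^ (j₀ + i)))) ^ (m + 1) := by
    intro i
    induction i with
    | zero =>
      refine (hstart Ω h hh _ fun p hp => ?_).trans ?_
      · rw [Finset.mem_filter] at hp
        exact ⟨hS p hp.1, hp.2⟩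
      · have hV := varFactor_nonneg (S := S.filter (· < 16 ^ (j₀ + 0))) (Ω := Ω)
        refine pow_le_pow_left₀ (by positivity) ?_ _
        rw [add_zero, sub_self, mul_zero, add_zero]
        rw [add_zero] at hV
        have a1 : 0 ≤ K * (h * varFactor (S.filter (· < 16 ^ j₀)) Ω) := by positivity
        have a2 : 0 ≤ G * (4 * (s : ℝ) ^ 2) * (S.filter (· < 16 ^ j₀)).card := by positivity
        linarith
    | succ i ih =>
      set A := S.filter (· < 16 ^ (j₀ + i)) with hA
      set A' := S.filter (· < 16 ^ (j₀ + (i + 1))) with hA'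
      set R := A' \ A with hR
      have hsub : A ⊆ A' := fun p hp => by
        rw [hA, Finset.mem_filter] at hp
        rw [hA', Finset.mem_filter]
        exact ⟨hp.1, hp.2.trans_le (Nat.pow_le_pow_right (by norm_num) (by omega))⟩
      have hRA : R ∪ A = A' := Finset.sdiff_union_of_subset hsub
      have hcard : R.card + A.card = A'.card := Finset.card_sdiff_add_card_eq_card hsub
      have hRmem : ∀ p ∈ R, IsSmallPrime Ω s h p ∧ p ∉ A ∧ 16 ^ (j₀ + i) ≤ p ∧
          p < 16 ^ (j₀ + i + 1) := fun p hp => by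
        rw [hR, Finset.mem_sdiff] at hp
        have h1 := hp.1
        rw [hA', Finset.mem_filter] at h1
        refine ⟨hS p h1.1, hp.2, ?_, h1.2⟩
        by_contra hcon
        exact hp.2 (by rw [hA, Finset.mem_filter]; exact ⟨h1.1, by omega⟩)
      have hRcard : R.card ≤ 16 ^ (j₀ + i + 1) := by
        have : R ⊆ Finset.range (16 ^ (j₀ + i + 1)) := fun p hp =>
          Finset.mem_range.mpr (hRmem p hp).2.2.2
        simpa using Finset.card_le_card this
      have hpow : ((3 : ℝ) / 4) ^ (j₀ + i) ≤ (3 / 4) ^ j₀ :=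
        pow_le_pow_of_le_one (by norm_num) (by norm_num) (by omega)
      set Z : ℝ := C₀ * (h / L) + G * (4 * s ^ 2) * A.card
          + h * W * (4 * (3 / 4) ^ j₀ - 4 * (3 / 4) ^ (j₀ + i)) with hZ
      have hZL : h ≤ L * Z := by
        have a1 : 0 ≤ G * (4 * (s : ℝ) ^ 2) * A.card := by positivity
        have a2 : 0 ≤ h * W * (4 * (3 / 4) ^ j₀ - 4 * (3 / 4) ^ (j₀ + i)) :=
          mul_nonneg (by positivity) (by linarith)
        have a3 : h / L ≤ Z := by
          have : h / L ≤ C₀ * (h / L) := le_mul_of_one_le_left (by positivity) hC₀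
          linarith
        rw [div_le_iff₀ hL0] at a3
        linarith
      have hblk := mean_siftDev_block_le hs hm (j := j₀ + i) hL hh hMb hK.ge R.card A R Z rfl
        (fun p hp => hS p (Finset.mem_filter.mp hp).1) hRmem hZL ih
      rw [hRA] at hblk
      refine hblk.trans ?_
      have hV := varFactor_nonneg (S := A') (Ω := Ω)
      have hZ0 : 0 ≤ Z := by
        by_contra hcon
        nlinarith
      have herr := mul_le_mul_of_nonneg_left
        (block_error_le (s := s) (m := m) (h := h) hL1 hM1 hRcard) hG0
      refine pow_le_pow_left₀ ?_ ?_ _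
      · have : 0 ≤ min (R.card : ℝ) (8 ^ (j₀ + i)) := by positivity
        positivity
      · rw [← hY] at herr
        have e : (A'.card : ℝ) = R.card + A.card := by exact_mod_cast hcard.symm
        have e3 : ((3 : ℝ) / 4) ^ (j₀ + (i + 1)) = (3 / 4) ^ (j₀ + i) * (3 / 4) := by
          rw [← add_assoc, pow_succ]
        rw [e, e3]
        refine (add_le_add_right (add_le_add_right herr Z) _).trans_eq ?_
        rw [hZ, hW]
        ring
  -- Since h < 16^h, after h blocks every prime has been inserted.
  have hfull : S.filter (· < 16 ^ (j₀ + h)) = S := by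
    refine Finset.filter_true_of_mem fun p hp => (hS p hp).2.1.trans_lt ?_
    calc h < 16 ^ h := Nat.lt_pow_self (by norm_num)
      _ ≤ _ := Nat.pow_le_pow_right (by norm_num) (by omega)
  have hfin := key h
  rw [hfull] at hfin
  refine hfin.trans ?_
  have hV := varFactor_nonneg (S := S) (Ω := Ω)
  have hpow : ((3 : ℝ) / 4) ^ (j₀ + h) ≤ (3 / 4) ^ j₀ :=
    pow_le_pow_of_le_one (by norm_num) (by norm_num) (by omega)
  have hpow0 : 0 ≤ ((3 : ℝ) / 4) ^ (j₀ + h) := by positivity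
  refine pow_le_pow_left₀ (add_nonneg (by positivity) (add_nonneg (by positivity)
    (mul_nonneg (by positivity) (by linarith)))) ?_ _
  have hcard : (S.card : ℝ) ≤ 9 * (h / L) := by
    have := card_primes_mul_log_le hh fun p hp => ⟨(hS p hp).1, (hS p hp).2.1⟩
    rw [← mul_div_assoc, le_div_iff₀ hL0]
    exact this
  -- From 3/4 ≤ e^(-1/4) and j₀ > √L - 1.
  have hdecay : ((3 : ℝ) / 4) ^ j₀ ≤ 2 * Real.exp (-(√L / 4)) := by
    have h1 : (3 : ℝ) / 4 ≤ Real.exp (-(1 / 4)) := by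
      have := Real.add_one_le_exp (-(1 / 4) : ℝ)
      linarith
    have h2 : √L < j₀ + 1 := Nat.lt_floor_add_one _
    have h3 : Real.exp (1 / 4) ≤ 2 := by
      have := Real.exp_bound_div_one_sub_of_interval (x := 1 / 4) (by norm_num) (by norm_num)
      norm_num at this ⊢
      linarith
    calc ((3 : ℝ) / 4) ^ j₀ ≤ Real.exp (-(1 / 4)) ^ j₀ := pow_le_pow_left₀ (by norm_num) h1 _
      _ = Real.exp (j₀ * -(1 / 4)) := (Real.exp_nat_mul _ _).symm
      _ ≤ Real.exp (1 / 4 + -(√L / 4)) := by gcongr; linarith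
      _ = Real.exp (1 / 4) * Real.exp (-(√L / 4)) := Real.exp_add _ _
      _ ≤ _ := by gcongr
  have hWle : W * (3 / 4) ^ j₀ ≤ 2 * G * Y * C₁ ^ (m + 1) * C₂ / L := by
    have h1 := hexp L hL0.le
    rw [le_div_iff₀ hL0]
    calc W * (3 / 4) ^ j₀ * L ≤ W * (2 * Real.exp (-(√L / 4))) * L := by gcongr
      _ = 2 * G * Y * C₁ ^ (m + 1) * (L ^ ((c + 1) * (m + 1) + 1) * Real.exp (-(√L / 4))) := by
          rw [hW, hM, mul_assoc C₁, ← pow_succ, mul_pow C₁, ← pow_mul L, pow_succ L ((c + 1) * (m + 1))]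
          ring
      _ ≤ _ := by gcongr
  have h4 : h * W * (4 * (3 / 4) ^ j₀ - 4 * (3 / 4) ^ (j₀ + h))
      ≤ 8 * G * Y * C₁ ^ (m + 1) * C₂ * (h / L) := by
    calc _ ≤ h * W * (4 * (3 / 4) ^ j₀) := by gcongr; linarith
      _ = 4 * h * (W * (3 / 4) ^ j₀) := by ring
      _ ≤ 4 * h * (2 * G * Y * C₁ ^ (m + 1) * C₂ / L) := by gcongr
      _ = _ := by ring
  have h5 : G * (4 * (s : ℝ) ^ 2) * S.card ≤ G * (36 * s ^ 2) * (h / L) := by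
    calc _ ≤ G * (4 * (s : ℝ) ^ 2) * (9 * (h / L)) := by gcongr
      _ = _ := by ring
  have h6 : 0 ≤ h / L := by positivity
  have h7 : 0 ≤ h * varFactor S Ω := by positivity
  have h8 : C₀ * (h / L) + G * (36 * s ^ 2) * (h / L) + 8 * G * Y * C₁ ^ (m + 1) * C₂ * (h / L)
      = E * (h / L) := by rw [hE]; ring
  have h9 : 0 ≤ K * (h / L) := by positivity
  have h10 : 0 ≤ E * (h * varFactor S Ω) := mul_nonneg (by linarith) h7
  linarith

end smallPrimes

/-! ### From tuples to the sieve, and their Euler products -/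

/-- Local factors agreeing up to O(1/p²) have comparable products, since ∑ 1/p² converges; the
constant is uniform in the set of primes. -/
theorem exists_prod_le_mul_prod (c : ℝ) (hc : 0 ≤ c) : ∃ A : ℝ, 1 ≤ A ∧
    ∀ (T : Finset ℕ) (f g : ℕ → ℝ), (∀ p ∈ T, 0 ≤ f p ∧ 0 ≤ g p ∧ f p ≤ (1 + c / p ^ 2) * g p) →
      ∏ p ∈ T, f p ≤ A * ∏ p ∈ T, g p := by
  have hsum : Summable fun n : ℕ => 1 / (n : ℝ) ^ 2 := Real.summable_one_div_nat_pow.mpr (by norm_num)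
  have h0 : ∀ n : ℕ, 0 ≤ 1 / (n : ℝ) ^ 2 := fun n => by positivity
  refine ⟨Real.exp (c * ∑' n : ℕ, 1 / (n : ℝ) ^ 2),
    Real.one_le_exp (mul_nonneg hc (tsum_nonneg h0)), fun T f g hfg => ?_⟩
  refine (Finset.prod_le_prod (fun p hp => (hfg p hp).1) fun p hp => (hfg p hp).2.2).trans ?_
  rw [Finset.prod_mul_distrib]
  refine mul_le_mul_of_nonneg_right ?_ (Finset.prod_nonneg fun p hp => (hfg p hp).2.1)
  calc ∏ p ∈ T, (1 + c / (p : ℝ) ^ 2) ≤ ∏ p ∈ T, Real.exp (c * (1 / (p : ℝ) ^ 2)) := by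
        refine Finset.prod_le_prod (fun p _ => by positivity) fun p _ => ?_
        have := Real.add_one_le_exp (c * (1 / (p : ℝ) ^ 2))
        rw [mul_one_div] at this ⊢
        linarith
    _ = Real.exp (c * ∑ p ∈ T, 1 / (p : ℝ) ^ 2) := by rw [← Real.exp_sum, Finset.mul_sum]
    _ ≤ _ := by
        gcongr
        exact hsum.sum_le_tsum T fun n _ => h0 n

section tuples

variable {D : Finset ℤ} {p : ℕ}

/-- The residue classes of `n` modulo `p` for which some `n + d`, `d ∈ D`, is divisible by `p`. -/
def negClasses (D : Finset ℤ) (p : ℕ) : Finset (ZMod p) := D.image fun d : ℤ => -(d : ZMod p)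

theorem card_negClasses (D : Finset ℤ) (p : ℕ) : (negClasses D p).card = residueCount D p := by
  have : negClasses D p = (D.image fun d : ℤ => (d : ZMod p)).image fun x => -x := by
    rw [negClasses, Finset.image_image]; rfl
  rw [this, Finset.card_image_of_injective _ neg_injective, residueCount]

theorem residueCount_le (D : Finset ℤ) (p : ℕ) : residueCount D p ≤ D.card := Finset.card_image_le

theorem one_le_residueCount (hD : D.Nonempty) (p : ℕ) : 1 ≤ residueCount D p :=
  Finset.card_pos.mpr (hD.image _)

theorem exists_residueCount_eq (D : Finset ℤ) : ∃ p₀ : ℕ, ∀ p : ℕ, p₀ < p →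
    residueCount D p = D.card := by
  refine ⟨∑ d ∈ D, 2 * d.natAbs, fun p hp => Finset.card_image_of_injOn fun a ha b hb hab => ?_⟩
  have ha' : 2 * a.natAbs < p :=
    (Finset.single_le_sum (f := fun d : ℤ => 2 * d.natAbs) (fun _ _ => Nat.zero_le _) ha).trans_lt hp
  have hb' : 2 * b.natAbs < p :=
    (Finset.single_le_sum (f := fun d : ℤ => 2 * d.natAbs) (fun _ _ => Nat.zero_le _) hb).trans_lt hp
  replace hab := (ZMod.intCast_eq_intCast_iff_dvd_sub a b p).mp hab
  have := Int.eq_zero_of_dvd_of_natAbs_lt_natAbs hab (by omega)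
  omega

/-- Admissibility enters through this bound: for p ≤ 2s the missed class gives 1 - ν_p/p ≥ 1/p ≥
1/(2s), and for p > 2s the bound ν_p ≤ s gives at least 1/2. -/
theorem one_div_le_one_sub_residueCount (hne : D.Nonempty) (hD : Admissible D) (hp : p.Prime) :
    (1 : ℝ) / (2 * D.card) ≤ 1 - (residueCount D p : ℝ) / p := by
  have hs : (1 : ℝ) ≤ D.card := by exact_mod_cast hne.card_pos
  have hp0 : (0 : ℝ) < p := by exact_mod_cast hp.pos
  have h1 : (residueCount D p : ℝ) + 1 ≤ p := by exact_mod_cast hD p hp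
  have h2 : (residueCount D p : ℝ) ≤ D.card := by exact_mod_cast residueCount_le D p
  rw [div_le_iff₀ (by positivity), one_sub_div hp0.ne', div_mul_eq_mul_div, le_div_iff₀ hp0]
  rcases le_or_gt (p : ℝ) (2 * D.card) with h | h <;> nlinarith

/-- The proportion of integers coprime to all primes of `T`. -/
noncomputable def coprimeDensity (T : Finset ℕ) : ℝ := ∏ p ∈ T, (1 - 1 / (p : ℝ))

theorem half_le_one_sub_inv (hp : p.Prime) : (1 : ℝ) / 2 ≤ 1 - 1 / p := by
  have : (2 : ℝ) ≤ p := by exact_mod_cast hp.two_le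
  have : (1 : ℝ) / p ≤ 1 / 2 := one_div_le_one_div_of_le (by norm_num) this
  linarith

theorem coprimeDensity_pos {T : Finset ℕ} (hT : ∀ p ∈ T, p.Prime) : 0 < coprimeDensity T :=
  Finset.prod_pos fun p hp => by linarith [half_le_one_sub_inv (hT p hp)]

theorem coprimeDensity_le_one {T : Finset ℕ} (hT : ∀ p ∈ T, p.Prime) : coprimeDensity T ≤ 1 :=
  Finset.prod_le_one (fun p hp => by linarith [half_le_one_sub_inv (hT p hp)]) fun p _ =>
    sub_le_self _ (by positivity)

theorem reducedDensity_eq {q : ℕ} (hq : 0 < q) : reducedDensity q = coprimeDensity q.primeFactors := by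
  have h := Nat.totient_eq_mul_prod_factors q
  have hq' : (q : ℝ) ≠ 0 := by exact_mod_cast hq.ne'
  have h' : (Nat.totient q : ℝ) = q * ∏ p ∈ q.primeFactors, (1 - (p : ℝ)⁻¹) := by
    have := congrArg (fun x : ℚ => (x : ℝ)) h
    push_cast at this
    exact this
  rw [reducedDensity, h', mul_div_cancel_left₀ _ hq', coprimeDensity]
  simp only [one_div]

/-- For large p the count ν_p equals s and Bernoulli gives 1 - s/p ≤ (1 - 1/p)^s. The finitely many
small primes go into the constant. -/
theorem exists_siftDensity_le (D : Finset ℤ) : ∃ C : ℝ, 1 ≤ C ∧ ∀ T : Finset ℕ, (∀ p ∈ T, p.Prime) →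
    siftDensity T (negClasses D) ≤ C * coprimeDensity T ^ D.card := by
  obtain ⟨p₀, hp₀⟩ := exists_residueCount_eq D
  set s := D.card with hs
  obtain ⟨C, hC, hprod⟩ := exists_prod_le_mul_prod (p₀ ^ 2 * 2 ^ s) (by positivity)
  refine ⟨C, hC, fun T hT => ?_⟩
  rw [coprimeDensity, ← Finset.prod_pow]
  refine hprod T _ _ fun p hp => ⟨sub_nonneg.mpr (card_div_le_one (hT p hp).pos), ?_, ?_⟩
  · have := half_le_one_sub_inv (hT p hp)
    exact pow_nonneg (by linarith) _
  have hp0 : (0 : ℝ) < p := by exact_mod_cast (hT p hp).pos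
  have hhalf := half_le_one_sub_inv (hT p hp)
  rw [card_negClasses]
  rcases le_or_gt p p₀ with h | h
  · have hpp : (p : ℝ) ≤ p₀ := by exact_mod_cast h
    calc 1 - (residueCount D p : ℝ) / p ≤ 1 := sub_le_self _ (by positivity)
      _ = 2 ^ s * (1 / 2) ^ s := by rw [← mul_pow]; norm_num
      _ ≤ (1 + p₀ ^ 2 * 2 ^ s / p ^ 2) * (1 - 1 / p) ^ s := by
          refine mul_le_mul ?_ (pow_le_pow_left₀ (by norm_num) hhalf s) (by positivity) (by positivity)
          have : (2 : ℝ) ^ s ≤ p₀ ^ 2 * 2 ^ s / p ^ 2 := by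
            rw [le_div_iff₀ (by positivity), mul_comm]
            gcongr
          linarith
  · rw [hp₀ p h]
    have h1 := one_add_mul_le_pow (a := -(1 / (p : ℝ))) (by linarith) s
    calc 1 - (s : ℝ) / p = 1 + s * -(1 / (p : ℝ)) := by ring
      _ ≤ (1 + -(1 / (p : ℝ))) ^ s := h1
      _ = (1 - 1 / (p : ℝ)) ^ s := by rw [← sub_eq_add_neg]
      _ ≤ _ := by
          refine le_mul_of_one_le_left (pow_nonneg (by linarith) _) ?_
          have : (0 : ℝ) ≤ p₀ ^ 2 * 2 ^ s / p ^ 2 := by positivity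
          linarith

/-- For large p the local factor s²/p + (1 - s/p)² and (1 - 1/p)^(2s - s²) agree to first order in
1/p, so only O(1/p²) is lost. The exponent is split into 2s and -s², because 2s - s² may be
negative. -/
theorem exists_varFactor_le (D : Finset ℤ) : ∃ C : ℝ, 1 ≤ C ∧ ∀ T : Finset ℕ, (∀ p ∈ T, p.Prime) →
    varFactor T (negClasses D)
      ≤ C * (coprimeDensity T ^ (2 * D.card) * (coprimeDensity T)⁻¹ ^ (D.card ^ 2)) := by
  obtain ⟨p₀, hp₀⟩ := exists_residueCount_eq D
  set s := D.card with hs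
  -- Beyond N the elements of D are distinct modulo p and s/p ≤ 1/4, which keeps the first-order
  -- comparison at least 1/2; below N the first part of c absorbs everything.
  set N : ℝ := p₀ + 4 * s with hN
  set c : ℝ := N ^ 2 * ((1 + s ^ 2) * 2 ^ (2 * s)) + 2 * (s ^ 2 + 2 * s ^ 3) with hc
  obtain ⟨C, hC, hprod⟩ := exists_prod_le_mul_prod c (by positivity)
  refine ⟨C, hC, fun T hT => ?_⟩
  rw [coprimeDensity, ← Finset.prod_pow, ← Finset.prod_inv_distrib, ← Finset.prod_pow,
    ← Finset.prod_mul_distrib]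
  refine hprod T _ _ fun p hp => ?_
  have hp1 : (1 : ℝ) ≤ p := by exact_mod_cast (hT p hp).one_le
  have hp0 : (0 : ℝ) < p := by linarith
  have hhalf := half_le_one_sub_inv (hT p hp)
  set x := 1 - 1 / (p : ℝ) with hx
  have hx0 : 0 < x := by linarith
  have hx1 : x ≤ 1 := sub_le_self _ (by positivity)
  have hinv1 : 1 ≤ x⁻¹ := (one_le_inv₀ hx0).mpr hx1
  refine ⟨by positivity, by positivity, ?_⟩
  rw [card_negClasses]
  rcases le_or_gt (p : ℝ) N with h | h
  · have hle : (residueCount D p : ℝ) ≤ s := by exact_mod_cast residueCount_le D p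
    have h1 : (residueCount D p : ℝ) ^ 2 / p ≤ s ^ 2 := by
      calc (residueCount D p : ℝ) ^ 2 / p ≤ (residueCount D p : ℝ) ^ 2 :=
            div_le_self (by positivity) hp1
        _ ≤ _ := by gcongr
    have h2 : (1 - (residueCount D p : ℝ) / p) ^ 2 ≤ 1 := by
      have a1 := card_div_le_one (Ω := negClasses D) (hT p hp).pos
      rw [card_negClasses] at a1
      exact pow_le_one₀ (by linarith) (sub_le_self _ (by positivity))
    have h3 : (1 + (s : ℝ) ^ 2) * 2 ^ (2 * s) ≤ 1 + c / p ^ 2 := by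
      have : (1 + (s : ℝ) ^ 2) * 2 ^ (2 * s) ≤ c / p ^ 2 := by
        rw [le_div_iff₀ (by positivity), hc, mul_comm]
        have a1 : (p : ℝ) ^ 2 * ((1 + (s : ℝ) ^ 2) * 2 ^ (2 * s))
            ≤ N ^ 2 * ((1 + s ^ 2) * 2 ^ (2 * s)) := by gcongr
        have a2 : 0 ≤ 2 * ((s : ℝ) ^ 2 + 2 * s ^ 3) := by positivity
        linarith
      linarith
    calc (residueCount D p : ℝ) ^ 2 / p + (1 - (residueCount D p : ℝ) / p) ^ 2
        ≤ 1 + (s : ℝ) ^ 2 := by linarith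
      _ = (1 + (s : ℝ) ^ 2) * 2 ^ (2 * s) * ((1 / 2) ^ (2 * s) * 1) := by
          rw [mul_one, mul_assoc, ← mul_pow]; norm_num
      _ ≤ (1 + c / p ^ 2) * (x ^ (2 * s) * x⁻¹ ^ (s ^ 2)) := by
          refine mul_le_mul h3 (mul_le_mul (pow_le_pow_left₀ (by norm_num) hhalf _)
            (one_le_pow₀ hinv1) zero_le_one (by positivity)) (by positivity) (by positivity)
  · have hs4 : 4 * (s : ℝ) ≤ p := by
      have : (0 : ℝ) ≤ p₀ := by positivity
      linarith
    rw [hp₀ p (by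
      have : (p₀ : ℝ) < p := by
        have : (0 : ℝ) ≤ 4 * s := by positivity
        linarith
      exact_mod_cast this)]
    have a1 : 1 - 2 * s / p ≤ x ^ (2 * s) := by
      have := one_add_mul_le_pow (a := -(1 / (p : ℝ))) (by linarith) (2 * s)
      rw [← sub_eq_add_neg, ← hx] at this
      refine le_trans (le_of_eq ?_) this
      push_cast
      ring
    have a2 : 1 + s ^ 2 / p ≤ x⁻¹ ^ (s ^ 2) := by
      have b1 : 1 + 1 / (p : ℝ) ≤ x⁻¹ := by
        rw [le_inv_comm₀ (by positivity) hx0, hx]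
        rw [← one_div, le_div_iff₀ (by positivity)]
        have : 0 ≤ 1 / (p : ℝ) * (1 / p) := by positivity
        linarith
      have := one_add_mul_le_pow (a := 1 / (p : ℝ)) (by linarith [show 0 ≤ 1 / (p : ℝ) by positivity])
        (s ^ 2)
      refine le_trans (le_of_eq ?_) (this.trans (pow_le_pow_left₀ (by positivity) b1 _))
      push_cast
      ring
    set u : ℝ := s / p with hu
    have hu0 : 0 ≤ u := by positivity
    have hu4 : u ≤ 1 / 4 := by rw [hu, div_le_iff₀ hp0]; linarith
    set w : ℝ := s ^ 2 / p with hw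
    have hw0 : 0 ≤ w := by positivity
    have e2 : 2 * (s : ℝ) / p = 2 * u := by rw [hu]; ring
    rw [e2] at a1
    have a3 : (1 - 2 * u) * (1 + w) ≤ x ^ (2 * s) * x⁻¹ ^ (s ^ 2) :=
      mul_le_mul a1 a2 (by linarith) (by positivity)
    have a4 : 2 * (u ^ 2 + 2 * u * w) ≤ c / p ^ 2 := by
      rw [le_div_iff₀ (by positivity), hc]
      have b1 : 2 * (u ^ 2 + 2 * u * w) * (p : ℝ) ^ 2 = 2 * (s ^ 2 + 2 * s ^ 3) := by
        rw [hu, hw]; field_simp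
      rw [b1]
      have : 0 ≤ N ^ 2 * ((1 + (s : ℝ) ^ 2) * 2 ^ (2 * s)) := by positivity
      linarith
    have a5 : (1 : ℝ) / 2 ≤ (1 - 2 * u) * (1 + w) := by nlinarith
    have hc0 : 0 ≤ c / p ^ 2 := by positivity
    calc w + (1 - u) ^ 2 = (1 - 2 * u) * (1 + w) + 2 * (u ^ 2 + 2 * u * w) * (1 / 2) := by ring
      _ ≤ (1 - 2 * u) * (1 + w) + c / p ^ 2 * ((1 - 2 * u) * (1 + w)) := by
          refine add_le_add_right (mul_le_mul a4 a5 (by norm_num) hc0) _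
      _ = (1 + c / p ^ 2) * ((1 - 2 * u) * (1 + w)) := by ring
      _ ≤ _ := mul_le_mul_of_nonneg_left a3 (by linarith)

theorem gcd_eq_one_iff_primeFactors {q : ℕ} (hq : 0 < q) (m : ℤ) :
    Int.gcd m q = 1 ↔ ∀ p ∈ q.primeFactors, (m : ZMod p) ≠ 0 := by
  have h : ∀ p : ℕ, (m : ZMod p) = 0 ↔ p ∣ m.natAbs := fun p => by
    rw [ZMod.intCast_zmod_eq_zero_iff_dvd, Int.natCast_dvd]
  simp only [ne_eq, h]
  change Nat.Coprime m.natAbs q ↔ _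
  rw [← not_iff_not, Nat.Prime.not_coprime_iff_dvd]
  push Not
  refine exists_congr fun p => ?_
  rw [Nat.mem_primeFactors]
  exact ⟨fun ⟨h1, h2, h3⟩ => ⟨⟨h1, h3, hq.ne'⟩, h2⟩, fun ⟨⟨h1, h3, _⟩, h2⟩ => ⟨h1, h2, h3⟩⟩

theorem prod_coprimeIndicator {q : ℕ} (hq : 0 < q) (n : ℤ) :
    ∏ d ∈ D, coprimeIndicator q (n + d) = sift q.primeFactors (negClasses D) n := by
  unfold coprimeIndicator sift
  simp only [← ite_not (p := _ ∈ _)]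
  rw [Finset.prod_ite_zero, Finset.prod_ite_zero]
  simp only [Finset.prod_const_one]
  congr 1
  rw [eq_iff_iff]
  simp only [gcd_eq_one_iff_primeFactors hq, negClasses, Finset.mem_image, not_exists, not_and]
  refine ⟨fun h p hp d hd he => h d hd p hp ?_, fun h d hd p hp he => h p hp d hd ?_⟩
  · push_cast
    rw [← he, neg_add_cancel]
  · push_cast at he
    exact (eq_neg_of_add_eq_zero_left he).symm

theorem tupleCount_sub_eq {q : ℕ} (hq : 0 < q) (h : ℕ) (n : ℤ) :
    tupleCount D q h n - h * tupleDensity D q = siftDev q.primeFactors (negClasses D) 1 h n := by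
  rw [siftDev, siftDensity, tupleDensity, tupleCount, siftCount]
  simp only [card_negClasses, prod_coprimeIndicator hq, Nat.cast_one, one_mul]

/-- Coprimality to q depends only on the primes dividing q, so the sum over a period q reduces to an
average over the radical of q. -/
theorem tupleMoment_eq {q : ℕ} (hq : 0 < q) (k h : ℕ) :
    tupleMoment D k q h = q * mean (∏ p ∈ q.primeFactors, p)
      (fun n => siftDev q.primeFactors (negClasses D) 1 h n ^ k) := by
  have hq' : (q : ℝ) ≠ 0 := by exact_mod_cast hq.ne'
  have hdvd := Nat.prod_primeFactors_dvd q
  have hb : 0 < q / ∏ p ∈ q.primeFactors, p :=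
    Nat.div_pos (Nat.le_of_dvd hq hdvd) (Nat.pos_of_dvd_of_pos hdvd hq)
  have h1 := mean_mul_of_periodic
    (siftDev_pow_periodic (S := q.primeFactors) (Ω := negClasses D) (h := h) 1 k) hb
  rw [Nat.mul_div_cancel' hdvd] at h1
  rw [← h1, tupleMoment, mean, mul_div_cancel₀ _ hq']
  exact Finset.sum_congr rfl fun n _ => by rw [tupleCount_sub_eq hq]

end tuples

/-! ### Moment bounds in terms of P and of the small primes -/

section moments

variable {D : Finset ℤ} {p h : ℕ}

theorem isSmallPrime_negClasses (hne : D.Nonempty) (hD : Admissible D) (hp : p.Prime) (hph : p ≤ h) :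
    IsSmallPrime (negClasses D) D.card h p := by
  refine ⟨hp, hph, ?_, ?_, ?_⟩ <;> rw [card_negClasses]
  · exact residueCount_le D p
  · exact one_le_residueCount hne p
  · exact one_div_le_one_sub_residueCount hne hD hp

theorem filter_not_union_filter (S : Finset ℕ) (h : ℕ) :
    S.filter (¬ · ≤ h) ∪ S.filter (· ≤ h) = S := by
  rw [Finset.union_comm, Finset.filter_union_filter_not_eq]

theorem coprimeDensity_filter_mul (S : Finset ℕ) (h : ℕ) :
    coprimeDensity (S.filter (¬ · ≤ h)) * coprimeDensity (S.filter (· ≤ h)) = coprimeDensity S := by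
  rw [mul_comm]
  exact Finset.prod_filter_mul_prod_filter_not S (· ≤ h) fun p => 1 - 1 / (p : ℝ)

/-- The inverse of the density of the integers free of small primes is at most logarithmic. -/
theorem exists_inv_coprimeDensity_le : ∃ C : ℝ, 1 ≤ C ∧ ∀ h : ℕ, 0 < h → ∀ S : Finset ℕ,
    (∀ p ∈ S, p.Prime) → (coprimeDensity (S.filter (· ≤ h)))⁻¹ ≤ C * (1 + Real.log h) := by
  obtain ⟨C, hC, hmain⟩ := exists_prod_inv_one_sub_le
  refine ⟨C, hC, fun h hh S hS => ?_⟩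
  rw [coprimeDensity, ← Finset.prod_inv_distrib]
  exact hmain h hh _ fun p hp => ⟨hS p (Finset.mem_filter.mp hp).1, (Finset.mem_filter.mp hp).2⟩

/-- The bound for the variance that comes from all primes of `S`, when the primes `≤ h` are treated
as small. -/
noncomputable def mainFactor (S : Finset ℕ) (s h : ℕ) : ℝ :=
  coprimeDensity S ^ (2 * s) * (coprimeDensity (S.filter (· ≤ h)))⁻¹ ^ (s ^ 2)

/-- The primes p ≤ h give the starting moment, governed by the variance Euler product, and the
primes p > h are then added. They multiply the square of that bound by the squared density of the
large primes and add a term of the size of the expected count. -/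
theorem exists_mean_siftDev_pow_le_mainFactor (hne : D.Nonempty) (hD : Admissible D) {m : ℕ}
    (hm : 1 ≤ m) : ∃ C : ℝ, 1 ≤ C ∧ ∀ h : ℕ, 0 < h → ∀ S : Finset ℕ, (∀ p ∈ S, p.Prime) →
      mean (∏ p ∈ S, p) (fun n => siftDev S (negClasses D) 1 h n ^ (2 * (m + 1)))
        ≤ (C * (h * mainFactor S D.card h + max (h * coprimeDensity S ^ D.card) 1)) ^ (m + 1) := by
  have hs : 1 ≤ D.card := hne.card_pos
  obtain ⟨C₁, hC₁, hsmall⟩ := exists_mean_siftDev_small_le D.card m hs hm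
  obtain ⟨C₂, hC₂, hvar⟩ := exists_varFactor_le D
  obtain ⟨C₃, hC₃, hmert⟩ := exists_inv_coprimeDensity_le
  obtain ⟨C₄, hC₄, hdens⟩ := exists_siftDensity_le D
  obtain ⟨K, hK, hlarge⟩ := exists_mean_siftDev_pow_union_le D.card m hs
  set s := D.card with hsD
  refine ⟨2 * C₄ ^ 2 * (C₁ * (C₂ + C₃)) + 2 * K ^ 2 * C₄, ?_, fun h hh S hS => ?_⟩
  · have h1 : 1 ≤ K ^ 2 * C₄ := one_le_mul_of_one_le_of_one_le (one_le_pow₀ hK) hC₄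
    have h2 : 0 ≤ 2 * C₄ ^ 2 * (C₁ * (C₂ + C₃)) := by positivity
    linarith
  have hhR : (0 : ℝ) < h := by exact_mod_cast hh
  have hlog : 0 ≤ Real.log h := Real.log_natCast_nonneg h
  set S₁ := S.filter (· ≤ h) with hS₁
  set S₂ := S.filter (¬ · ≤ h) with hS₂
  have hp₁ : ∀ p ∈ S₁, p.Prime := fun p hp => hS p (Finset.mem_filter.mp hp).1
  have hp₂ : ∀ p ∈ S₂, p.Prime := fun p hp => hS p (Finset.mem_filter.mp hp).1
  have hun : S₂ ∪ S₁ = S := filter_not_union_filter S h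
  have hmul : coprimeDensity S₂ * coprimeDensity S₁ = coprimeDensity S := coprimeDensity_filter_mul S h
  have hP₁ := coprimeDensity_pos hp₁
  have hP₁1 := coprimeDensity_le_one hp₁
  have hP₂ := coprimeDensity_pos hp₂
  have hP := coprimeDensity_pos hS
  have hM := hmert h hh S hS
  rw [← hS₁] at hM
  have hmain : mainFactor S s h = coprimeDensity S ^ (2 * s) * (coprimeDensity S₁)⁻¹ ^ (s ^ 2) := rfl
  set P := coprimeDensity S
  set P₁ := coprimeDensity S₁
  set P₂ := coprimeDensity S₂
  set L := 1 + Real.log h with hL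
  have hL0 : 0 < L := by linarith
  have hLP : 1 / L ≤ C₃ * P₁ := by
    rw [inv_eq_one_div, div_le_iff₀ hP₁] at hM
    rw [div_le_iff₀ hL0]
    linarith
  set V := P₁ ^ (2 * s) * P₁⁻¹ ^ (s ^ 2) with hV
  have hV0 : 0 ≤ V := by positivity
  have hPV : P₁ ≤ V := by
    rw [hV, inv_pow, ← div_eq_mul_inv, le_div_iff₀ (by positivity), ← pow_succ']
    refine pow_le_pow_of_le_one hP₁.le hP₁1 ?_
    zify
    nlinarith [sq_nonneg ((s : ℤ) - 1)]
  set β := C₁ * (C₂ + C₃) * (h * V) with hβ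
  have hβ0 : 0 ≤ β := by positivity
  have hbase : mean (∏ l ∈ S₁, l) (fun n => siftDev S₁ (negClasses D) 1 h n ^ (2 * (m + 1)))
      ≤ √β ^ (2 * (m + 1)) := by
    refine (hsmall (negClasses D) h hh S₁ fun p hp =>
      isSmallPrime_negClasses hne hD (hp₁ p hp) (Finset.mem_filter.mp hp).2).trans ?_
    rw [pow_mul, Real.sq_sqrt hβ0]
    have h0 := varFactor_nonneg (S := S₁) (Ω := negClasses D)
    refine pow_le_pow_left₀ (by positivity) ?_ _
    have h1 := hvar S₁ hp₁
    have h2 : h / L ≤ C₃ * (h * V) := by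
      calc h / L = h * (1 / L) := by ring
        _ ≤ h * (C₃ * P₁) := by gcongr
        _ ≤ h * (C₃ * V) := by gcongr
        _ = _ := by ring
    have h3 : h * varFactor S₁ (negClasses D) ≤ C₂ * (h * V) := by
      calc h * varFactor S₁ (negClasses D) ≤ h * (C₂ * V) := by gcongr
        _ = _ := by ring
    rw [hβ, mul_assoc C₁]
    refine mul_le_mul_of_nonneg_left ?_ (by linarith)
    linarith
  have hfin := hlarge (negClasses D) h S₁ hp₁ √β (by positivity) hbase S₂ (fun p hp => by
    have h1 := isSmallPrime_negClasses (h := p) hne hD (hp₂ p hp) le_rfl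
    exact ⟨h1.1, (not_le.mp (Finset.mem_filter.mp hp).2).le, h1.2.2⟩) (fun p hp hp' =>
      (Finset.mem_filter.mp hp).2 (Finset.mem_filter.mp hp').2)
  rw [hun] at hfin
  refine hfin.trans ?_
  rw [pow_mul]
  refine pow_le_pow_left₀ (by positivity) ?_ _
  have hd₂ := hdens S₂ hp₂
  have hd := hdens S hS
  have hd₂0 := siftDensity_nonneg (Ω := negClasses D) hp₂
  set X := max (h * P ^ s) 1 with hX
  have hX0 : 0 ≤ X := le_trans zero_le_one (le_max_right _ _)
  have e1 : max (h * siftDensity S (negClasses D)) 1 ≤ C₄ * X := by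
    refine max_le ?_ ?_
    · calc h * siftDensity S (negClasses D) ≤ h * (C₄ * P ^ s) := by gcongr
        _ = C₄ * (h * P ^ s) := by ring
        _ ≤ _ := by gcongr; exact le_max_left _ _
    · exact one_le_mul_of_one_le_of_one_le hC₄ (le_max_right _ _)
  -- P₂^(2s) P₁^(2s) = P^(2s), so only the small primes keep the factor P₁^(-s²).
  have e2 : siftDensity S₂ (negClasses D) ^ 2 * β
      ≤ C₄ ^ 2 * (C₁ * (C₂ + C₃)) * (h * mainFactor S s h) := by
    calc _ ≤ (C₄ * P₂ ^ s) ^ 2 * β := by gcongr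
      _ = _ := by
        rw [hβ, hV, hmain, ← hmul]
        ring
  have e3 : 0 ≤ h * mainFactor S s h := by rw [hmain]; positivity
  calc (siftDensity S₂ (negClasses D) * √β + K * √(max (h * siftDensity S (negClasses D)) 1)) ^ 2
      ≤ 2 * (siftDensity S₂ (negClasses D) * √β) ^ 2
        + 2 * (K * √(max (h * siftDensity S (negClasses D)) 1)) ^ 2 := by
        nlinarith [sq_nonneg (siftDensity S₂ (negClasses D) * √β
          - K * √(max (h * siftDensity S (negClasses D)) 1))]
    _ = 2 * (siftDensity S₂ (negClasses D) ^ 2 * β)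
        + 2 * K ^ 2 * max (h * siftDensity S (negClasses D)) 1 := by
        rw [mul_pow, mul_pow, Real.sq_sqrt hβ0, Real.sq_sqrt (le_trans zero_le_one (le_max_right _ _))]
        ring
    _ ≤ 2 * (C₄ ^ 2 * (C₁ * (C₂ + C₃)) * (h * mainFactor S s h)) + 2 * K ^ 2 * (C₄ * X) := by
        gcongr
    _ ≤ _ := by
        have a1 : 0 ≤ 2 * C₄ ^ 2 * (C₁ * (C₂ + C₃)) * X := by positivity
        have a2 : 0 ≤ 2 * K ^ 2 * C₄ * (h * mainFactor S s h) := by positivity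
        linarith

/-- For the second moment the step at a large prime adds only a conditional variance and no higher
moment, so the floor 1 is absent. This is why k ≤ 2 needs no lower bound on h P^s. -/
theorem exists_mean_siftDev_sq_le_mainFactor (hne : D.Nonempty) (hD : Admissible D) :
    ∃ C : ℝ, 1 ≤ C ∧ ∀ h : ℕ, 0 < h → ∀ S : Finset ℕ, (∀ p ∈ S, p.Prime) →
      mean (∏ p ∈ S, p) (fun n => siftDev S (negClasses D) 1 h n ^ 2)
        ≤ C * (h * mainFactor S D.card h + h * coprimeDensity S ^ D.card) := by
  have hs : 1 ≤ D.card := hne.card_pos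
  have hs' : (1 : ℝ) ≤ D.card := by exact_mod_cast hs
  obtain ⟨C₂, hC₂, hvar⟩ := exists_varFactor_le D
  obtain ⟨C₄, hC₄, hdens⟩ := exists_siftDensity_le D
  set s := D.card with hsD
  refine ⟨4 * C₄ ^ 2 * C₂ + 2 * s ^ 3 * C₄, ?_, fun h hh S hS => ?_⟩
  · have h1 : 1 ≤ C₄ ^ 2 * C₂ := one_le_mul_of_one_le_of_one_le (one_le_pow₀ hC₄) hC₂
    have h2 : 0 ≤ 2 * (s : ℝ) ^ 3 * C₄ := by positivity
    linarith
  have hhR : (0 : ℝ) < h := by exact_mod_cast hh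
  set S₁ := S.filter (· ≤ h) with hS₁
  set S₂ := S.filter (¬ · ≤ h) with hS₂
  have hp₁ : ∀ p ∈ S₁, p.Prime := fun p hp => hS p (Finset.mem_filter.mp hp).1
  have hp₂ : ∀ p ∈ S₂, p.Prime := fun p hp => hS p (Finset.mem_filter.mp hp).1
  have hun : S₂ ∪ S₁ = S := filter_not_union_filter S h
  have hmul : coprimeDensity S₂ * coprimeDensity S₁ = coprimeDensity S := coprimeDensity_filter_mul S h
  have hP₁ := coprimeDensity_pos hp₁
  have hP₂ := coprimeDensity_pos hp₂
  have hP := coprimeDensity_pos hS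
  have hmain : mainFactor S s h = coprimeDensity S ^ (2 * s) * (coprimeDensity S₁)⁻¹ ^ (s ^ 2) := rfl
  have hfin := mean_siftDev_sq_union_le (Ω := negClasses D) (h := h) hs S₁ hp₁ S₂ (fun p hp => by
    have h1 := isSmallPrime_negClasses (h := p) hne hD (hp₂ p hp) le_rfl
    exact ⟨h1.1, (not_le.mp (Finset.mem_filter.mp hp).2).le, h1.2.2⟩) (fun p hp hp' =>
      (Finset.mem_filter.mp hp).2 (Finset.mem_filter.mp hp').2)
  rw [hun] at hfin
  have hbase := mean_siftDev_sq_le (Ω := negClasses D) hp₁ (fun p hp => (hp₁ p hp).not_dvd_one) h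
  have hd₂ := hdens S₂ hp₂
  have hd := hdens S hS
  have hd₂0 := siftDensity_nonneg (Ω := negClasses D) hp₂
  have hv := hvar S₁ hp₁
  have e3 : 0 ≤ h * mainFactor S s h := by rw [hmain]; positivity
  refine hfin.trans ?_
  set P := coprimeDensity S
  set P₁ := coprimeDensity S₁
  set P₂ := coprimeDensity S₂
  calc _ ≤ (C₄ * P₂ ^ s) ^ 2 * (4 * h * (C₂ * (P₁ ^ (2 * s) * P₁⁻¹ ^ (s ^ 2))))
        + 2 * s ^ 3 * (h * (C₄ * P ^ s)) := by
        refine add_le_add (mul_le_mul (pow_le_pow_left₀ hd₂0 hd₂ 2) (hbase.trans ?_)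
          (mean_nonneg fun _ => sq_nonneg _) (by positivity)) (by gcongr)
        gcongr
    _ = 4 * C₄ ^ 2 * C₂ * (h * mainFactor S s h) + 2 * s ^ 3 * C₄ * (h * P ^ s) := by
        rw [hmain, ← hmul]
        ring
    _ ≤ _ := by
        have a1 : 0 ≤ 4 * C₄ ^ 2 * C₂ * (h * P ^ s) := by positivity
        have a2 : 0 ≤ 2 * (s : ℝ) ^ 3 * C₄ * (h * mainFactor S s h) := by positivity
        linarith

/-- Moments of order `k` from an even moment. -/
theorem abs_mean_pow_le {N k : ℕ} (hN : 0 < N) {f : ℤ → ℝ} {X : ℝ} (hX : 0 ≤ X)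
    (h : mean N (fun n => f n ^ (2 * k)) ≤ X ^ k) : |mean N (fun n => f n ^ k)| ≤ X ^ ((k : ℝ) / 2) := by
  refine abs_le_of_sq_le_sq ?_ (Real.rpow_nonneg hX _)
  have h1 := mean_mul_sq_le N (fun n => f n ^ k) fun _ => 1
  simp only [mul_one, one_pow, mean_const hN] at h1
  have e : (X ^ ((k : ℝ) / 2)) ^ 2 = X ^ k := by
    rw [← Real.rpow_natCast (X ^ ((k : ℝ) / 2)) 2, ← Real.rpow_mul hX, ← Real.rpow_natCast X k]
    congr 1
    push_cast
    ring
  rw [e]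
  refine h1.trans (le_trans (le_of_eq (mean_congr fun n => ?_)) h)
  rw [← pow_mul, mul_comm k]

/-- The bound for the moments of order `k` from which both parts of the theorem follow. -/
theorem exists_abs_tupleMoment_le (hne : D.Nonempty) (hD : Admissible D) {k : ℕ} (hk : 0 < k) :
    ∃ C : ℝ, 1 ≤ C ∧ ∀ q h : ℕ, 0 < q → 0 < h → ∀ Y : ℝ,
      h * mainFactor q.primeFactors D.card h ≤ Y → h * reducedDensity q ^ D.card ≤ Y →
      (2 < k → 1 ≤ Y) → |tupleMoment D k q h| ≤ q * (C * Y) ^ ((k : ℝ) / 2) := by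
  have hpr : ∀ q : ℕ, ∀ p ∈ q.primeFactors, p.Prime := fun q p hp => Nat.prime_of_mem_primeFactors hp
  rcases le_or_gt k 2 with hk2 | hk2
  · obtain ⟨C, hC, hmain⟩ := exists_mean_siftDev_sq_le_mainFactor hne hD
    refine ⟨2 * C, by linarith, fun q h hq hh Y hY₁ hY₂ _ => ?_⟩
    have hY0 : 0 ≤ Y := le_trans (by rw [reducedDensity]; positivity) hY₂
    have hb := hmain h hh q.primeFactors (hpr q)
    rw [← reducedDensity_eq hq] at hb
    have hb' := hb.trans (show _ ≤ 2 * C * Y by nlinarith)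
    rw [tupleMoment_eq hq, abs_mul, Nat.abs_cast]
    refine mul_le_mul_of_nonneg_left ?_ (by positivity)
    rcases (by omega : k = 1 ∨ k = 2) with rfl | rfl
    · exact abs_mean_pow_le (prod_primes_pos (hpr q)) (by positivity) (by simpa using hb')
    · rw [abs_of_nonneg (mean_nonneg fun _ => sq_nonneg _)]
      simpa using hb'
  -- With k = m + 1 the even moment of order 2(m + 1) is the one of order 2k, from which
  -- Cauchy–Schwarz gives order k for either parity.
  · obtain ⟨m, rfl⟩ : ∃ m, k = m + 1 := ⟨k - 1, by omega⟩
    obtain ⟨C, hC, hmain⟩ := exists_mean_siftDev_pow_le_mainFactor hne hD (m := m) (by omega)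
    refine ⟨2 * C, by linarith, fun q h hq hh Y hY₁ hY₂ hY₃ => ?_⟩
    have hY1 := hY₃ hk2
    have hb := hmain h hh q.primeFactors (hpr q)
    rw [← reducedDensity_eq hq] at hb
    rw [tupleMoment_eq hq, abs_mul, Nat.abs_cast]
    refine mul_le_mul_of_nonneg_left ?_ (by positivity)
    refine abs_mean_pow_le (prod_primes_pos (hpr q)) (by positivity) (hb.trans ?_)
    have hm0 : 0 ≤ mainFactor q.primeFactors D.card h := by
      have a1 := coprimeDensity_pos (hpr q)
      have a2 := coprimeDensity_pos (T := q.primeFactors.filter (· ≤ h))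
        fun p hp => hpr q p (Finset.mem_filter.mp hp).1
      rw [mainFactor]
      positivity
    refine pow_le_pow_left₀ (mul_nonneg (by linarith) (add_nonneg (by positivity)
      (le_trans zero_le_one (le_max_right _ _)))) ?_ _
    have : max (h * reducedDensity q ^ D.card) 1 ≤ Y := max_le hY₂ hY1
    nlinarith

theorem tupleMoment_zero {k : ℕ} (hk : 0 < k) (q : ℕ) : tupleMoment D k q 0 = 0 := by
  simp [tupleMoment, tupleCount, hk.ne']

theorem reducedDensity_pos {q : ℕ} (hq : 0 < q) : 0 < reducedDensity q := by
  rw [reducedDensity_eq hq]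
  exact coprimeDensity_pos fun p hp => Nat.prime_of_mem_primeFactors hp

theorem reducedDensity_le_one {q : ℕ} (hq : 0 < q) : reducedDensity q ≤ 1 := by
  rw [reducedDensity_eq hq]
  exact coprimeDensity_le_one fun p hp => Nat.prime_of_mem_primeFactors hp

/-- A short interval, in the sense that `h < exp (1 / (k P ^ (1 / s)))`, has `P (log h) ^ s ≪ 1`. -/
theorem mul_one_add_log_pow_le {P : ℝ} (hP : 0 < P) (hP1 : P ≤ 1) {s k : ℕ} (hs : 1 ≤ s) (hk : 1 ≤ k)
    (hh : 0 < h) (hlt : (h : ℝ) < Real.exp (1 / (k * P ^ (1 / (s : ℝ))))) :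
    P * (1 + Real.log h) ^ s ≤ 2 ^ s := by
  have hlog : 0 ≤ Real.log h := Real.log_natCast_nonneg h
  have hk' : (1 : ℝ) ≤ k := by exact_mod_cast hk
  set u := P ^ (1 / (s : ℝ)) with hu
  have hu0 : 0 < u := Real.rpow_pos_of_pos hP _
  have hu1 : u ≤ 1 := Real.rpow_le_one hP.le hP1 (by positivity)
  have hus : u ^ s = P := by
    rw [hu, one_div]
    exact Real.rpow_inv_natCast_pow hP.le (by omega)
  have hl : Real.log h < 1 / (k * u) := (Real.log_lt_iff_lt_exp (by exact_mod_cast hh)).mpr hlt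
  rw [lt_div_iff₀ (by positivity)] at hl
  have h1 : u * (1 + Real.log h) ≤ 2 := by
    have : Real.log h * u ≤ Real.log h * (k * u) :=
      mul_le_mul_of_nonneg_left (le_mul_of_one_le_left hu0.le hk') hlog
    linarith
  rw [← hus, ← mul_pow]
  exact pow_le_pow_left₀ (by positivity) h1 s

end moments

/-! ### The two ranges of h -/

/-- Regrouping P^(2s) L^(s²) as (P L^s)^s P^s shows that the main factor has the size P^s of the
expected density as long as P L^s is bounded. -/
theorem mainFactor_le_of_short {P L C : ℝ} {S : Finset ℕ} {s h : ℕ} (hP : coprimeDensity S = P)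
    (hP0 : 0 < P) (hL : 0 ≤ L) (hC : 0 ≤ C)
    (hPL : P * L ^ s ≤ 2 ^ s) (hinv0 : 0 ≤ (coprimeDensity (S.filter (· ≤ h)))⁻¹)
    (hinv : (coprimeDensity (S.filter (· ≤ h)))⁻¹ ≤ C * L) :
    mainFactor S s h ≤ (2 * C) ^ (s ^ 2) * P ^ s := by
  rw [mainFactor, hP]
  calc P ^ (2 * s) * (coprimeDensity (S.filter (· ≤ h)))⁻¹ ^ (s ^ 2)
      ≤ P ^ (2 * s) * (C * L) ^ (s ^ 2) := by gcongr
    _ = C ^ (s ^ 2) * (P * L ^ s) ^ s * P ^ s := by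
        rw [mul_pow P, mul_pow C, ← pow_mul, ← sq]; ring
    _ ≤ C ^ (s ^ 2) * (2 ^ s) ^ s * P ^ s := by gcongr
    _ = _ := by rw [mul_pow, ← pow_mul, ← sq]; ring

theorem rpow_tuple_exponent {P : ℝ} (hP : 0 < P) (s k : ℕ) :
    (P ^ (2 * s) * P⁻¹ ^ (s ^ 2)) ^ ((k : ℝ) / 2) = P ^ ((s : ℝ) * k - (s : ℝ) ^ 2 * ((k : ℝ) / 2)) := by
  have e : P ^ (2 * s) * P⁻¹ ^ (s ^ 2) = P ^ (2 * (s : ℝ) - (s : ℝ) ^ 2) := by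
    rw [Real.rpow_sub hP, inv_pow, ← div_eq_mul_inv, ← Real.rpow_natCast P (2 * s),
      ← Real.rpow_natCast P (s ^ 2)]
    push_cast
    rfl
  rw [e, ← Real.rpow_mul hP.le]
  congr 1
  ring

theorem theorem4p2 (D : Finset ℤ) (hne : D.Nonempty) (hD : Admissible D)
    (k : ℕ) (hk : 0 < k) :
    (∃ C : ℝ, 0 < C ∧ ∀ q h : ℕ, 0 < q →
      (2 < k → 1 ≤ (h : ℝ) * reducedDensity q ^ D.card) →
      (h : ℝ) < Real.exp (1 / ((k : ℝ) * reducedDensity q ^ (1 / (D.card : ℝ)))) →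
      |tupleMoment D k q h| ≤
        C * ((q : ℝ) * ((h : ℝ) * reducedDensity q ^ D.card) ^ ((k : ℝ) / 2))) ∧
    (∃ C : ℝ, 0 < C ∧ ∀ q h : ℕ, 0 < q →
      (2 < k → D.card = 1 → 1 ≤ (h : ℝ) * reducedDensity q) →
      |tupleMoment D k q h| ≤
        C * ((q : ℝ) * (h : ℝ) ^ ((k : ℝ) / 2) *
          reducedDensity q ^ ((D.card : ℝ) * (k : ℝ) - (D.card : ℝ) ^ 2 * ((k : ℝ) / 2)))) := by
  obtain ⟨C, hC, hmain⟩ := exists_abs_tupleMoment_le hne hD hk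
  have hs : 1 ≤ D.card := hne.card_pos
  have hC0 : 0 < C := by linarith
  constructor
  · obtain ⟨C₃, hC₃, hmert⟩ := exists_inv_coprimeDensity_le
    set A : ℝ := (2 * C₃) ^ (D.card ^ 2) with hA
    have hA1 : 1 ≤ A := one_le_pow₀ (by linarith)
    refine ⟨(C * A) ^ ((k : ℝ) / 2), by positivity, fun q h hq h1 h2 => ?_⟩
    have hP := reducedDensity_pos hq
    rcases Nat.eq_zero_or_pos h with rfl | hh
    · rw [tupleMoment_zero hk, abs_zero]
      positivity
    have hpr : ∀ p ∈ q.primeFactors, p.Prime := fun p hp => Nat.prime_of_mem_primeFactors hp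
    have hlog : 0 ≤ Real.log h := Real.log_natCast_nonneg h
    have hle := mainFactor_le_of_short (reducedDensity_eq hq).symm hP
      (by linarith : 0 ≤ 1 + Real.log h) (by linarith : 0 ≤ C₃)
      (mul_one_add_log_pow_le hP (reducedDensity_le_one hq) hs hk hh h2)
      (inv_nonneg.mpr (coprimeDensity_pos fun p hp => hpr p (Finset.mem_filter.mp hp).1).le)
      (hmert h hh _ hpr)
    set X := (h : ℝ) * reducedDensity q ^ D.card with hX
    have hX0 : 0 ≤ X := by positivity
    have hXA : X ≤ A * X := le_mul_of_one_le_left hX0 hA1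
    refine (hmain q h hq hh (A * X) ?_ hXA fun hk2 => (h1 hk2).trans hXA).trans_eq ?_
    · calc (h : ℝ) * mainFactor q.primeFactors D.card h
          ≤ h * (A * reducedDensity q ^ D.card) := by gcongr
        _ = _ := by rw [hX]; ring
    · rw [← mul_assoc C, Real.mul_rpow (by positivity) hX0]
      ring
  · refine ⟨C ^ ((k : ℝ) / 2), by positivity, fun q h hq h1 => ?_⟩
    have hP := reducedDensity_pos hq
    have hP1 := reducedDensity_le_one hq
    rcases Nat.eq_zero_or_pos h with rfl | hh
    · rw [tupleMoment_zero hk, abs_zero]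
      positivity
    have hh1 : (1 : ℝ) ≤ h := by exact_mod_cast hh
    have hpr : ∀ p ∈ q.primeFactors, p.Prime := fun p hp => Nat.prime_of_mem_primeFactors hp
    -- Dropping the primes p > h can only increase the density; for part (ii) this replaces P₁ by P
    -- in the main factor.
    have hPle : reducedDensity q ≤ coprimeDensity (q.primeFactors.filter (· ≤ h)) := by
      rw [reducedDensity_eq hq, ← coprimeDensity_filter_mul _ h]
      exact mul_le_of_le_one_left
        (coprimeDensity_pos fun p hp => hpr p (Finset.mem_filter.mp hp).1).le
        (coprimeDensity_le_one fun p hp => hpr p (Finset.mem_filter.mp hp).1)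
    rw [← rpow_tuple_exponent hP]
    set s := D.card
    have hfac : mainFactor q.primeFactors s h
        ≤ reducedDensity q ^ (2 * s) * (reducedDensity q)⁻¹ ^ (s ^ 2) := by
      rw [mainFactor, ← reducedDensity_eq hq]
      have h3 : (coprimeDensity (q.primeFactors.filter (· ≤ h)))⁻¹ ≤ (reducedDensity q)⁻¹ :=
        inv_anti₀ hP hPle
      have h4 : 0 ≤ (coprimeDensity (q.primeFactors.filter (· ≤ h)))⁻¹ :=
        inv_nonneg.mpr (hP.le.trans hPle)
      gcongr
    set P := reducedDensity q
    -- Used with three exponents: a = s bounds h P^s by the main term; for s ≥ 2 one has 2s - s² ≤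
    -- 0, so a = 0 makes the main term at least 1 automatically; for s = 1 the choice a = 1 reduces
    -- this to the hypothesis h P ≥ 1.
    have hpow : ∀ a : ℕ, 2 * s ≤ a + s ^ 2 → P ^ a ≤ P ^ (2 * s) * P⁻¹ ^ (s ^ 2) := fun a ha => by
      rw [inv_pow, ← div_eq_mul_inv, le_div_iff₀ (by positivity), ← pow_add]
      exact pow_le_pow_of_le_one hP.le hP1 ha
    refine (hmain q h hq hh (h * (P ^ (2 * s) * P⁻¹ ^ (s ^ 2))) (by gcongr) ?_ fun hk2 => ?_).trans_eq ?_
    · have := hpow s (by nlinarith)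
      gcongr
    · rcases Nat.lt_or_ge s 2 with hs2 | hs2
      · have hs1 : s = 1 := by omega
        refine (h1 hk2 hs1).trans ?_
        have := hpow 1 (by rw [hs1]; norm_num)
        rw [pow_one] at this
        gcongr
      · have := hpow 0 (by nlinarith)
        rw [pow_zero] at this
        exact one_le_mul_of_one_le_of_one_le hh1 this
    · rw [← mul_assoc C, Real.mul_rpow (by positivity) (by positivity),
        Real.mul_rpow (by positivity) (by positivity)]
      ring
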